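/- All function spaces below consist of real functions on $\mathbb R$, and functions in $W^{1,1}_{\rm loc}(\mathbb R)$ are identified with their continuous representatives. Let $V$ be the set of $f\in W^{1,1}_{\rm loc}(\mathbb R)$ for which there is $\alpha\in\mathbb R$ with $f(\xi+1)=f(\xi)+\alpha$ for all $\xi$. Let $V_1$ be the set of those $f$ with $\alpha=1$, and $W^{1,1}_{\rm per}$ the set of those with $\alpha=0$. Put $\|f\|_V=\|f\|_{L^\infty([0,1])}+\|f_\xi\|_{L^1([0,1])}$. Let $L^1_{\rm per}$ be the space of locally integrable functions of period $1$ (modulo a.e. equality) with norm $\|f\|_{L^1([0,1])}$. Let $E=V\times W^{1,1}_{\rm per}\times L^1_{\rm per}$ with $$\|(y,U,\nu)\|_E=\|y\|_V+\|U\|_V+\|\nu\|_{L^1([0,1])}.$$ For $X=(y,U,\nu)$ put $$Q(\xi)=-\tfrac14\int_{\mathbb R}\operatorname{sign}(\xi-\eta)\,e^{-\operatorname{sign}(\xi-\eta)(y(\xi)-y(\eta))}(U^2y_\xi+\nu)(\eta)\,d\eta,\qquad P(\xi)=\tfrac14\int_{\mathbb R}e^{-\operatorname{sign}(\xi-\eta)(y(\xi)-y(\eta))}(U^2y_\xi+\nu)(\eta)\,d\eta,$$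 and consider the system $$y_t=U,\qquad U_t=-Q,\qquad \nu_t=-2QUy_\xi+(3U^2-2P)U_\xi.\tag{1}$$ Let $\mathcal F$ be the set of $(y,U,\nu)\in E$ with $y\in V_1$, $y,U\in W^{1,\infty}_{\rm loc}(\mathbb R)$, $\nu\in L^\infty$ such that, almost everywhere, $y_\xi\ge0$, $\nu\ge0$, $y_\xi+\nu\ge c$ for some constant $c>0$, and $y_\xi\nu=y_\xi^2U^2+U_\xi^2$. Write $h=\|\nu\|_{L^1([0,1])}$. Let $\mathcal H$ be the set of $(y,U,\nu)\in\mathcal F$ with $y_\xi+\nu=1+h$ a.e. and $\int_0^1y\,d\xi=0$. For $M>0$ let $\mathcal H^M=\{X\in\mathcal H: h\le M\}$. Let $W^{1,\infty}_{\rm per}$ be the set of functions in $W^{1,\infty}_{\rm loc}(\mathbb R)$ of period $1$. Let $G$ be the set of invertible $f:\mathbb R\to\mathbb R$ with $f\in W^{1,\infty}_{\rm loc}(\mathbb R)$, $f(\xi+1)=f(\xi)+1$ for all $\xi$, and $f-\mathrm{id},\,f^{-1}-\mathrm{id}\in W^{1,\infty}_{\rm per}$. It acts by $(y,U,\nu)\bullet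 f=(y\circ f,U\circ f,(\nu\circ f)f_\xi)$. Let $\Pi:\mathcal F\to\mathcal H$ be $\Pi=\Pi_2\circ\Pi_1$, where $\Pi_1(X)=X\bullet f^{-1}$ with $f(\xi)=\frac1{1+h}\big(y(\xi)+\int_0^\xi\nu\,d\eta\big)$, and $\Pi_2(X)=X(\cdot-a)$ with $a=\int_0^1y\,d\xi$. For $X,Y\in\mathcal F$ let $J(X,Y)=\inf_{f,g\in G}\|X\bullet f-Y\bullet g\|_E$. For $X,Y\in\mathcal H^M$ let $$d_M(X,Y)=\inf\sum_{n=1}^NJ(X_{n-1},X_n),$$ where the infimum is over all finite sequences $X_0,\dots,X_N$ in $\mathcal H^M$ with $X_0=X$ and $X_N=Y$. **Theorem.** For every $X\in\mathcal F$ the system (1) has a unique global solution in $C^1([0,\infty),E)$ with initial value $X$, and it stays in $\mathcal F$. Denote its value at time $t$ by $S_tX$ and let $\bar S_t=\Pi\circ S_t$. Given $T>0$ and $M>0$, there is a constant $C_M$, depending only on $M$ and $T$, such that for all $X_\alpha,X_\beta\in\mathcal H^M$ and all $t\in[0,T]$ one has $\bar S_tX_\alpha,\bar S_tX_\beta\in\mathcal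 H^M$, $d_M(X_\alpha,X_\beta)<\infty$ and $$d_M(\bar S_tX_\alpha,\bar S_tX_\beta)\le C_M\,d_M(X_\alpha,X_\beta).$$ -/

import Mathlib

open MeasureTheory Filter Topology
open scoped ENNReal NNReal

namespace CamassaHolm

/-- `f ∈ W^{1,1}_loc(ℝ)`, through the (unique) continuous representative: `f` is absolutely
continuous on every compact interval.  Its weak derivative is the a.e. derivative `deriv f`. -/
def W11Loc (f : ℝ → ℝ) : Prop :=
  ∀ a b : ℝ, AbsolutelyContinuousOnInterval f a b

/-- `f ∈ W^{1,∞}_loc(ℝ)`, through the continuous representative: `f` is locally Lipschitz. -/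
def W1infLoc (f : ℝ → ℝ) : Prop :=
  LocallyLipschitz f

/-- `f ∈ W^{1,∞}_per`, period one. -/
def W1infPer (f : ℝ → ℝ) : Prop :=
  W1infLoc f ∧ Function.Periodic f 1

/-- `V = {f ∈ W^{1,1}_loc | ∃ α, f(ξ+1) = f(ξ) + α for all ξ}`. -/
def V : Set (ℝ → ℝ) :=
  {f | W11Loc f ∧ ∃ α : ℝ, ∀ ξ, f (ξ + 1) = f ξ + α}

/-- `V₁ = {f ∈ W^{1,1}_loc | f(ξ+1) = f(ξ) + 1 for all ξ}`. -/
def V₁ : Set (ℝ → ℝ) :=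
  {f | W11Loc f ∧ ∀ ξ, f (ξ + 1) = f ξ + 1}

/-- `W^{1,1}_per`, period one. -/
def W11Per : Set (ℝ → ℝ) :=
  {f | W11Loc f ∧ Function.Periodic f 1}

/-- `L¹_per`, as representatives: one-periodic, locally integrable functions. -/
def L1Per : Set (ℝ → ℝ) :=
  {f | LocallyIntegrable f volume ∧ Function.Periodic f 1}

/-- `‖f‖_{L^∞([0,1])}`. -/
noncomputable def normLinf (f : ℝ → ℝ) : ℝ≥0∞ :=
  eLpNorm f ∞ (volume.restrict (Set.Icc 0 1))

/-- `‖f‖_{L^1([0,1])}`. -/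
noncomputable def normL1 (f : ℝ → ℝ) : ℝ≥0∞ :=
  eLpNorm f 1 (volume.restrict (Set.Icc 0 1))

/-- `‖f‖_V = ‖f‖_{L^∞([0,1])} + ‖f_ξ‖_{L^1([0,1])}`, which is also the norm of `W^{1,1}_per`. -/
noncomputable def normV (f : ℝ → ℝ) : ℝ≥0∞ :=
  normLinf f + normL1 (deriv f)

/-- Triples `X = (y, U, ν)`, with pointwise vector space operations. -/
abbrev Triple : Type := (ℝ → ℝ) × (ℝ → ℝ) × (ℝ → ℝ)

namespace Triple

/-- The characteristics. -/
abbrev y (X : Triple) : ℝ → ℝ := X.1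

/-- The Lagrangian velocity. -/
abbrev U (X : Triple) : ℝ → ℝ := X.2.1

/-- The Lagrangian energy density. -/
abbrev ν (X : Triple) : ℝ → ℝ := X.2.2

end Triple

/-- `E = V × W^{1,1}_per × L¹_per`.  The third component is a representative of its class: two
triples stand for the same element of `E` when they are related by `SameE`. -/
def E : Set Triple :=
  {X | X.y ∈ V ∧ X.U ∈ W11Per ∧ X.ν ∈ L1Per}

/-- Equality of elements of `E` (the third components agree almost everywhere). -/
def SameE (X Y : Triple) : Prop :=
  X.y = Y.y ∧ X.U = Y.U ∧ X.ν =ᵐ[volume] Y.ν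

/-- The norm of `E`. -/
noncomputable def normE (X : Triple) : ℝ≥0∞ :=
  normV X.y + normV X.U + normL1 X.ν

/-- `Q(ξ) = -1/4 ∫_ℝ sign(ξ-η) exp(-sign(ξ-η)(y(ξ)-y(η))) (U² y_ξ + ν)(η) dη`. -/
noncomputable def Q (X : Triple) (ξ : ℝ) : ℝ :=
  -(1 / 4) * ∫ η : ℝ, Real.sign (ξ - η) *
    Real.exp (-(Real.sign (ξ - η) * (X.y ξ - X.y η))) * (X.U η ^ 2 * deriv X.y η + X.ν η)

/-- `P(ξ) = 1/4 ∫_ℝ exp(-sign(ξ-η)(y(ξ)-y(η))) (U² y_ξ + ν)(η) dη`. -/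
noncomputable def P (X : Triple) (ξ : ℝ) : ℝ :=
  (1 / 4) * ∫ η : ℝ,
    Real.exp (-(Real.sign (ξ - η) * (X.y ξ - X.y η))) * (X.U η ^ 2 * deriv X.y η + X.ν η)

/-- The right-hand side of the Lagrangian system
`y_t = U`, `U_t = -Q`, `ν_t = -2 Q U y_ξ + (3 U² - 2 P) U_ξ`. -/
noncomputable def rhs (X : Triple) : Triple :=
  (X.U, fun ξ => -Q X ξ,
    fun ξ => -2 * Q X ξ * X.U ξ * deriv X.y ξ + (3 * X.U ξ ^ 2 - 2 * P X ξ) * deriv X.U ξ)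

/-- `Z ∈ C¹(ℝ₊, E)` solves `Z_t = rhs Z` with `Z(0) = X₀`; derivative and continuity are with
respect to the norm of `E`, on `ℝ₊ = [0, ∞)` (one-sided at `t = 0`). -/
structure IsSolution (X₀ : Triple) (Z : ℝ → Triple) : Prop where
  init : Z 0 = X₀
  mem : ∀ t, 0 ≤ t → Z t ∈ E
  rhs_mem : ∀ t, 0 ≤ t → rhs (Z t) ∈ E
  hasDeriv : ∀ t, 0 ≤ t →
    Tendsto (fun s => normE ((s - t)⁻¹ • (Z s - Z t) - rhs (Z t)))
      (𝓝[Set.Ici 0 \ {t}] t) (𝓝 0)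
  cont_deriv : ∀ t, 0 ≤ t →
    Tendsto (fun s => normE (rhs (Z s) - rhs (Z t))) (𝓝[Set.Ici 0] t) (𝓝 0)

/-- The set `𝓕` of Lagrangian coordinates. -/
def F : Set Triple :=
  {X | X ∈ E ∧
    X.y ∈ V₁ ∧ W1infLoc X.y ∧ W1infLoc X.U ∧ MemLp X.ν ∞ volume ∧
    (∀ᵐ ξ : ℝ, 0 ≤ deriv X.y ξ) ∧ (∀ᵐ ξ : ℝ, 0 ≤ X.ν ξ) ∧
    (∃ c : ℝ, 0 < c ∧ ∀ᵐ ξ : ℝ, c ≤ deriv X.y ξ + X.ν ξ) ∧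
    (∀ᵐ ξ : ℝ, deriv X.y ξ * X.ν ξ = deriv X.y ξ ^ 2 * X.U ξ ^ 2 + deriv X.U ξ ^ 2)}

open Classical in
/-- The solution operator `S_t`: the value at time `t` of the global solution with initial data
`X` (and, by convention, `X` itself if there were no global solution). -/
noncomputable def S (t : ℝ) (X : Triple) : Triple :=
  if h : ∃ Z, IsSolution X Z then h.choose t else X

/-- The group `G` of relabeling functions. -/
def G : Set (ℝ → ℝ) :=
  {f | W1infLoc f ∧ (∀ ξ, f (ξ + 1) = f ξ + 1) ∧
    ∃ g : ℝ → ℝ, Function.LeftInverse g f ∧ Function.RightInverse g f ∧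
      W1infPer (fun ξ => f ξ - ξ) ∧ W1infPer (fun ξ => g ξ - ξ)}

/-- The action `X • f = (y ∘ f, U ∘ f, (ν ∘ f) f_ξ)`. -/
noncomputable def act (X : Triple) (f : ℝ → ℝ) : Triple :=
  (fun ξ => X.y (f ξ), fun ξ => X.U (f ξ), fun ξ => X.ν (f ξ) * deriv f ξ)

/-- The total energy `h = ‖ν‖_{L^1([0,1])}`. -/
noncomputable def energy (X : Triple) : ℝ :=
  ∫ ξ in (0 : ℝ)..1, |X.ν ξ|

/-- `𝓕₀ = {X ∈ 𝓕 | y_ξ + ν = 1 + h a.e.}`. -/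
def F₀ : Set Triple :=
  {X | X ∈ F ∧ ∀ᵐ ξ : ℝ, deriv X.y ξ + X.ν ξ = 1 + energy X}

/-- `𝓗 = {X ∈ 𝓕₀ | ∫₀¹ y = 0}`. -/
def H : Set Triple :=
  {X | X ∈ F₀ ∧ ∫ ξ in (0 : ℝ)..1, X.y ξ = 0}

/-- `𝓗^M = {X ∈ 𝓗 | h ≤ M}`. -/
def HM (M : ℝ) : Set Triple :=
  {X | X ∈ H ∧ energy X ≤ M}

/-- `Π₁ : 𝓕 → 𝓕₀`, `Π₁ X = X • f⁻¹` with `f = (y + ∫₀^ξ ν) / (1 + h)`. -/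
noncomputable def proj₁ (X : Triple) : Triple :=
  act X (Function.invFun fun ξ => (1 / (1 + energy X)) * (X.y ξ + ∫ η in (0 : ℝ)..ξ, X.ν η))

/-- `Π₂ : 𝓕₀ → 𝓗`, `Π₂ X = X(· - a)` with `a = ∫₀¹ y`. -/
noncomputable def proj₂ (X : Triple) : Triple :=
  act X fun ξ => ξ - ∫ η in (0 : ℝ)..1, X.y η

/-- The projection `Π : 𝓕 → 𝓗`: first `Π₁`, then `Π₂`. -/
noncomputable def proj (X : Triple) : Triple :=
  proj₂ (proj₁ X)

/-- The semigroup `S̄_t = Π ∘ S_t`. -/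
noncomputable def Sbar (t : ℝ) (X : Triple) : Triple :=
  proj (S t X)

/-- `J(X, Y) = inf_{f, g ∈ G} ‖X • f - Y • g‖_E`. -/
noncomputable def J (X Y : Triple) : ℝ≥0∞ :=
  ⨅ f ∈ G, ⨅ g ∈ G, normE (act X f - act Y g)

/-- `d_M(X, Y)`: the infimum of `∑_{n=1}^N J(X_{n-1}, X_n)` over all finite sequences
`X_0, …, X_N` in `𝓗^M` with `X_0 = X` and `X_N = Y`. -/
noncomputable def dM (M : ℝ) (X Y : Triple) : ℝ≥0∞ :=
  ⨅ (N : ℕ) (c : ℕ → Triple) (_ : c 0 = X) (_ : c N = Y) (_ : ∀ n ≤ N, c n ∈ HM M),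
    ∑ n ∈ Finset.range N, J (c n) (c (n + 1))

end CamassaHolm

open CamassaHolm

/-! The pseudo-distance `J` is an infimum over relabelings, so the estimate needs a norm and
constants that relabelings leave alone. The supremum of `U` and the `L¹` norms of `y_ξ`, `U_ξ`, `ν`
over a period are invariant under `X ↦ X • f`; the suprema of `y_ξ` and `ν` are not. On `F` the
invariant quantities are all controlled by the energy `h` (`F.bnd`): the integral of `y_ξ` over a
period is `1`, and the algebraic relation gives `U_ξ² ≤ y_ξ ν` and `U² y_ξ ≤ ν`.

Under such bounds the vector field is Lipschitz in the norm of `E` (`rhs_lipschitz`). `P` and `Q`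
depend only on differences of `y`, the relation `y(ξ+1) = y(ξ)+1` reduces their integrals to one
period (`Adm.leftConv_period`), and `Q_ξ = y_ξ P - (U² y_ξ + ν)/2` shows that no derivative is lost.
As `h` is conserved, Gronwall's inequality yields uniqueness and a Lipschitz constant for `S t` that
depends only on `M` and `T` (`nE_S_sub_le`). The system commutes with relabeling, so by uniqueness
`S t (X • f)` and `(S t X) • f` represent the same element (`Relabel.S_act`). Hence the flow expands
`J` at most by that constant (`J_S_le`). The projection acts on each `X` as a relabeling and does
not increase `J` (`J_proj_le`). Applying the semigroup to every member of a chain in `HM M` and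
summing gives the bound for `dM`.

Global existence is proved in the smaller Banach space `State` of bounded functions defined at every
point, which encode `y_ξ`, `U_ξ`, `ν` together with `y(0)` and `U(0)`. The field is locally
Lipschitz there, and evaluation at a point is a continuous functional, so for each fixed `ξ` the
relation defining `F` and the sum `y_ξ + ν` obey scalar differential equations (`Flow.ident`,
`Flow.good`). Conservation of energy bounds `U`, `P`, `Q`, and Gronwall's inequality for `y_ξ + ν`
then excludes blow-up (`Flow.norm_le`). -/

namespace CamassaHolm

/-! ### Calculus of locally absolutely continuous functions. -/

section AbsolutelyContinuous

theorem lipschitzOnWith_comp_absolutelyContinuousOnInterval {φ f : ℝ → ℝ} {K : ℝ≥0} {a b : ℝ}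
    (hφ : LipschitzOnWith K φ (f '' Set.uIcc a b)) (hf : AbsolutelyContinuousOnInterval f a b) :
    AbsolutelyContinuousOnInterval (fun x => φ (f x)) a b := by
  rw [absolutelyContinuousOnInterval_iff] at hf ⊢
  intro ε hε
  -- Dividing by `K + 1` covers the case `K = 0` and makes the final inequality strict.
  obtain ⟨δ, hδ, h⟩ := hf (ε / (K + 1)) (by positivity)
  refine ⟨δ, hδ, fun E hE hs => ?_⟩
  calc ∑ i ∈ Finset.range E.1, dist (φ (f (E.2 i).1)) (φ (f (E.2 i).2))
      ≤ ∑ i ∈ Finset.range E.1, K * dist (f (E.2 i).1) (f (E.2 i).2) :=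
        Finset.sum_le_sum fun i hi => hφ.dist_le_mul _ ⟨_, (hE.1 i hi).1, rfl⟩ _
          ⟨_, (hE.1 i hi).2, rfl⟩
    _ = K * ∑ i ∈ Finset.range E.1, dist (f (E.2 i).1) (f (E.2 i).2) := by rw [Finset.mul_sum]
    _ ≤ K * (ε / (K + 1)) := by gcongr; exact (h E hE hs).le
    _ < (K + 1) * (ε / (K + 1)) := by gcongr; linarith
    _ = ε := by field

namespace W11Loc

variable {f g : ℝ → ℝ}

theorem continuous (hf : W11Loc f) : Continuous f := by
  rw [continuous_iff_continuousAt]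
  intro x
  have := (hf (x - 1) (x + 1)).continuousOn
  refine this.continuousAt ?_
  rw [Set.uIcc_of_le (by linarith)]
  exact Icc_mem_nhds (by linarith) (by linarith)

theorem add (hf : W11Loc f) (hg : W11Loc g) : W11Loc (fun x => f x + g x) :=
  fun a b => (hf a b).add (hg a b)

theorem sub (hf : W11Loc f) (hg : W11Loc g) : W11Loc (fun x => f x - g x) :=
  fun a b => (hf a b).sub (hg a b)

theorem neg (hf : W11Loc f) : W11Loc (fun x => - f x) :=
  fun a b => (hf a b).neg

theorem mul (hf : W11Loc f) (hg : W11Loc g) : W11Loc (fun x => f x * g x) :=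
  fun a b => (hf a b).mul (hg a b)

theorem const_mul (c : ℝ) (hf : W11Loc f) : W11Loc (fun x => c * f x) :=
  fun a b => (hf a b).const_mul c

theorem of_locallyLipschitz (hf : LocallyLipschitz f) : W11Loc f := by
  intro a b
  obtain ⟨K, hK⟩ := (hf.locallyLipschitzOn (s := Set.uIcc a b)).exists_lipschitzOnWith_of_compact
    isCompact_uIcc
  exact hK.absolutelyContinuousOnInterval

theorem const (c : ℝ) : W11Loc (fun _ => c) :=
  of_locallyLipschitz (LipschitzWith.const c).locallyLipschitz

theorem id : W11Loc (fun x => x) :=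
  of_locallyLipschitz LipschitzWith.id.locallyLipschitz

theorem comp_of_contDiff {φ : ℝ → ℝ} (hφ : ContDiff ℝ 1 φ) (hf : W11Loc f) :
    W11Loc (fun x => φ (f x)) := by
  intro a b
  obtain ⟨K, hK⟩ := (hφ.locallyLipschitz.locallyLipschitzOn
    (s := f '' Set.uIcc a b)).exists_lipschitzOnWith_of_compact
    (isCompact_uIcc.image_of_continuousOn hf.continuous.continuousOn)
  exact lipschitzOnWith_comp_absolutelyContinuousOnInterval hK (hf a b)

theorem exp (hf : W11Loc f) : W11Loc (fun x => Real.exp (f x)) :=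
  hf.comp_of_contDiff Real.contDiff_exp

theorem intervalIntegrable_deriv (hf : W11Loc f) (a b : ℝ) :
    IntervalIntegrable (deriv f) volume a b :=
  (hf a b).intervalIntegrable_deriv

theorem integral_deriv (hf : W11Loc f) (a b : ℝ) : ∫ x in a..b, deriv f x = f b - f a :=
  (hf a b).integral_deriv_eq_sub

theorem ae_differentiableAt (hf : W11Loc f) : ∀ᵐ x : ℝ, DifferentiableAt ℝ f x := by
  have : ∀ n : ℕ, ∀ᵐ x : ℝ, x ∈ Set.uIcc (-(n : ℝ)) n → DifferentiableAt ℝ f x :=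
    fun n => (hf _ _).ae_differentiableAt
  rw [← ae_all_iff] at this
  filter_upwards [this] with x hx
  obtain ⟨n, hn⟩ := exists_nat_ge |x|
  refine hx n ?_
  rw [Set.uIcc_of_le (by linarith [abs_nonneg x])]
  exact abs_le.1 hn

theorem integral_of_ae_eq (hf : W11Loc f) (h : deriv f =ᵐ[volume] g) (a b : ℝ) :
    ∫ x in a..b, g x = f b - f a := by
  rw [← hf.integral_deriv a b]
  exact intervalIntegral.integral_congr_ae (by filter_upwards [h] with x hx _ using hx.symm)

end W11Loc

/-- Primitives of locally integrable functions. -/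
theorem w11Loc_primitive {g : ℝ → ℝ} (hg : ∀ a b, IntervalIntegrable g volume a b) (c : ℝ) :
    W11Loc (fun x => ∫ t in c..x, g t) := by
  intro a b
  refine ((hg (min c (min a b)) (max c (max a b))).absolutelyContinuousOnInterval_intervalIntegral
    (c := c) ?_).mono ?_
  · rw [Set.uIcc_of_le (by simp)]; simp
  · rw [Set.uIcc_of_le (by simp : min c (min a b) ≤ max c (max a b)), Set.uIcc]
    exact Set.Icc_subset_Icc (by simp) (by simp)

theorem locallyIntegrable_iff_intervalIntegrable {g : ℝ → ℝ} :
    LocallyIntegrable g volume ↔ ∀ a b, IntervalIntegrable g volume a b := by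
  constructor
  · intro h a b
    exact (h.integrableOn_isCompact isCompact_uIcc).intervalIntegrable
  · intro h x
    refine ⟨Set.Ioo (x - 1) (x + 1), Ioo_mem_nhds (by linarith) (by linarith), ?_⟩
    have := (h (x - 1) (x + 1)).1
    exact this.mono_set Set.Ioo_subset_Ioc_self

theorem deriv_primitive {g : ℝ → ℝ} (hg : ∀ a b, IntervalIntegrable g volume a b) (c : ℝ) :
    ∀ᵐ x : ℝ, HasDerivAt (fun x => ∫ t in c..x, g t) (g x) x := by
  filter_upwards [LocallyIntegrable.ae_hasDerivAt_integral
    (locallyIntegrable_iff_intervalIntegrable.2 hg)] with x hx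
  exact hx c

/-- Needed because every fact about integrals over a right half-line is obtained from the left one
by reflection. The reflected function is rewritten as a primitive. -/
theorem W11Loc.comp_neg {f : ℝ → ℝ} (hf : W11Loc f) : W11Loc (fun x => f (-x)) := by
  have key : (fun x => f (-x)) = fun x => f 0 - ∫ t in (0 : ℝ)..x, deriv f (-t) := by
    funext x
    rw [intervalIntegral.integral_comp_neg (fun t => deriv f t), hf.integral_deriv]
    simp
  rw [key]
  refine (W11Loc.const (f 0)).sub (w11Loc_primitive (fun a b => ?_) 0)
  have := hf.intervalIntegrable_deriv (-a) (-b)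
  rwa [IntervalIntegrable.iff_comp_neg, neg_neg, neg_neg] at this

theorem W11Loc.const_smul {f : ℝ → ℝ} (c : ℝ) (hf : W11Loc f) : W11Loc (c • f) :=
  hf.const_mul c

theorem periodic_deriv {f : ℝ → ℝ} {α : ℝ} (h : ∀ ξ, f (ξ + 1) = f ξ + α) :
    Function.Periodic (deriv f) 1 := by
  intro ξ
  rw [← deriv_comp_add_const]
  simp_rw [h]
  simp

end AbsolutelyContinuous

/-! ### The norm of `E`, its affine subspace `E₁`, and equality of elements. -/

section Norms

theorem normL1_eq {f : ℝ → ℝ} (h : IntervalIntegrable f volume 0 1) :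
    normL1 f = ENNReal.ofReal (∫ x in (0 : ℝ)..1, |f x|) := by
  have h' : Integrable f (volume.restrict (Set.Icc 0 1)) := by
    have := h.1
    rwa [← integrableOn_Icc_iff_integrableOn_Ioc] at this
  rw [normL1, eLpNorm_one_eq_lintegral_enorm, intervalIntegral.integral_of_le zero_le_one,
    ← integral_Icc_eq_integral_Ioc, ← ofReal_integral_norm_eq_lintegral_enorm h']
  rfl

theorem normLinf_le {f : ℝ → ℝ} {C : ℝ} (h : ∀ x ∈ Set.Icc (0 : ℝ) 1, |f x| ≤ C) :
    normLinf f ≤ ENNReal.ofReal C := by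
  rw [normLinf]
  refine le_trans (eLpNorm_le_of_ae_bound (C := C) ?_) ?_
  · filter_upwards [ae_restrict_mem measurableSet_Icc] with x hx using h x hx
  · simp

/-- For a continuous function the essential supremum is a pointwise bound: a violation in the open
interval would persist on an open set of positive measure, and the endpoints follow by closure. -/
theorem le_normLinf {f : ℝ → ℝ} (hf : Continuous f) {x : ℝ} (hx : x ∈ Set.Icc (0 : ℝ) 1) :
    ENNReal.ofReal |f x| ≤ normLinf f := by
  have h1 : ∀ᵐ y ∂(volume.restrict (Set.Icc (0 : ℝ) 1)), ‖f y‖ₑ ≤ normLinf f := by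
    rw [normLinf, eLpNorm_exponent_top]
    exact ae_le_eLpNormEssSup
  have h1' : ∀ᵐ y ∂(volume.restrict (Set.Ioo (0 : ℝ) 1)), ‖f y‖ₑ ≤ normLinf f :=
    ae_mono (Measure.restrict_mono Set.Ioo_subset_Icc_self le_rfl) h1
  have h2 : ∀ y ∈ Set.Ioo (0 : ℝ) 1, ‖f y‖ₑ ≤ normLinf f := by
    by_contra! hc
    obtain ⟨y, hy, hlt⟩ := hc
    have ho : IsOpen {z | normLinf f < ‖f z‖ₑ} := isOpen_lt continuous_const hf.enorm
    have hpos : 0 < volume ({z | normLinf f < ‖f z‖ₑ} ∩ Set.Ioo (0 : ℝ) 1) :=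
      (ho.inter isOpen_Ioo).measure_pos _ ⟨y, hlt, hy⟩
    rw [ae_restrict_iff' measurableSet_Ioo, ae_iff] at h1'
    refine hpos.ne' (measure_mono_null ?_ h1')
    rintro z ⟨hz1, hz2⟩
    simp only [Set.mem_ofPred_eq, Classical.not_imp, not_le]
    exact ⟨hz2, hz1⟩
  have h3 : Set.Icc (0 : ℝ) 1 ⊆ {y | ‖f y‖ₑ ≤ normLinf f} := by
    rw [← closure_Ioo zero_ne_one]
    exact closure_minimal h2 (isClosed_le hf.enorm continuous_const)
  have := h3 hx
  rwa [Set.mem_ofPred_eq, ← ofReal_norm] at this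

theorem normLinf_add_le {f g : ℝ → ℝ} (hf : Continuous f) (hg : Continuous g) :
    normLinf (f + g) ≤ normLinf f + normLinf g :=
  eLpNorm_add_le hf.aestronglyMeasurable hg.aestronglyMeasurable (by simp)

theorem normL1_congr {f g : ℝ → ℝ} (h : f =ᵐ[volume] g) : normL1 f = normL1 g :=
  eLpNorm_congr_ae (ae_restrict_of_ae h)

theorem normL1_add_le {f g : ℝ → ℝ} (hf : AEStronglyMeasurable f volume)
    (hg : AEStronglyMeasurable g volume) : normL1 (f + g) ≤ normL1 f + normL1 g :=
  eLpNorm_add_le hf.restrict hg.restrict (by simp)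

theorem deriv_add_ae {f g : ℝ → ℝ} (hf : W11Loc f) (hg : W11Loc g) :
    deriv (f + g) =ᵐ[volume] deriv f + deriv g := by
  filter_upwards [hf.ae_differentiableAt, hg.ae_differentiableAt] with x h1 h2
  exact deriv_add h1 h2

theorem deriv_sub_ae {f g : ℝ → ℝ} (hf : W11Loc f) (hg : W11Loc g) :
    deriv (f - g) =ᵐ[volume] deriv f - deriv g := by
  filter_upwards [hf.ae_differentiableAt, hg.ae_differentiableAt] with x h1 h2
  exact deriv_sub h1 h2

theorem normV_add_le {f g : ℝ → ℝ} (hf : W11Loc f) (hg : W11Loc g) :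
    normV (f + g) ≤ normV f + normV g := by
  have h1 := normLinf_add_le hf.continuous hg.continuous
  have h2 : normL1 (deriv (f + g)) ≤ normL1 (deriv f) + normL1 (deriv g) := by
    rw [normL1_congr (deriv_add_ae hf hg)]
    exact normL1_add_le (measurable_deriv f).aestronglyMeasurable
      (measurable_deriv g).aestronglyMeasurable
  rw [normV, normV, normV]
  calc _ ≤ (normLinf f + normLinf g) + (normL1 (deriv f) + normL1 (deriv g)) := add_le_add h1 h2
    _ = _ := by ring

theorem normV_smul (c : ℝ) (f : ℝ → ℝ) : normV (c • f) = ‖c‖ₑ * normV f := by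
  have h : deriv (c • f) = c • deriv f := by
    funext x
    exact deriv_const_smul_field c f
  rw [normV, normV, normLinf, normL1, h, eLpNorm_const_smul, eLpNorm_const_smul, mul_add]
  rfl

theorem normE_smul (c : ℝ) (X : Triple) : normE (c • X) = ‖c‖ₑ * normE X := by
  rw [normE, normE, mul_add, mul_add, ← normV_smul, ← normV_smul]
  congr 1
  exact eLpNorm_const_smul ..

theorem normE_neg (X : Triple) : normE (-X) = normE X := by
  have := normE_smul (-1) X
  rwa [neg_one_smul, enorm_neg, enorm_one, one_mul] at this

theorem normE_add_le {X Y : Triple} (hX : X ∈ E) (hY : Y ∈ E) :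
    normE (X + Y) ≤ normE X + normE Y := by
  have h1 := normV_add_le hX.1.1 hY.1.1
  have h2 := normV_add_le hX.2.1.1 hY.2.1.1
  have h3 := normL1_add_le hX.2.2.1.aestronglyMeasurable hY.2.2.1.aestronglyMeasurable
  calc normE (X + Y)
      ≤ (normV X.y + normV Y.y) + (normV X.U + normV Y.U) + (normL1 X.ν + normL1 Y.ν) :=
        add_le_add (add_le_add h1 h2) h3
    _ = normE X + normE Y := by rw [normE, normE]; ring

theorem SameE.normE_eq {X Y : Triple} (h : SameE X Y) : normE X = normE Y := by
  rw [normE, normE, h.1, h.2.1, normL1_congr h.2.2]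

namespace SameE

variable {X Y Z W : Triple}

theorem refl (X : Triple) : SameE X X := ⟨rfl, rfl, ae_eq_rfl⟩

theorem symm (h : SameE X Y) : SameE Y X := ⟨h.1.symm, h.2.1.symm, h.2.2.symm⟩

theorem trans (h : SameE X Y) (h' : SameE Y Z) : SameE X Z :=
  ⟨h.1.trans h'.1, h.2.1.trans h'.2.1, h.2.2.trans h'.2.2⟩

theorem sub (h : SameE X Y) (h' : SameE Z W) : SameE (X - Z) (Y - W) :=
  ⟨congrArg₂ (· - ·) h.1 h'.1, congrArg₂ (· - ·) h.2.1 h'.2.1, h.2.2.sub h'.2.2⟩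

theorem smul (c : ℝ) (h : SameE X Y) : SameE (c • X) (c • Y) :=
  ⟨congrArg (c • ·) h.1, congrArg (c • ·) h.2.1, h.2.2.const_smul c⟩

theorem Q_eq (h : SameE X Y) : Q X = Q Y := by
  funext ξ
  simp only [Q]
  rw [h.1, h.2.1]
  congr 1
  apply integral_congr_ae
  filter_upwards [h.2.2] with η hη
  rw [hη]

theorem P_eq (h : SameE X Y) : P X = P Y := by
  funext ξ
  simp only [P]
  rw [h.1, h.2.1]
  congr 1
  apply integral_congr_ae
  filter_upwards [h.2.2] with η hη
  rw [hη]

/-- The density `ν` enters the right-hand side only under the integrals `P` and `Q`, so the equality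
is literal and not merely almost everywhere. -/
theorem rhs_eq (h : SameE X Y) : rhs X = rhs Y := by
  rw [rhs, rhs, h.Q_eq, h.P_eq, h.1, h.2.1]

theorem energy_eq (h : SameE X Y) : energy X = energy Y := by
  apply intervalIntegral.integral_congr_ae
  filter_upwards [h.2.2] with x hx _
  rw [hx]

end SameE

theorem L1Per.intervalIntegrable {g : ℝ → ℝ} (h : g ∈ L1Per) (a b : ℝ) :
    IntervalIntegrable g volume a b :=
  locallyIntegrable_iff_intervalIntegrable.1 h.1 a b

/-- The triples of `E` with periodic first component. -/
def EPer : Set Triple := {X | X.y ∈ W11Per ∧ X.U ∈ W11Per ∧ X.ν ∈ L1Per}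

theorem EPer.mem_E {X : Triple} (h : X ∈ EPer) : X ∈ E :=
  ⟨⟨h.1.1, 0, fun ξ => by rw [add_zero]; exact h.1.2 ξ⟩, h.2⟩

theorem W11Per.sub {f g : ℝ → ℝ} (hf : f ∈ W11Per) (hg : g ∈ W11Per) : f - g ∈ W11Per :=
  ⟨hf.1.sub hg.1, hf.2.sub hg.2⟩

theorem W11Per.const_smul {f : ℝ → ℝ} (c : ℝ) (hf : f ∈ W11Per) : c • f ∈ W11Per :=
  ⟨hf.1.const_smul c, fun ξ => by simp [hf.2 ξ]⟩

theorem L1Per.sub {f g : ℝ → ℝ} (hf : f ∈ L1Per) (hg : g ∈ L1Per) : f - g ∈ L1Per :=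
  ⟨hf.1.sub hg.1, hf.2.sub hg.2⟩

theorem L1Per.const_smul {f : ℝ → ℝ} (c : ℝ) (hf : f ∈ L1Per) : c • f ∈ L1Per :=
  ⟨hf.1.smul c, fun ξ => by simp [hf.2 ξ]⟩

theorem V₁.sub {f g : ℝ → ℝ} (hf : f ∈ V₁) (hg : g ∈ V₁) : f - g ∈ W11Per :=
  ⟨hf.1.sub hg.1, fun ξ => by simp [hf.2 ξ, hg.2 ξ]⟩

theorem EPer.sub {X Y : Triple} (hX : X ∈ EPer) (hY : Y ∈ EPer) : X - Y ∈ EPer :=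
  ⟨W11Per.sub hX.1 hY.1, W11Per.sub hX.2.1 hY.2.1, L1Per.sub hX.2.2 hY.2.2⟩

theorem EPer.const_smul {X : Triple} (c : ℝ) (hX : X ∈ EPer) : c • X ∈ EPer :=
  ⟨W11Per.const_smul c hX.1, W11Per.const_smul c hX.2.1, L1Per.const_smul c hX.2.2⟩

/-- The affine subspace of `E` on which the Lagrangian system lives. -/
def E₁ : Set Triple := {X | X.y ∈ V₁ ∧ X.U ∈ W11Per ∧ X.ν ∈ L1Per}

theorem E₁.mem_E {X : Triple} (h : X ∈ E₁) : X ∈ E := ⟨⟨h.1.1, 1, h.1.2⟩, h.2⟩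

theorem E₁.sub {X Y : Triple} (hX : X ∈ E₁) (hY : Y ∈ E₁) : X - Y ∈ EPer :=
  ⟨V₁.sub hX.1 hY.1, W11Per.sub hX.2.1 hY.2.1, L1Per.sub hX.2.2 hY.2.2⟩

theorem E.sub {X Y : Triple} (hX : X ∈ E) (hY : Y ∈ E) : X - Y ∈ E := by
  obtain ⟨⟨h1, α, hα⟩, h2⟩ := hX
  obtain ⟨⟨k1, β, hβ⟩, k2⟩ := hY
  exact ⟨⟨h1.sub k1, α - β, fun ξ => by simp [hα ξ, hβ ξ]; ring⟩, W11Per.sub h2.1 k2.1,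
    L1Per.sub h2.2 k2.2⟩

theorem E.const_smul {X : Triple} (c : ℝ) (hX : X ∈ E) : c • X ∈ E := by
  obtain ⟨⟨h1, α, hα⟩, h2⟩ := hX
  exact ⟨⟨h1.const_smul c, c * α, fun ξ => by simp [hα ξ]; ring⟩, W11Per.const_smul c h2.1,
    L1Per.const_smul c h2.2⟩

theorem F.mem_E₁ {X : Triple} (h : X ∈ F) : X ∈ E₁ := ⟨h.2.1, h.1.2⟩

/-- Componentwise bounds, equivalent to a bound of `normE` on `EPer`. -/
structure EBound (X : Triple) (D : ℝ) : Prop where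
  y : ∀ ξ, |X.y ξ| ≤ D
  U : ∀ ξ, |X.U ξ| ≤ D
  dy : ∫ ξ in (0 : ℝ)..1, |deriv X.y ξ| ≤ D
  dU : ∫ ξ in (0 : ℝ)..1, |deriv X.U ξ| ≤ D
  ν : ∫ ξ in (0 : ℝ)..1, |X.ν ξ| ≤ D

theorem periodic_exists_mem_Icc {f : ℝ → ℝ} (hf : Function.Periodic f 1) (x : ℝ) :
    ∃ y ∈ Set.Icc (0 : ℝ) 1, f x = f y := by
  obtain ⟨y, hy, h⟩ := hf.exists_mem_Ico₀ zero_lt_one x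
  exact ⟨y, ⟨hy.1, hy.2.le⟩, h⟩

theorem EBound.normE_le {X : Triple} {D : ℝ} (hX : X ∈ E) (h : EBound X D) :
    normE X ≤ ENNReal.ofReal (5 * D) := by
  have hD : 0 ≤ D := (abs_nonneg _).trans (h.y 0)
  rw [normE, normV, normV, normL1_eq (hX.1.1.intervalIntegrable_deriv 0 1),
    normL1_eq (hX.2.1.1.intervalIntegrable_deriv 0 1), normL1_eq (L1Per.intervalIntegrable hX.2.2 0 1)]
  calc _ ≤ ENNReal.ofReal D + ENNReal.ofReal D + (ENNReal.ofReal D + ENNReal.ofReal D)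
        + ENNReal.ofReal D := by
        gcongr
        exacts [normLinf_le fun x _ => h.y x, h.dy, normLinf_le fun x _ => h.U x, h.dU, h.ν]
    _ = ENNReal.ofReal (5 * D) := by
        rw [← ENNReal.ofReal_add, ← ENNReal.ofReal_add, ← ENNReal.ofReal_add] <;> try positivity
        congr 1; ring

theorem normLinf_lt_top {f : ℝ → ℝ} (hf : Continuous f) : normLinf f < ∞ := by
  obtain ⟨C, hC⟩ := (isCompact_Icc (a := (0 : ℝ)) (b := 1)).exists_bound_of_continuousOn
    hf.continuousOn
  exact (normLinf_le hC).trans_lt ENNReal.ofReal_lt_top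

theorem normE_lt_top {X : Triple} (hX : X ∈ E) : normE X < ∞ := by
  rw [normE, normV, normV, normL1_eq (hX.1.1.intervalIntegrable_deriv 0 1),
    normL1_eq (hX.2.1.1.intervalIntegrable_deriv 0 1), normL1_eq (L1Per.intervalIntegrable hX.2.2 0 1)]
  have h1 := normLinf_lt_top hX.1.1.continuous
  have h2 := normLinf_lt_top hX.2.1.1.continuous
  simp [ENNReal.add_lt_top, h1, h2]

/-- Each of the five quantities is dominated by a summand of the norm. Periodicity carries the
suprema from `[0,1]` to the line; this would fail for a general element of `E`, whose `y` may grow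
linearly. -/
theorem EPer.eBound {X : Triple} (hX : X ∈ EPer) : EBound X (normE X).toReal := by
  have hE := EPer.mem_E hX
  have htop := (normE_lt_top hE).ne
  have key : ∀ {r : ℝ}, ENNReal.ofReal r ≤ normE X → r ≤ (normE X).toReal := fun h =>
    (ENNReal.ofReal_le_iff_le_toReal htop).1 h
  have e : normE X = normV X.y + normV X.U + normL1 X.ν := rfl
  refine ⟨fun ξ => ?_, fun ξ => ?_, key ?_, key ?_, key ?_⟩
  · obtain ⟨x, hx, h⟩ := periodic_exists_mem_Icc hX.1.2 ξ
    rw [h]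
    refine key ((le_normLinf hX.1.1.continuous hx).trans ?_)
    rw [e, normV, add_assoc, add_assoc]
    exact le_self_add
  · obtain ⟨x, hx, h⟩ := periodic_exists_mem_Icc hX.2.1.2 ξ
    rw [h]
    refine key ((le_normLinf hX.2.1.1.continuous hx).trans ?_)
    rw [e]
    refine le_trans (le_trans ?_ (le_add_self (b := normV X.y))) le_self_add
    exact le_self_add
  · rw [← normL1_eq (hX.1.1.intervalIntegrable_deriv 0 1), e]
    exact le_trans (le_trans (le_add_self (b := normLinf X.y)) le_self_add) le_self_add
  · rw [← normL1_eq (hX.2.1.1.intervalIntegrable_deriv 0 1), e]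
    exact le_trans (le_trans (le_add_self (b := normLinf X.U)) (le_add_self (b := normV X.y)))
      le_self_add
  · rw [← normL1_eq (L1Per.intervalIntegrable hX.2.2 0 1), e]
    exact le_add_self

end Norms

/-! ### One-sided exponential convolutions with a quasi-periodic exponent. -/

section Kernel

/-- A quasi-periodic exponent together with a periodic locally integrable source. -/
structure Adm (y m : ℝ → ℝ) : Prop where
  mem : y ∈ V₁
  per : Function.Periodic m 1
  int : ∀ a b, IntervalIntegrable m volume a b

/-- The left half of the exponential convolution. -/
noncomputable def leftConv (y m : ℝ → ℝ) (ξ : ℝ) : ℝ :=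
  ∫ η in Set.Iic ξ, Real.exp (y η - y ξ) * m η

/-- The right half of the exponential convolution. -/
noncomputable def rightConv (y m : ℝ → ℝ) (ξ : ℝ) : ℝ :=
  ∫ η in Set.Ioi ξ, Real.exp (y ξ - y η) * m η

/-- The increase of `y` to the left of a point, over at most a period, is at least `-R`. -/
def Osc (y : ℝ → ℝ) (R : ℝ) : Prop := ∀ ξ η, η ≤ ξ → ξ ≤ η + 1 → y η - y ξ ≤ R

theorem Osc.reflect {y : ℝ → ℝ} {R : ℝ} (h : Osc y R) : Osc (fun s => -y (-s)) R := by
  intro ξ η h1 h2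
  have := h (-η) (-ξ) (by linarith) (by linarith)
  linarith

namespace Adm

variable {y m : ℝ → ℝ}

/-- The reflection `ξ ↦ -ξ`, with `y` also changing sign, stays in the class and exchanges
`leftConv` with `rightConv`. -/
theorem reflect (h : Adm y m) : Adm (fun s => -y (-s)) (fun s => m (-s)) where
  mem := ⟨h.mem.1.comp_neg.neg, fun ξ => by
    have := h.mem.2 (-(ξ + 1))
    rw [show -(ξ + 1) + 1 = -ξ by ring] at this
    linarith⟩
  per := fun ξ => by
    have := h.per (-(ξ + 1))
    rw [show -(ξ + 1) + 1 = -ξ by ring] at this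
    exact this.symm
  int := fun a b => by
    have := h.int (-a) (-b)
    rwa [IntervalIntegrable.iff_comp_neg, neg_neg, neg_neg] at this

theorem continuous (h : Adm y m) : Continuous y := h.mem.1.continuous

theorem int_exp_mul (h : Adm y m) (a b : ℝ) :
    IntervalIntegrable (fun η => Real.exp (y η) * m η) volume a b :=
  (h.int a b).continuousOn_mul (Real.continuous_exp.comp h.continuous).continuousOn

/-- A shift by one period multiplies the weighted source by `exp (-1)`. Half-line integrals thus
become geometric series, without any monotonicity of `y`. -/
theorem exp_mul_shift (h : Adm y m) (η : ℝ) :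
    Real.exp (y (η - 1)) * m (η - 1) = Real.exp (-1) * (Real.exp (y η) * m η) := by
  have h1 := h.mem.2 (η - 1)
  have h2 := h.per (η - 1)
  rw [sub_add_cancel] at h1 h2
  rw [← h2, show y (η - 1) = -1 + y η by linarith, Real.exp_add]
  ring

theorem integrableOn_Iic_zero (h : Adm y m) :
    IntegrableOn (fun η => Real.exp (y η) * m η) (Set.Iic 0) := by
  set f : ℝ → ℝ := fun η => Real.exp (y η) * m η with hf
  have hq : Real.exp (-1) < 1 := by rw [Real.exp_lt_one_iff]; norm_num
  have hq0 : 0 < Real.exp (-1) := Real.exp_pos _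
  set c := ∫ η in (-1 : ℝ)..0, ‖f η‖
  have hc0 : 0 ≤ c := intervalIntegral.integral_nonneg (by norm_num) fun _ _ => norm_nonneg _
  have hint : ∀ a b, IntervalIntegrable (fun η => ‖f η‖) volume a b :=
    fun a b => (h.int_exp_mul a b).norm
  have step : ∀ n : ℕ, ∫ η in (-((n : ℝ) + 1))..0, ‖f η‖
      = c + Real.exp (-1) * ∫ η in (-(n : ℝ))..0, ‖f η‖ := by
    intro n
    rw [← intervalIntegral.integral_add_adjacent_intervals (hint _ (-1)) (hint _ 0), add_comm]
    congr 1
    rw [← intervalIntegral.integral_const_mul]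
    have := intervalIntegral.integral_comp_sub_right (a := -(n : ℝ)) (b := 0)
      (fun η => ‖f η‖) 1
    rw [show -((n : ℝ) + 1) = -(n : ℝ) - 1 by ring, show (-1 : ℝ) = 0 - 1 by ring, ← this]
    refine intervalIntegral.integral_congr fun η _ => ?_
    simp only [hf]
    rw [h.exp_mul_shift, norm_mul, Real.norm_of_nonneg hq0.le]
    norm_num
  -- The bound is the fixed point of the recursion `s ↦ c + exp (-1) * s` from `step`.
  have bd : ∀ n : ℕ, ∫ η in (-(n : ℝ))..0, ‖f η‖ ≤ c / (1 - Real.exp (-1)) := by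
    intro n
    induction n with
    | zero => simpa using div_nonneg hc0 (by linarith)
    | succ n ih =>
      push_cast
      rw [step]
      calc c + Real.exp (-1) * ∫ η in (-(n : ℝ))..0, ‖f η‖
          ≤ c + Real.exp (-1) * (c / (1 - Real.exp (-1))) := by gcongr
        _ = c / (1 - Real.exp (-1)) := by
          have : 1 - Real.exp (-1) ≠ 0 := by linarith
          field
  refine integrableOn_Iic_of_intervalIntegral_norm_bounded (l := atTop)
    (a := fun n : ℕ => -(n : ℝ)) _ 0 (fun n => (h.int_exp_mul _ _).1) ?_ (Eventually.of_forall bd)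
  exact tendsto_neg_atTop_atBot.comp tendsto_natCast_atTop_atTop

theorem integrableOn_Iic (h : Adm y m) (ξ : ℝ) :
    IntegrableOn (fun η => Real.exp (y η) * m η) (Set.Iic ξ) := by
  refine (h.integrableOn_Iic_zero.union (h.int_exp_mul 0 ξ).1).mono_set fun x hx => ?_
  rcases le_or_gt x 0 with h0 | h0
  · exact Or.inl h0
  · exact Or.inr ⟨h0, hx⟩

theorem leftConv_integrable (h : Adm y m) (ξ : ℝ) :
    IntegrableOn (fun η => Real.exp (y η - y ξ) * m η) (Set.Iic ξ) := by
  have := (h.integrableOn_Iic ξ).const_mul (Real.exp (-y ξ))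
  refine this.congr (Eventually.of_forall fun η => ?_)
  simp only [sub_eq_add_neg, Real.exp_add]
  ring

theorem rightConv_eq_reflect (y m : ℝ → ℝ) (ξ : ℝ) :
    rightConv y m ξ = leftConv (fun s => -y (-s)) (fun s => m (-s)) (-ξ) := by
  rw [rightConv, leftConv]
  have := integral_comp_neg_Iic (-ξ) (fun η => Real.exp (y ξ - y η) * m η)
  rw [neg_neg] at this
  rw [← this]
  refine integral_congr_ae (Eventually.of_forall fun η => ?_)
  simp only [neg_neg]
  congr 2
  ring

theorem rightConv_integrable (h : Adm y m) (ξ : ℝ) :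
    IntegrableOn (fun η => Real.exp (y ξ - y η) * m η) (Set.Ioi ξ) := by
  have := (h.reflect.leftConv_integrable (-ξ))
  have h2 := (this.mono_set Set.Iio_subset_Iic_self).comp_neg_Ioi (c := ξ)
  refine h2.congr (Eventually.of_forall fun η => ?_)
  simp only [neg_neg]
  congr 2
  ring

/-- Separating the factor that depends on `ξ` leaves a constant plus a primitive, from which
regularity and the derivative can be read off. -/
theorem leftConv_eq (h : Adm y m) (ξ : ℝ) :
    leftConv y m ξ = Real.exp (-y ξ) *
      ((∫ η in Set.Iic 0, Real.exp (y η) * m η) + ∫ η in (0 : ℝ)..ξ, Real.exp (y η) * m η) := by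
  rw [← intervalIntegral.integral_Iic_sub_Iic (h.integrableOn_Iic 0) (h.integrableOn_Iic ξ),
    add_sub_cancel, ← integral_const_mul, leftConv]
  refine integral_congr_ae (Eventually.of_forall fun η => ?_)
  simp only [sub_eq_add_neg, Real.exp_add]
  ring

/-- The geometric series summed: the integral up to `ξ - 1` is `exp (-1)` times the integral up to
`ξ`, so their difference over one period determines both. -/
theorem leftConv_period (h : Adm y m) (ξ : ℝ) :
    (1 - Real.exp (-1)) * leftConv y m ξ = ∫ η in (ξ - 1)..ξ, Real.exp (y η - y ξ) * m η := by
  have h1 : ∫ η in Set.Iic (ξ - 1), Real.exp (y η) * m η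
      = Real.exp (-1) * ∫ η in Set.Iic ξ, Real.exp (y η) * m η := by
    rw [← integral_const_mul]
    simp_rw [← h.exp_mul_shift]
    have A : MeasurableEmbedding fun x : ℝ => x - 1 :=
      (Homeomorph.subRight (1 : ℝ)).isClosedEmbedding.measurableEmbedding
    have key := MeasurableEmbedding.setIntegral_map (μ := volume) A
      (fun η => Real.exp (y η) * m η) (Set.Iic (ξ - 1))
    rw [map_sub_right_eq_self] at key
    rw [key]
    congr 2
    ext x
    simp
  have h2 := intervalIntegral.integral_Iic_sub_Iic (h.integrableOn_Iic (ξ - 1))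
    (h.integrableOn_Iic ξ)
  have h3 : leftConv y m ξ = Real.exp (-y ξ) * ∫ η in Set.Iic ξ, Real.exp (y η) * m η := by
    rw [leftConv, ← integral_const_mul]
    refine integral_congr_ae (Eventually.of_forall fun η => ?_)
    simp only [sub_eq_add_neg, Real.exp_add]
    ring
  have h4 : ∫ η in (ξ - 1)..ξ, Real.exp (y η - y ξ) * m η
      = Real.exp (-y ξ) * ∫ η in (ξ - 1)..ξ, Real.exp (y η) * m η := by
    rw [← intervalIntegral.integral_const_mul]
    refine intervalIntegral.integral_congr fun η _ => ?_
    simp only [sub_eq_add_neg, Real.exp_add]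
    ring
  rw [h4, ← h2, h1, h3]
  ring

theorem leftConv_periodic (h : Adm y m) : Function.Periodic (leftConv y m) 1 := by
  intro ξ
  have hq : Real.exp (-1) < 1 := by rw [Real.exp_lt_one_iff]; norm_num
  have hq' : 1 - Real.exp (-1) ≠ 0 := by linarith
  apply mul_left_cancel₀ hq'
  rw [h.leftConv_period, h.leftConv_period]
  have := intervalIntegral.integral_comp_add_right (a := ξ - 1) (b := ξ)
    (fun η => Real.exp (y η - y (ξ + 1)) * m η) 1
  rw [show ξ + 1 - 1 = ξ - 1 + 1 by ring, ← this]
  refine intervalIntegral.integral_congr fun η _ => ?_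
  rw [h.per, h.mem.2, h.mem.2]
  congr 2
  ring

theorem leftConv_w11Loc (h : Adm y m) : W11Loc (leftConv y m) := by
  have : leftConv y m = fun ξ => Real.exp (-y ξ) *
      ((∫ η in Set.Iic 0, Real.exp (y η) * m η) + ∫ η in (0 : ℝ)..ξ, Real.exp (y η) * m η) :=
    funext h.leftConv_eq
  rw [this]
  exact h.mem.1.neg.exp.mul ((W11Loc.const _).add (w11Loc_primitive h.int_exp_mul 0))

theorem leftConv_hasDerivAt (h : Adm y m) :
    ∀ᵐ ξ : ℝ, HasDerivAt (leftConv y m) (m ξ - deriv y ξ * leftConv y m ξ) ξ := by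
  filter_upwards [h.mem.1.ae_differentiableAt, deriv_primitive h.int_exp_mul 0] with ξ h1 h2
  have h3 := (h1.hasDerivAt.neg.exp).mul
    (h2.const_add (∫ η in Set.Iic 0, Real.exp (y η) * m η))
  have : leftConv y m = fun ξ => Real.exp (-y ξ) *
      ((∫ η in Set.Iic 0, Real.exp (y η) * m η) + ∫ η in (0 : ℝ)..ξ, Real.exp (y η) * m η) :=
    funext h.leftConv_eq
  rw [h.leftConv_eq ξ, this]
  convert! h3 using 1
  have : Real.exp (-y ξ) * Real.exp (y ξ) = 1 := by rw [← Real.exp_add]; simp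
  linear_combination (-m ξ) * this

theorem rightConv_eq (y m : ℝ → ℝ) :
    rightConv y m = fun ξ => leftConv (fun s => -y (-s)) (fun s => m (-s)) (-ξ) :=
  funext (rightConv_eq_reflect y m)

theorem rightConv_periodic (h : Adm y m) : Function.Periodic (rightConv y m) 1 := by
  intro ξ
  rw [rightConv_eq]
  have := h.reflect.leftConv_periodic (-(ξ + 1))
  rw [show -(ξ + 1) + 1 = -ξ by ring] at this
  exact this.symm

theorem rightConv_w11Loc (h : Adm y m) : W11Loc (rightConv y m) := by
  rw [rightConv_eq]
  exact h.reflect.leftConv_w11Loc.comp_neg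

theorem ae_comp_neg {p : ℝ → Prop} (h : ∀ᵐ x : ℝ, p x) : ∀ᵐ x : ℝ, p (-x) :=
  (Measure.measurePreserving_neg (volume : Measure ℝ)).quasiMeasurePreserving.ae h

theorem rightConv_hasDerivAt (h : Adm y m) :
    ∀ᵐ ξ : ℝ, HasDerivAt (rightConv y m) (deriv y ξ * rightConv y m ξ - m ξ) ξ := by
  filter_upwards [ae_comp_neg h.reflect.leftConv_hasDerivAt] with ξ h1
  rw [rightConv_eq]
  have h2 : HasDerivAt (fun x : ℝ => -x) (-1) ξ := hasDerivAt_neg ξ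
  have h3 := h1.comp ξ h2
  convert! h3 using 1
  have : deriv (fun s => -y (-s)) (-ξ) = deriv y ξ := by
    rw [deriv.fun_neg, deriv_comp_neg]
    simp
  rw [this]
  simp only [neg_neg]
  ring

theorem inv_one_sub_exp_le : (1 - Real.exp (-1))⁻¹ ≤ 2 := by
  have h1 : Real.exp (-1) ≤ 1 / 2 := by
    rw [Real.exp_neg, one_div]
    exact inv_anti₀ (by norm_num) (by linarith [Real.add_one_le_exp (1 : ℝ)])
  rw [inv_le_comm₀ (by linarith) (by norm_num)]
  linarith

theorem leftConv_eq_period (h : Adm y m) (ξ : ℝ) : leftConv y m ξ =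
    (1 - Real.exp (-1))⁻¹ * ∫ η in (ξ - 1)..ξ, Real.exp (y η - y ξ) * m η := by
  have hq : Real.exp (-1) < 1 := by rw [Real.exp_lt_one_iff]; norm_num
  rw [← h.leftConv_period, inv_mul_cancel_left₀]
  linarith

theorem integral_period (hp : Function.Periodic m 1) (ξ : ℝ) :
    ∫ η in (ξ - 1)..ξ, m η = ∫ η in (0 : ℝ)..1, m η := by
  have := hp.intervalIntegral_add_eq (ξ - 1) 0
  simpa using this

theorem periodic_abs (hp : Function.Periodic m 1) : Function.Periodic (fun x => |m x|) 1 :=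
  fun x => by simp only [hp x]

/-- After reduction to one period the exponent is at most `R` by `Osc`, and the factor `2` bounds
the sum of the geometric series. -/
theorem abs_leftConv_le (h : Adm y m) {R : ℝ} (hR : Osc y R) (ξ : ℝ) :
    |leftConv y m ξ| ≤ 2 * Real.exp R * ∫ η in (0 : ℝ)..1, |m η| := by
  have hq : Real.exp (-1) < 1 := by rw [Real.exp_lt_one_iff]; norm_num
  have hq' : 0 < (1 - Real.exp (-1))⁻¹ := inv_pos.2 (by linarith)
  rw [h.leftConv_eq_period, abs_mul, abs_of_pos hq', mul_assoc]
  refine mul_le_mul inv_one_sub_exp_le ?_ (abs_nonneg _) (by norm_num)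
  rw [← integral_period (periodic_abs h.per) ξ, ← intervalIntegral.integral_const_mul]
  rw [← Real.norm_eq_abs]
  refine intervalIntegral.norm_integral_le_of_norm_le (by linarith) ?_
    ((h.int _ _).abs.const_mul _)
  refine Eventually.of_forall fun η hη => ?_
  rw [norm_mul, Real.norm_of_nonneg (Real.exp_pos _).le, Real.norm_eq_abs]
  gcongr
  exact hR ξ η hη.2 (by linarith [hη.1])

theorem abs_exp_sub_exp_le {a b R : ℝ} (ha : a ≤ R) (hb : b ≤ R) :
    |Real.exp a - Real.exp b| ≤ Real.exp R * |a - b| := by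
  wlog hab : b ≤ a generalizing a b
  · rw [abs_sub_comm, abs_sub_comm a]
    exact this hb ha (le_of_not_ge hab)
  rw [abs_of_nonneg (by linarith [Real.exp_le_exp.2 hab]), abs_of_nonneg (by linarith)]
  have h1 : Real.exp b = Real.exp a * Real.exp (b - a) := by rw [← Real.exp_add]; ring_nf
  have h2 := Real.add_one_le_exp (b - a)
  calc Real.exp a - Real.exp b = Real.exp a * (1 - Real.exp (b - a)) := by rw [h1]; ring
    _ ≤ Real.exp a * (a - b) :=
      mul_le_mul_of_nonneg_left (by linarith) (Real.exp_pos _).le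
    _ ≤ Real.exp R * (a - b) :=
      mul_le_mul_of_nonneg_right (Real.exp_le_exp.2 ha) (by linarith)

/-- The exponents involve `y` at two points, which accounts for `2 * D`; the rest is the telescoping
of a product. -/
theorem abs_leftConv_sub_le {y' m' : ℝ → ℝ} (h : Adm y m) (h' : Adm y' m') {R D : ℝ}
    (hR : Osc y R) (hR' : Osc y' R) (hD : ∀ ξ, |y ξ - y' ξ| ≤ D) (ξ : ℝ) :
    |leftConv y m ξ - leftConv y' m' ξ| ≤ 2 * Real.exp R *
      (2 * D * (∫ η in (0 : ℝ)..1, |m η|) + ∫ η in (0 : ℝ)..1, |m η - m' η|) := by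
  have hq : Real.exp (-1) < 1 := by rw [Real.exp_lt_one_iff]; norm_num
  have hq' : 0 < (1 - Real.exp (-1))⁻¹ := inv_pos.2 (by linarith)
  have hD0 : 0 ≤ D := (abs_nonneg _).trans (hD 0)
  have hi : ∀ {y m : ℝ → ℝ} (h : Adm y m) (a b : ℝ),
      IntervalIntegrable (fun η => Real.exp (y η - y ξ) * m η) volume a b := fun {y m} h a b =>
    (h.int a b).continuousOn_mul
      (Real.continuous_exp.comp (h.continuous.sub continuous_const)).continuousOn
  rw [h.leftConv_eq_period, h'.leftConv_eq_period, ← mul_sub, abs_mul, abs_of_pos hq', mul_assoc,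
    ← intervalIntegral.integral_sub (hi h _ _) (hi h' _ _)]
  refine mul_le_mul inv_one_sub_exp_le ?_ (abs_nonneg _) (by norm_num)
  have hp : Function.Periodic (fun η => m η - m' η) 1 := fun x => by simp only [h.per x, h'.per x]
  rw [← integral_period (periodic_abs h.per) ξ, ← integral_period (periodic_abs hp) ξ,
    ← intervalIntegral.integral_const_mul, ← intervalIntegral.integral_add
      ((h.int _ _).abs.const_mul _) ((h.int _ _).sub (h'.int _ _)).abs,
    ← intervalIntegral.integral_const_mul, ← Real.norm_eq_abs]
  refine intervalIntegral.norm_integral_le_of_norm_le (by linarith) ?_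
    ((((h.int _ _).abs.const_mul _).add ((h.int _ _).sub (h'.int _ _)).abs).const_mul _)
  refine Eventually.of_forall fun η hη => ?_
  have e1 := hR ξ η hη.2 (by linarith [hη.1])
  have e2 := hR' ξ η hη.2 (by linarith [hη.1])
  have e3 := abs_exp_sub_exp_le e1 e2
  have e4 : |(y η - y ξ) - (y' η - y' ξ)| ≤ 2 * D := by
    have a1 := abs_le.1 (hD η)
    have a2 := abs_le.1 (hD ξ)
    rw [abs_le]; constructor <;> linarith
  have e5 := Real.exp_le_exp.2 e2
  rw [Real.norm_eq_abs, show Real.exp (y η - y ξ) * m η - Real.exp (y' η - y' ξ) * m' η =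
    (Real.exp (y η - y ξ) - Real.exp (y' η - y' ξ)) * m η
      + Real.exp (y' η - y' ξ) * (m η - m' η) by ring]
  calc _ ≤ |Real.exp (y η - y ξ) - Real.exp (y' η - y' ξ)| * |m η|
        + Real.exp (y' η - y' ξ) * |m η - m' η| := by
        refine (abs_add_le _ _).trans (le_of_eq ?_)
        rw [abs_mul, abs_mul, abs_of_pos (Real.exp_pos _)]
    _ ≤ (Real.exp R * (2 * D)) * |m η| + Real.exp R * |m η - m' η| := by
        gcongr
        exact e3.trans (by gcongr)
    _ = _ := by ring

theorem integral_reflect (hp : Function.Periodic m 1) :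
    ∫ η in (0 : ℝ)..1, m (-η) = ∫ η in (0 : ℝ)..1, m η := by
  rw [intervalIntegral.integral_comp_neg, ← integral_period hp 0]
  norm_num

theorem abs_rightConv_le (h : Adm y m) {R : ℝ} (hR : Osc y R) (ξ : ℝ) :
    |rightConv y m ξ| ≤ 2 * Real.exp R * ∫ η in (0 : ℝ)..1, |m η| := by
  rw [rightConv_eq, ← integral_reflect (periodic_abs h.per)]
  exact h.reflect.abs_leftConv_le hR.reflect (-ξ)

theorem abs_rightConv_sub_le {y' m' : ℝ → ℝ} (h : Adm y m) (h' : Adm y' m') {R D : ℝ}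
    (hR : Osc y R) (hR' : Osc y' R) (hD : ∀ ξ, |y ξ - y' ξ| ≤ D) (ξ : ℝ) :
    |rightConv y m ξ - rightConv y' m' ξ| ≤ 2 * Real.exp R *
      (2 * D * (∫ η in (0 : ℝ)..1, |m η|) + ∫ η in (0 : ℝ)..1, |m η - m' η|) := by
  have hp : Function.Periodic (fun η => m η - m' η) 1 := fun x => by simp only [h.per x, h'.per x]
  rw [rightConv_eq, rightConv_eq, ← integral_reflect (periodic_abs h.per),
    ← integral_reflect (periodic_abs hp)]
  refine h.reflect.abs_leftConv_sub_le h'.reflect hR.reflect hR'.reflect (fun s => ?_) (-ξ)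
  have := hD (-s)
  rw [abs_sub_comm] at this
  rwa [neg_sub_neg]

end Adm

end Kernel

/-! ### `P`, `Q` and the Lipschitz estimate for the Lagrangian vector field. -/

section VectorField

/-- The source `U² y_ξ + ν` of the convolutions defining `P` and `Q`. -/
noncomputable def src (X : Triple) (η : ℝ) : ℝ := X.U η ^ 2 * deriv X.y η + X.ν η

theorem intervalIntegrable_src {X : Triple} (hX : X ∈ E) (a b : ℝ) :
    IntervalIntegrable (src X) volume a b :=
  ((hX.1.1.intervalIntegrable_deriv a b).continuousOn_mul
    (hX.2.1.1.continuous.pow 2).continuousOn).add (L1Per.intervalIntegrable hX.2.2 a b)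

theorem E₁.adm {X : Triple} (hX : X ∈ E₁) : Adm X.y (src X) where
  mem := hX.1
  per := fun ξ => by
    have h1 := periodic_deriv hX.1.2 ξ
    have h2 := hX.2.1.2 ξ
    have h3 := hX.2.2.2 ξ
    simp only [src]
    rw [h1, h2, h3]
  int := intervalIntegrable_src (E₁.mem_E hX)

/-- The sign in the kernels of `P` and `Q` is constant on either side of `ξ`; at `ξ` itself it
vanishes, but a point is null. -/
theorem E₁.split {X : Triple} (hX : X ∈ E₁) (ξ : ℝ) {f : ℝ → ℝ} {a b : ℝ}
    (h1 : ∀ η < ξ, f η = a * (Real.exp (X.y η - X.y ξ) * src X η))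
    (h2 : ∀ η > ξ, f η = b * (Real.exp (X.y ξ - X.y η) * src X η)) :
    ∫ η, f η = a * leftConv X.y (src X) ξ + b * rightConv X.y (src X) ξ := by
  have hA := E₁.adm hX
  have e1 : f =ᵐ[volume.restrict (Set.Iic ξ)]
      fun η => a * (Real.exp (X.y η - X.y ξ) * src X η) := by
    rw [← restrict_Iio_eq_restrict_Iic]
    filter_upwards [ae_restrict_mem measurableSet_Iio] with η hη using h1 η hη
  have e2 : f =ᵐ[volume.restrict (Set.Ioi ξ)]
      fun η => b * (Real.exp (X.y ξ - X.y η) * src X η) := by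
    filter_upwards [ae_restrict_mem measurableSet_Ioi] with η hη using h2 η hη
  have i1 : IntegrableOn f (Set.Iic ξ) := ((hA.leftConv_integrable ξ).const_mul a).congr e1.symm
  have i2 : IntegrableOn f (Set.Ioi ξ) := ((hA.rightConv_integrable ξ).const_mul b).congr e2.symm
  rw [← intervalIntegral.integral_Iic_add_Ioi i1 i2, integral_congr_ae e1, integral_congr_ae e2,
    integral_const_mul, integral_const_mul]
  rfl

theorem P_eq_conv {X : Triple} (hX : X ∈ E₁) (ξ : ℝ) :
    P X ξ = (1 / 4) * (leftConv X.y (src X) ξ + rightConv X.y (src X) ξ) := by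
  rw [P, E₁.split hX ξ (a := 1) (b := 1)]
  · ring
  · intro η hη
    rw [Real.sign_of_pos (by linarith), src,
      show -(1 * (X.y ξ - X.y η)) = X.y η - X.y ξ by ring, one_mul]
  · intro η hη
    rw [Real.sign_of_neg (by linarith), src,
      show -(-1 * (X.y ξ - X.y η)) = X.y ξ - X.y η by ring, one_mul]

theorem Q_eq_conv {X : Triple} (hX : X ∈ E₁) (ξ : ℝ) :
    Q X ξ = -(1 / 4) * (leftConv X.y (src X) ξ - rightConv X.y (src X) ξ) := by
  rw [Q, E₁.split hX ξ (a := 1) (b := -1)]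
  · ring
  · intro η hη
    rw [Real.sign_of_pos (by linarith), src, one_mul, one_mul, one_mul, neg_sub]
  · intro η hη
    rw [Real.sign_of_neg (by linarith), src, mul_assoc]
    congr 3
    ring

theorem P_eq_conv' {X : Triple} (hX : X ∈ E₁) :
    P X = fun ξ => (1 / 4) * (leftConv X.y (src X) ξ + rightConv X.y (src X) ξ) :=
  funext (P_eq_conv hX)

theorem Q_eq_conv' {X : Triple} (hX : X ∈ E₁) :
    Q X = fun ξ => -(1 / 4) * (leftConv X.y (src X) ξ - rightConv X.y (src X) ξ) :=
  funext (Q_eq_conv hX)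

theorem P_mem {X : Triple} (hX : X ∈ E₁) : P X ∈ W11Per := by
  have hA := E₁.adm hX
  rw [P_eq_conv' hX]
  exact ⟨(hA.leftConv_w11Loc.add hA.rightConv_w11Loc).const_mul _, fun ξ => by
    simp only [hA.leftConv_periodic ξ, hA.rightConv_periodic ξ]⟩

theorem Q_mem {X : Triple} (hX : X ∈ E₁) : Q X ∈ W11Per := by
  have hA := E₁.adm hX
  rw [Q_eq_conv' hX]
  exact ⟨(hA.leftConv_w11Loc.sub hA.rightConv_w11Loc).const_mul _, fun ξ => by
    simp only [hA.leftConv_periodic ξ, hA.rightConv_periodic ξ]⟩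

/-- The source enters the derivatives of the two convolutions with opposite signs: it cancels in `P`
and adds up in `Q`. -/
theorem P_hasDerivAt {X : Triple} (hX : X ∈ E₁) :
    ∀ᵐ ξ : ℝ, HasDerivAt (P X) (deriv X.y ξ * Q X ξ) ξ := by
  have hA := E₁.adm hX
  filter_upwards [hA.leftConv_hasDerivAt, hA.rightConv_hasDerivAt] with ξ h1 h2
  rw [Q_eq_conv hX, P_eq_conv' hX]
  convert! (h1.add h2).const_mul (1 / 4) using 1
  ring

theorem Q_hasDerivAt {X : Triple} (hX : X ∈ E₁) :
    ∀ᵐ ξ : ℝ, HasDerivAt (Q X) (deriv X.y ξ * P X ξ - 1 / 2 * src X ξ) ξ := by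
  have hA := E₁.adm hX
  filter_upwards [hA.leftConv_hasDerivAt, hA.rightConv_hasDerivAt] with ξ h1 h2
  rw [P_eq_conv hX, Q_eq_conv' hX]
  convert! (h1.sub h2).const_mul (-(1 / 4)) using 1
  ring

theorem rhs_mem_EPer {X : Triple} (hX : X ∈ E₁) : rhs X ∈ EPer := by
  refine ⟨hX.2.1, ⟨(Q_mem hX).1.neg, fun ξ => ?_⟩, ?_, fun ξ => ?_⟩
  · have := (Q_mem hX).2 ξ
    change -Q X (ξ + 1) = -Q X ξ
    rw [this]
  · rw [locallyIntegrable_iff_intervalIntegrable]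
    intro a b
    have c1 := (Q_mem hX).1.continuous
    have c2 := (P_mem hX).1.continuous
    have c3 := hX.2.1.1.continuous
    exact ((hX.1.1.intervalIntegrable_deriv a b).continuousOn_mul (by fun_prop)).add
      ((hX.2.1.1.intervalIntegrable_deriv a b).continuousOn_mul (by fun_prop))
  · have h1 := (Q_mem hX).2 ξ
    have h2 := (P_mem hX).2 ξ
    have h3 := hX.2.1.2 ξ
    have h4 := periodic_deriv hX.1.2 ξ
    have h5 := periodic_deriv (α := 0) (f := X.U) (fun ξ => by rw [hX.2.1.2 ξ, add_zero]) ξ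
    change -2 * Q X (ξ + 1) * X.U (ξ + 1) * deriv X.y (ξ + 1)
        + (3 * X.U (ξ + 1) ^ 2 - 2 * P X (ξ + 1)) * deriv X.U (ξ + 1)
      = -2 * Q X ξ * X.U ξ * deriv X.y ξ + (3 * X.U ξ ^ 2 - 2 * P X ξ) * deriv X.U ξ
    rw [h1, h2, h3, h4, h5]

/-- Bounds that are invariant under relabeling and under translations of `y`. -/
structure Bnd (X : Triple) (R : ℝ) : Prop where
  U : ∀ ξ, |X.U ξ| ≤ R
  dy : ∫ ξ in (0 : ℝ)..1, |deriv X.y ξ| ≤ R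
  dU : ∫ ξ in (0 : ℝ)..1, |deriv X.U ξ| ≤ R
  ν : ∫ ξ in (0 : ℝ)..1, |X.ν ξ| ≤ R

theorem Bnd.nonneg {X : Triple} {R : ℝ} (h : Bnd X R) : 0 ≤ R := (abs_nonneg _).trans (h.U 0)

theorem Bnd.mono {X : Triple} {R R' : ℝ} (h : Bnd X R) (hR : R ≤ R') : Bnd X R' :=
  ⟨fun ξ => (h.U ξ).trans hR, h.dy.trans hR, h.dU.trans hR, h.ν.trans hR⟩

/-- Over at most one period `y` varies by no more than the integral of `|y_ξ|` over a period. -/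
theorem Bnd.osc {X : Triple} {R : ℝ} (h : Bnd X R) (hX : X ∈ E₁) : Osc X.y R := by
  intro ξ η h1 h2
  have hi := hX.1.1.intervalIntegrable_deriv
  calc X.y η - X.y ξ = -∫ x in η..ξ, deriv X.y x := by rw [hX.1.1.integral_deriv]; ring
    _ ≤ |∫ x in η..ξ, deriv X.y x| := neg_le_abs _
    _ ≤ ∫ x in η..ξ, |deriv X.y x| := intervalIntegral.abs_integral_le_integral_abs h1
    _ ≤ ∫ x in (ξ - 1)..ξ, |deriv X.y x| := by
      refine intervalIntegral.integral_mono_interval (by linarith) h1 le_rfl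
        (Eventually.of_forall fun _ => abs_nonneg _) (hi _ _).abs
    _ = ∫ x in (0 : ℝ)..1, |deriv X.y x| :=
      Adm.integral_period (Adm.periodic_abs (periodic_deriv hX.1.2)) ξ
    _ ≤ R := h.dy

/-- Integrating a pointwise bound by a linear combination. -/
theorem integral_abs_le_of_ae_le {f u₁ u₂ u₃ u₄ : ℝ → ℝ} {a₁ a₂ a₃ a₄ A₁ A₂ A₃ A₄ : ℝ}
    (h₁ : IntervalIntegrable u₁ volume 0 1) (h₂ : IntervalIntegrable u₂ volume 0 1)
    (h₃ : IntervalIntegrable u₃ volume 0 1) (h₄ : IntervalIntegrable u₄ volume 0 1)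
    (i₁ : ∫ x in (0 : ℝ)..1, |u₁ x| ≤ A₁) (i₂ : ∫ x in (0 : ℝ)..1, |u₂ x| ≤ A₂)
    (i₃ : ∫ x in (0 : ℝ)..1, |u₃ x| ≤ A₃) (i₄ : ∫ x in (0 : ℝ)..1, |u₄ x| ≤ A₄)
    (n₁ : 0 ≤ a₁) (n₂ : 0 ≤ a₂) (n₃ : 0 ≤ a₃) (n₄ : 0 ≤ a₄)
    (h : ∀ᵐ x : ℝ, |f x| ≤ a₁ * |u₁ x| + a₂ * |u₂ x| + a₃ * |u₃ x| + a₄ * |u₄ x|) :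
    ∫ x in (0 : ℝ)..1, |f x| ≤ a₁ * A₁ + a₂ * A₂ + a₃ * A₃ + a₄ * A₄ := by
  have hi := (((h₁.abs.const_mul a₁).add (h₂.abs.const_mul a₂)).add (h₃.abs.const_mul a₃)).add
    (h₄.abs.const_mul a₄)
  calc ∫ x in (0 : ℝ)..1, |f x|
      ≤ ∫ x in (0 : ℝ)..1, (a₁ * |u₁ x| + a₂ * |u₂ x| + a₃ * |u₃ x| + a₄ * |u₄ x|) := by
        have := intervalIntegral.norm_integral_le_of_norm_le (f := fun x => |f x|) zero_le_one
          (h.mono fun x hx _ => by simpa using hx) hi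
        exact (le_abs_self _).trans this
    _ = a₁ * (∫ x in (0 : ℝ)..1, |u₁ x|) + a₂ * (∫ x in (0 : ℝ)..1, |u₂ x|)
        + a₃ * (∫ x in (0 : ℝ)..1, |u₃ x|) + a₄ * (∫ x in (0 : ℝ)..1, |u₄ x|) := by
        rw [intervalIntegral.integral_add (((h₁.abs.const_mul a₁).add (h₂.abs.const_mul a₂)).add
            (h₃.abs.const_mul a₃)) (h₄.abs.const_mul a₄),
          intervalIntegral.integral_add ((h₁.abs.const_mul a₁).add (h₂.abs.const_mul a₂))
            (h₃.abs.const_mul a₃),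
          intervalIntegral.integral_add (h₁.abs.const_mul a₁) (h₂.abs.const_mul a₂)]
        simp only [intervalIntegral.integral_const_mul]
    _ ≤ _ := by gcongr

theorem Bnd.src_le {X : Triple} {R : ℝ} (h : Bnd X R) (hX : X ∈ E₁) :
    ∫ η in (0 : ℝ)..1, |src X η| ≤ R ^ 3 + R := by
  have hR := h.nonneg
  have i1 := hX.1.1.intervalIntegrable_deriv 0 1
  have i2 := L1Per.intervalIntegrable hX.2.2 0 1
  have := integral_abs_le_of_ae_le (f := src X) (a₁ := R ^ 2) (a₂ := 1) (a₃ := 0) (a₄ := 0)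
    i1 i2 i2 i2 h.dy h.ν h.ν h.ν (by positivity) zero_le_one le_rfl le_rfl
    (Eventually.of_forall fun η => ?_)
  · linarith
  · rw [src]
    have := h.U η
    have h2 : X.U η ^ 2 ≤ R ^ 2 := sq_le_sq' (by linarith [(abs_le.1 this).1]) (abs_le.1 this).2
    calc _ ≤ |X.U η ^ 2 * deriv X.y η| + |X.ν η| := abs_add_le _ _
      _ ≤ R ^ 2 * |deriv X.y η| + |X.ν η| := by
        rw [abs_mul, abs_of_nonneg (sq_nonneg _)]; gcongr
      _ = _ := by ring

theorem abs_mul_add_sub_le {a b c d D R : ℝ} (hab : |a - b| ≤ D) (ha : |a| ≤ R) (hb : |b| ≤ R) :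
    |a ^ 2 * c - b ^ 2 * d| ≤ 2 * R * D * |c| + R ^ 2 * |c - d| := by
  have hR : 0 ≤ R := (abs_nonneg _).trans ha
  have hD : 0 ≤ D := (abs_nonneg _).trans hab
  have e : a ^ 2 * c - b ^ 2 * d = (a - b) * (a + b) * c + b ^ 2 * (c - d) := by ring
  have h1 : |a + b| ≤ 2 * R := (abs_add_le _ _).trans (by linarith)
  have h2 : b ^ 2 ≤ R ^ 2 := sq_le_sq' (by linarith [(abs_le.1 hb).1]) (abs_le.1 hb).2
  rw [e]
  calc _ ≤ |a - b| * |a + b| * |c| + b ^ 2 * |c - d| := by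
        refine (abs_add_le _ _).trans (le_of_eq ?_)
        rw [abs_mul, abs_mul, abs_mul, abs_of_nonneg (sq_nonneg b)]
    _ ≤ D * (2 * R) * |c| + R ^ 2 * |c - d| := by gcongr
    _ = _ := by ring

theorem src_sub_le {X Y : Triple} {R D : ℝ} (hX : X ∈ E₁) (hY : Y ∈ E₁) (h : Bnd X R)
    (h' : Bnd Y R) (hD : EBound (X - Y) D) :
    ∫ η in (0 : ℝ)..1, |src X η - src Y η| ≤ (3 * R ^ 2 + 1) * D := by
  have hR := h.nonneg
  have hD0 : 0 ≤ D := (abs_nonneg _).trans (hD.y 0)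
  have hXY := E₁.sub hX hY
  have i1 := hX.1.1.intervalIntegrable_deriv 0 1
  have i2 := hXY.1.1.intervalIntegrable_deriv 0 1
  have i3 := L1Per.intervalIntegrable hXY.2.2 0 1
  have := integral_abs_le_of_ae_le (f := fun η => src X η - src Y η)
    (a₁ := 2 * R * D) (a₂ := R ^ 2) (a₃ := 1) (a₄ := 0)
    i1 i2 i3 i3 h.dy hD.dy hD.ν hD.ν (by positivity) (by positivity) zero_le_one le_rfl ?_
  · linarith
  · filter_upwards [deriv_sub_ae hX.1.1 hY.1.1] with η hη
    have e1 := abs_mul_add_sub_le (c := deriv X.y η) (d := deriv Y.y η) (hD.U η) (h.U η) (h'.U η)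
    have e2 : deriv (X - Y).y η = deriv X.y η - deriv Y.y η := hη
    rw [e2, src, src]
    calc _ = |(X.U η ^ 2 * deriv X.y η - Y.U η ^ 2 * deriv Y.y η) + (X.ν η - Y.ν η)| := by
          congr 1; ring
      _ ≤ |X.U η ^ 2 * deriv X.y η - Y.U η ^ 2 * deriv Y.y η| + |X.ν η - Y.ν η| := abs_add_le _ _
      _ ≤ 2 * R * D * |deriv X.y η| + R ^ 2 * |deriv X.y η - deriv Y.y η|
          + |X.ν η - Y.ν η| := by gcongr
      _ = _ := by
        change _ = _ + 1 * |X.ν η - Y.ν η| + _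
        ring

/-- A bound of `|P|` and `|Q|`. -/
noncomputable def boundPQ (R : ℝ) : ℝ := Real.exp R * (R ^ 3 + R)

/-- A Lipschitz constant of `P` and `Q`. -/
noncomputable def lipPQ (R : ℝ) : ℝ := Real.exp R * (2 * (R ^ 3 + R) + (3 * R ^ 2 + 1))

theorem boundPQ_nonneg {R : ℝ} (hR : 0 ≤ R) : 0 ≤ boundPQ R := by
  rw [boundPQ]; positivity

theorem lipPQ_nonneg {R : ℝ} (hR : 0 ≤ R) : 0 ≤ lipPQ R := by
  rw [lipPQ]; positivity

theorem abs_quarter_add_le {a b C : ℝ} (ha : |a| ≤ C) (hb : |b| ≤ C) :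
    |1 / 4 * (a + b)| ≤ C / 2 := by
  rw [abs_le] at *; constructor <;> linarith

theorem abs_quarter_sub_le {a b C : ℝ} (ha : |a| ≤ C) (hb : |b| ≤ C) :
    |-(1 / 4) * (a - b)| ≤ C / 2 := by
  rw [abs_le] at *; constructor <;> linarith

/-- The oscillation bound is kept apart from the bound of the source, since for nondecreasing `y` it
may be taken to be `0`. -/
theorem conv_le {X : Triple} {R K : ℝ} (hX : X ∈ E₁) (ho : Osc X.y R)
    (hs : ∫ η in (0 : ℝ)..1, |src X η| ≤ K) (ξ : ℝ) :
    |P X ξ| ≤ Real.exp R * K ∧ |Q X ξ| ≤ Real.exp R * K := by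
  have hA := E₁.adm hX
  have h1 := (hA.abs_leftConv_le ho ξ).trans
    (mul_le_mul_of_nonneg_left hs (by positivity : 0 ≤ 2 * Real.exp R))
  have h2 := (hA.abs_rightConv_le ho ξ).trans
    (mul_le_mul_of_nonneg_left hs (by positivity : 0 ≤ 2 * Real.exp R))
  rw [P_eq_conv hX, Q_eq_conv hX]
  exact ⟨(abs_quarter_add_le h1 h2).trans (by linarith),
    (abs_quarter_sub_le h1 h2).trans (by linarith)⟩

theorem Bnd.abs_PQ_le {X : Triple} {R : ℝ} (h : Bnd X R) (hX : X ∈ E₁) (ξ : ℝ) :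
    |P X ξ| ≤ boundPQ R ∧ |Q X ξ| ≤ boundPQ R :=
  conv_le hX (h.osc hX) (h.src_le hX) ξ

theorem abs_PQ_sub_le {X Y : Triple} {R D : ℝ} (hX : X ∈ E₁) (hY : Y ∈ E₁) (h : Bnd X R)
    (h' : Bnd Y R) (hD : EBound (X - Y) D) (ξ : ℝ) :
    |P X ξ - P Y ξ| ≤ lipPQ R * D ∧ |Q X ξ - Q Y ξ| ≤ lipPQ R * D := by
  have hA := E₁.adm hX
  have hB := E₁.adm hY
  have hD0 : 0 ≤ D := (abs_nonneg _).trans (hD.y 0)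
  have s1 := h.src_le hX
  have s2 := src_sub_le hX hY h h' hD
  have s3 : 2 * Real.exp R * (2 * D * (∫ η in (0 : ℝ)..1, |src X η|)
      + ∫ η in (0 : ℝ)..1, |src X η - src Y η|) ≤ 2 * (lipPQ R * D) := by
    calc _ ≤ 2 * Real.exp R * (2 * D * (R ^ 3 + R) + (3 * R ^ 2 + 1) * D) := by gcongr
      _ = _ := by rw [lipPQ]; ring
  have h1 := (hA.abs_leftConv_sub_le hB (h.osc hX) (h'.osc hY) (hD.y) ξ).trans s3
  have h2 := (hA.abs_rightConv_sub_le hB (h.osc hX) (h'.osc hY) (hD.y) ξ).trans s3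
  rw [P_eq_conv hX, Q_eq_conv hX, P_eq_conv hY, Q_eq_conv hY]
  constructor
  · rw [← mul_sub, add_sub_add_comm]
    exact (abs_quarter_add_le h1 h2).trans (by linarith)
  · rw [← mul_sub, sub_sub_sub_comm]
    exact (abs_quarter_sub_le h1 h2).trans (by linarith)

/-- A Lipschitz constant of the Lagrangian vector field. -/
noncomputable def lipRhs (R : ℝ) : ℝ :=
  1 + lipPQ R + (boundPQ R + R * lipPQ R + (3 * R ^ 2 + 1)) +
    (2 * (lipPQ R * R * R + boundPQ R * R + boundPQ R * R) + (6 * R + 2 * lipPQ R) * R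
      + (3 * R ^ 2 + 2 * boundPQ R))

theorem abs_three_mul_sub_le {a a' b b' c c' A B L M N : ℝ} (ha' : |a'| ≤ A)
    (hb : |b| ≤ B) (hb' : |b'| ≤ B) (haa : |a - a'| ≤ L) (hbb : |b - b'| ≤ M)
    (hN : |c - c'| ≤ N) :
    |a * b * c - a' * b' * c'| ≤ (L * B + A * M) * |c| + A * B * N := by
  have e : a * b * c - a' * b' * c' = (a - a') * b * c + a' * (b - b') * c + a' * b' * (c - c') := by
    ring
  rw [e]
  have hL := (abs_nonneg _).trans haa
  have hA := (abs_nonneg _).trans ha'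
  have hB := (abs_nonneg _).trans hb
  calc _ ≤ |a - a'| * |b| * |c| + |a'| * |b - b'| * |c| + |a'| * |b'| * |c - c'| := by
        refine (abs_add_three _ _ _).trans (le_of_eq ?_)
        simp only [abs_mul]
    _ ≤ L * B * |c| + A * M * |c| + A * B * N := by gcongr
    _ = _ := by ring

theorem abs_two_mul_sub_le {a a' c c' A L : ℝ} (ha' : |a'| ≤ A) (haa : |a - a'| ≤ L) :
    |a * c - a' * c'| ≤ L * |c| + A * |c - c'| := by
  have e : a * c - a' * c' = (a - a') * c + a' * (c - c') := by ring
  rw [e]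
  calc _ ≤ |a - a'| * |c| + |a'| * |c - c'| := by
        refine (abs_add_le _ _).trans (le_of_eq ?_)
        simp only [abs_mul]
    _ ≤ _ := by gcongr

/-- In every product one factor among `y_ξ`, `U_ξ`, `ν` is measured in `L¹` and the factors `U`,
`P`, `Q` in the supremum norm, so no supremum of `y_ξ` or `ν` is needed. This makes the constant
invariant under relabeling. -/
theorem rhs_lipschitz {X Y : Triple} {R D : ℝ} (hX : X ∈ E₁) (hY : Y ∈ E₁) (h : Bnd X R)
    (h' : Bnd Y R) (hD : EBound (X - Y) D) : EBound (rhs X - rhs Y) (lipRhs R * D) := by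
  have hR := h.nonneg
  have hD0 : 0 ≤ D := (abs_nonneg _).trans (hD.y 0)
  have hK := boundPQ_nonneg hR
  have hL := lipPQ_nonneg hR
  have hXY := E₁.sub hX hY
  have iy := hX.1.1.intervalIntegrable_deriv 0 1
  have iy' := hY.1.1.intervalIntegrable_deriv 0 1
  have iU := hX.2.1.1.intervalIntegrable_deriv 0 1
  have idy := hXY.1.1.intervalIntegrable_deriv 0 1
  have idU := hXY.2.1.1.intervalIntegrable_deriv 0 1
  have is : IntervalIntegrable (fun η => src X η - src Y η) volume 0 1 :=
    (intervalIntegrable_src (E₁.mem_E hX) 0 1).sub (intervalIntegrable_src (E₁.mem_E hY) 0 1)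
  have p1 := h.abs_PQ_le hX
  have p2 := h'.abs_PQ_le hY
  have p3 := abs_PQ_sub_le hX hY h h' hD
  -- `lipRhs` dominates the constants of all five components, so each component is compared with it
  -- by positivity of the remainder.
  have le : ∀ {a : ℝ}, a ≤ lipRhs R → a * D ≤ lipRhs R * D :=
    fun h => mul_le_mul_of_nonneg_right h hD0
  refine ⟨fun ξ => ?_, fun ξ => ?_, ?_, ?_, ?_⟩
  · refine (hD.U ξ).trans ?_
    rw [← one_mul D, ← mul_assoc, mul_one]
    refine le ?_
    rw [lipRhs, ← sub_nonneg]; ring_nf; positivity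
  · have : |-Q X ξ - -Q Y ξ| ≤ lipPQ R * D := by
      rw [neg_sub_neg, abs_sub_comm]; exact (p3 ξ).2
    refine this.trans (le ?_)
    rw [lipRhs, ← sub_nonneg]; ring_nf; positivity
  · refine hD.dU.trans ?_
    rw [← one_mul D, ← mul_assoc, mul_one]
    refine le ?_
    rw [lipRhs, ← sub_nonneg]; ring_nf; positivity
  -- The derivative of the second component is `-Q_ξ = src / 2 - y_ξ P`, so it is controlled without
  -- differentiating the source.
  · have := integral_abs_le_of_ae_le (f := deriv (rhs X - rhs Y).U)
      (a₁ := boundPQ R) (a₂ := lipPQ R * D) (a₃ := 1 / 2) (a₄ := 0)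
      idy iy is is hD.dy h.dy (src_sub_le hX hY h h' hD) (src_sub_le hX hY h h' hD)
      hK (by positivity) (by norm_num) le_rfl ?_
    · refine this.trans (le_trans (le_of_eq ?_)
        (le (a := boundPQ R + lipPQ R * R + 1 / 2 * (3 * R ^ 2 + 1)) ?_))
      · ring
      · rw [lipRhs, ← sub_nonneg]; ring_nf; positivity
    · filter_upwards [Q_hasDerivAt hX, Q_hasDerivAt hY, deriv_sub_ae hX.1.1 hY.1.1] with ξ q1 q2 hy
      have e2 : deriv (X - Y).y ξ = deriv X.y ξ - deriv Y.y ξ := hy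
      have e1 : deriv (rhs X - rhs Y).U ξ = _ := (q1.neg.sub q2.neg).deriv
      rw [e1, e2]
      have e3 := abs_two_mul_sub_le (c := deriv X.y ξ) (c' := deriv Y.y ξ) (p2 ξ).1 (p3 ξ).1
      calc _ = |-(P X ξ * deriv X.y ξ - P Y ξ * deriv Y.y ξ)
            + 1 / 2 * (src X ξ - src Y ξ)| := by congr 1; ring
        _ ≤ |P X ξ * deriv X.y ξ - P Y ξ * deriv Y.y ξ| + 1 / 2 * |src X ξ - src Y ξ| := by
          refine (abs_add_le _ _).trans (le_of_eq ?_)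
          rw [abs_neg, abs_mul, abs_of_nonneg (by norm_num : (0 : ℝ) ≤ 1 / 2)]
        _ ≤ _ := by linarith
  · have := integral_abs_le_of_ae_le (f := (rhs X - rhs Y).ν)
      (a₁ := 2 * (lipPQ R * D * R + boundPQ R * D)) (a₂ := 2 * (boundPQ R * R))
      (a₃ := 6 * R * D + 2 * (lipPQ R * D)) (a₄ := 3 * R ^ 2 + 2 * boundPQ R)
      iy idy iU idU h.dy hD.dy h.dU hD.dU
      (by positivity) (by positivity) (by positivity) (by positivity) ?_
    · refine this.trans (le_trans (le_of_eq ?_)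
        (le (a := 2 * (lipPQ R * R + boundPQ R) * R + 2 * (boundPQ R * R)
          + (6 * R + 2 * lipPQ R) * R + (3 * R ^ 2 + 2 * boundPQ R)) ?_))
      · ring
      · rw [lipRhs, ← sub_nonneg]; ring_nf; positivity
    · filter_upwards [deriv_sub_ae hX.1.1 hY.1.1, deriv_sub_ae hX.2.1.1 hY.2.1.1] with ξ hy hU
      have e1 : deriv (X - Y).y ξ = deriv X.y ξ - deriv Y.y ξ := hy
      have e2 : deriv (X - Y).U ξ = deriv X.U ξ - deriv Y.U ξ := hU
      rw [e1, e2]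
      have t1 := abs_three_mul_sub_le (c := deriv X.y ξ) (c' := deriv Y.y ξ) (p2 ξ).2 (h.U ξ)
        (h'.U ξ) (p3 ξ).2 (hD.U ξ) le_rfl
      have t2 := abs_mul_add_sub_le (c := deriv X.U ξ) (d := deriv Y.U ξ) (hD.U ξ) (h.U ξ) (h'.U ξ)
      have t3 := abs_two_mul_sub_le (c := deriv X.U ξ) (c' := deriv Y.U ξ) (p2 ξ).1 (p3 ξ).1
      have e : (rhs X - rhs Y).ν ξ = -2 * (Q X ξ * X.U ξ * deriv X.y ξ - Q Y ξ * Y.U ξ * deriv Y.y ξ)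
          + 3 * (X.U ξ ^ 2 * deriv X.U ξ - Y.U ξ ^ 2 * deriv Y.U ξ)
          + -2 * (P X ξ * deriv X.U ξ - P Y ξ * deriv Y.U ξ) := by
        change (rhs X).ν ξ - (rhs Y).ν ξ = _
        simp only [rhs]
        ring
      rw [e]
      refine (abs_add_three _ _ _).trans ?_
      rw [abs_mul, abs_mul, abs_mul, abs_neg, abs_of_pos (by norm_num : (0 : ℝ) < 2),
        abs_of_pos (by norm_num : (0 : ℝ) < 3)]
      calc _ ≤ 2 * ((lipPQ R * D * R + boundPQ R * D) * |deriv X.y ξ|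
              + boundPQ R * R * |deriv X.y ξ - deriv Y.y ξ|)
            + 3 * (2 * R * D * |deriv X.U ξ| + R ^ 2 * |deriv X.U ξ - deriv Y.U ξ|)
            + 2 * (lipPQ R * D * |deriv X.U ξ| + boundPQ R * |deriv X.U ξ - deriv Y.U ξ|) := by
            gcongr
        _ = _ := by ring

end VectorField

/-! ### Uniqueness and continuous dependence in the norm of `E`. -/

section Stability

/-- The real value of the norm of `E`. -/
noncomputable def nE (X : Triple) : ℝ := (normE X).toReal

theorem nE_nonneg (X : Triple) : 0 ≤ nE X := ENNReal.toReal_nonneg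

theorem E.add {X Y : Triple} (hX : X ∈ E) (hY : Y ∈ E) : X + Y ∈ E := by
  have := E.sub hX (E.const_smul (-1) hY)
  rwa [neg_one_smul, sub_neg_eq_add] at this

theorem nE_add_le {X Y : Triple} (hX : X ∈ E) (hY : Y ∈ E) : nE (X + Y) ≤ nE X + nE Y := by
  rw [nE, nE, nE, ← ENNReal.toReal_add (normE_lt_top hX).ne (normE_lt_top hY).ne]
  exact ENNReal.toReal_mono (ENNReal.add_lt_top.2 ⟨normE_lt_top hX, normE_lt_top hY⟩).ne
    (normE_add_le hX hY)

theorem nE_smul (c : ℝ) (X : Triple) : nE (c • X) = |c| * nE X := by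
  rw [nE, normE_smul, ENNReal.toReal_mul, nE, toReal_enorm, Real.norm_eq_abs]

theorem nE_neg (X : Triple) : nE (-X) = nE X := by rw [nE, normE_neg, nE]

theorem nE_sub_comm (X Y : Triple) : nE (X - Y) = nE (Y - X) := by rw [← nE_neg, neg_sub]

theorem abs_nE_sub_le {X Y : Triple} (hX : X ∈ E) (hY : Y ∈ E) : |nE X - nE Y| ≤ nE (X - Y) := by
  have h1 := nE_add_le (E.sub hX hY) hY
  have h2 := nE_add_le (E.sub hY hX) hX
  rw [sub_add_cancel] at h1 h2
  rw [nE_sub_comm] at h2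
  rw [abs_le]; constructor <;> linarith

/-- The functional `y(1) - y(0)` is bounded on `E` and reads off the constant `α`; it serves to show
that solutions stay in `E₁`. -/
theorem abs_sub_le_nE {W : Triple} (hW : W ∈ E) : |W.y 1 - W.y 0| ≤ 2 * nE W := by
  have key : ∀ x ∈ Set.Icc (0 : ℝ) 1, |W.y x| ≤ nE W := fun x hx => by
    refine (ENNReal.ofReal_le_iff_le_toReal (normE_lt_top hW).ne).1 ?_
    refine (le_normLinf hW.1.1.continuous hx).trans ?_
    rw [normE, normV, add_assoc, add_assoc]
    exact le_self_add
  have h0 := abs_le.1 (key 0 (by simp))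
  have h1 := abs_le.1 (key 1 (by simp))
  rw [abs_le]; constructor <;> linarith

namespace IsSolution

variable {X Y : Triple} {Z W : ℝ → Triple}

/-- The remainder of the difference quotient. -/
theorem quot_mem (hZ : IsSolution X Z) {s t : ℝ} (hs : 0 ≤ s) (ht : 0 ≤ t) :
    (s - t)⁻¹ • (Z s - Z t) - rhs (Z t) ∈ E :=
  E.sub (E.const_smul _ (E.sub (hZ.mem s hs) (hZ.mem t ht))) (hZ.rhs_mem t ht)

theorem tendsto_quot (hZ : IsSolution X Z) {t : ℝ} (ht : 0 ≤ t) :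
    Tendsto (fun s => nE ((s - t)⁻¹ • (Z s - Z t) - rhs (Z t))) (𝓝[Set.Ici 0 \ {t}] t) (𝓝 0) :=
  (ENNReal.tendsto_toReal ENNReal.zero_ne_top).comp (hZ.hasDeriv t ht)

theorem tendsto_sub (hZ : IsSolution X Z) {t : ℝ} (ht : 0 ≤ t) :
    Tendsto (fun s => nE (Z s - Z t)) (𝓝[Set.Ici 0] t) (𝓝 0) := by
  have h0 : nE (Z t - Z t) = 0 := by
    rw [sub_self, ← zero_smul ℝ (0 : Triple), nE_smul, abs_zero, zero_mul]
  have h1 : Tendsto (fun s => nE (Z s - Z t)) (𝓝[Set.Ici 0 \ {t}] t) (𝓝 0) := by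
    have h2 : Tendsto (fun s => |s - t| * (nE ((s - t)⁻¹ • (Z s - Z t) - rhs (Z t))
        + nE (rhs (Z t)))) (𝓝[Set.Ici 0 \ {t}] t) (𝓝 (|t - t| * (0 + nE (rhs (Z t))))) := by
      refine Tendsto.mul ?_ ((hZ.tendsto_quot ht).add_const _)
      exact ((continuous_id.sub continuous_const).abs.tendsto t).mono_left nhdsWithin_le_nhds
    rw [sub_self, abs_zero, zero_mul] at h2
    refine squeeze_zero' (Eventually.of_forall fun s => nE_nonneg _) ?_ h2
    filter_upwards [self_mem_nhdsWithin] with s hs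
    have hne : s - t ≠ 0 := sub_ne_zero.2 hs.2
    have e : Z s - Z t = (s - t) • (((s - t)⁻¹ • (Z s - Z t) - rhs (Z t)) + rhs (Z t)) := by
      rw [sub_add_cancel, smul_smul, mul_inv_cancel₀ hne, one_smul]
    conv_lhs => rw [e, nE_smul]
    exact mul_le_mul_of_nonneg_left (nE_add_le (hZ.quot_mem hs.1 ht) (hZ.rhs_mem t ht))
      (abs_nonneg _)
  -- The filter of the difference quotient omits `s = t`; there the norm of the difference is `0` by
  -- `h0`.
  rw [tendsto_iff_forall_eventually_mem] at h1 ⊢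
  intro s hs
  have h2 := h1 s hs
  rw [eventually_nhdsWithin_iff] at h2 ⊢
  filter_upwards [h2] with x hx hx0
  by_cases hxt : x = t
  · rw [hxt, h0]; exact mem_of_mem_nhds hs
  · exact hx ⟨hx0, hxt⟩

theorem continuousOn_nE_sub (hZ : IsSolution X Z) (hW : IsSolution Y W) :
    ContinuousOn (fun t => nE (Z t - W t)) (Set.Ici 0) := by
  intro t ht
  rw [ContinuousWithinAt, tendsto_iff_dist_tendsto_zero]
  have h := (hZ.tendsto_sub ht).add (hW.tendsto_sub ht)
  rw [add_zero] at h
  refine squeeze_zero' (Eventually.of_forall fun s => dist_nonneg) ?_ h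
  filter_upwards [self_mem_nhdsWithin] with s hs
  rw [Real.dist_eq]
  refine (abs_nE_sub_le (E.sub (hZ.mem s hs) (hW.mem s hs))
    (E.sub (hZ.mem t ht) (hW.mem t ht))).trans ?_
  rw [show Z s - W s - (Z t - W t) = (Z s - Z t) + -(W s - W t) by abel]
  rw [← nE_neg (W s - W t)]
  refine nE_add_le (E.sub (hZ.mem s hs) (hZ.mem t ht)) ?_
  rw [neg_sub]
  exact E.sub (hW.mem t ht) (hW.mem s hs)

theorem continuousOn_nE (hZ : IsSolution X Z) : ContinuousOn (fun t => nE (Z t)) (Set.Ici 0) := by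
  intro t ht
  rw [ContinuousWithinAt, tendsto_iff_dist_tendsto_zero]
  refine squeeze_zero' (Eventually.of_forall fun s => dist_nonneg) ?_ (hZ.tendsto_sub ht)
  filter_upwards [self_mem_nhdsWithin] with s hs
  exact abs_nE_sub_le (hZ.mem s hs) (hZ.mem t ht)

theorem increment_hasDeriv (hZ : IsSolution X Z) {t : ℝ} (ht : 0 ≤ t) :
    HasDerivWithinAt (fun t => (Z t).y 1 - (Z t).y 0) 0 (Set.Ici 0) t := by
  rw [hasDerivWithinAt_iff_tendsto_slope]
  have h := (hZ.tendsto_quot ht).const_mul 2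
  rw [mul_zero] at h
  refine squeeze_zero_norm' ?_ h
  filter_upwards [self_mem_nhdsWithin] with s hs
  refine le_trans (le_of_eq ?_) (abs_sub_le_nE (hZ.quot_mem hs.1 ht))
  have hU : (Z t).U 1 = (Z t).U 0 := by simpa using (hZ.mem t ht).2.1.2 0
  rw [Real.norm_eq_abs, slope_def_field]
  change _ = |((s - t)⁻¹ * ((Z s).y 1 - (Z t).y 1) - (Z t).U 1)
    - ((s - t)⁻¹ * ((Z s).y 0 - (Z t).y 0) - (Z t).U 0)|
  rw [hU]
  congr 1
  ring

/-- `IsSolution` only asks for membership in `E`. The increment of `y` over a period has time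
derivative `U(1) - U(0) = 0`, so it keeps its initial value `1`. -/
theorem mem_E₁ (hZ : IsSolution X Z) (hX : X ∈ E₁) {t : ℝ} (ht : 0 ≤ t) : Z t ∈ E₁ := by
  have hc : (Z t).y 1 - (Z t).y 0 = (Z 0).y 1 - (Z 0).y 0 := by
    refine constant_of_has_deriv_right_zero (f := fun t => (Z t).y 1 - (Z t).y 0) (a := 0) (b := t)
      (fun s hs => ((hZ.increment_hasDeriv hs.1).continuousWithinAt).mono Set.Icc_subset_Ici_self)
      (fun s hs => (hZ.increment_hasDeriv hs.1).mono (Set.Ici_subset_Ici.2 hs.1)) t ⟨ht, le_rfl⟩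
  obtain ⟨⟨h1, α, hα⟩, h2⟩ := hZ.mem t ht
  have hX1 := hX.1.2 0
  have hα0 := hα 0
  rw [hZ.init] at hc
  rw [zero_add] at hX1 hα0
  have : α = 1 := by linarith
  exact ⟨⟨h1, this ▸ hα⟩, h2⟩

theorem nE_rhs_sub_le {R : ℝ} (hX : X ∈ E₁) (hY : Y ∈ E₁) (h : Bnd X R) (h' : Bnd Y R) :
    nE (rhs X - rhs Y) ≤ 5 * lipRhs R * nE (X - Y) := by
  have h1 := rhs_lipschitz hX hY h h' (EPer.eBound (E₁.sub hX hY))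
  have h2 := h1.normE_le (EPer.mem_E (EPer.sub (rhs_mem_EPer hX) (rhs_mem_EPer hY)))
  have h3 : 0 ≤ 5 * (lipRhs R * nE (X - Y)) := by
    have := (abs_nonneg _).trans (h1.y 0)
    exact mul_nonneg (by norm_num) this
  rw [mul_assoc]
  exact ENNReal.toReal_le_of_le_ofReal h3 h2

/-- Gronwall's estimate for two solutions within invariant bounds. -/
theorem nE_sub_le (hZ : IsSolution X Z) (hW : IsSolution Y W) (hX : X ∈ E₁) (hY : Y ∈ E₁)
    {R T : ℝ} (hZR : ∀ t ∈ Set.Icc 0 T, Bnd (Z t) R) (hWR : ∀ t ∈ Set.Icc 0 T, Bnd (W t) R)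
    {t : ℝ} (ht : t ∈ Set.Icc 0 T) :
    nE (Z t - W t) ≤ nE (X - Y) * Real.exp (5 * lipRhs R * t) := by
  have key := le_gronwallBound_of_liminf_deriv_right_le
    (f := fun t => nE (Z t - W t)) (f' := fun t => nE (rhs (Z t) - rhs (W t)))
    (δ := nE (X - Y)) (K := 5 * lipRhs R) (ε := 0) (a := 0) (b := T)
    ((hZ.continuousOn_nE_sub hW).mono Set.Icc_subset_Ici_self) ?_ ?_ ?_ t ht
  · rwa [gronwallBound_ε0, sub_zero] at key
  · intro x hx r hr
    refine Eventually.frequently ?_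
    have hmono : 𝓝[>] x ≤ 𝓝[Set.Ici 0 \ {x}] x :=
      nhdsWithin_mono _ fun z hz => ⟨hx.1.trans (le_of_lt hz), ne_of_gt hz⟩
    have h1 := (((hZ.tendsto_quot hx.1).add (hW.tendsto_quot hx.1)).const_add
      (nE (rhs (Z x) - rhs (W x)))).mono_left hmono
    rw [add_zero, add_zero] at h1
    filter_upwards [h1.eventually (gt_mem_nhds hr), self_mem_nhdsWithin] with z hz1 hz2
    have hz0 : 0 ≤ z := hx.1.trans (le_of_lt hz2)
    have hpos : 0 < z - x := sub_pos.2 hz2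
    refine lt_of_le_of_lt ?_ hz1
    rw [inv_mul_le_iff₀ hpos]
    set qZ := (z - x)⁻¹ • (Z z - Z x) - rhs (Z x) with hqZ
    set qW := (z - x)⁻¹ • (W z - W x) - rhs (W x) with hqW
    have mZ : qZ ∈ E := hZ.quot_mem hz0 hx.1
    have mW : qW ∈ E := hW.quot_mem hz0 hx.1
    have mr := E.sub (hZ.rhs_mem x hx.1) (hW.rhs_mem x hx.1)
    have m0 := E.sub (hZ.mem x hx.1) (hW.mem x hx.1)
    -- The new difference is the old one plus `z - x` times the difference of the fields and the two
    -- difference-quotient remainders. As the remainders vanish in the limit, the upper right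
    -- derivative of the norm is at most the norm of the difference of the fields.
    have e : Z z - W z = (Z x - W x) + (z - x) • ((rhs (Z x) - rhs (W x)) + (qZ + -qW)) := by
      have : (rhs (Z x) - rhs (W x)) + (qZ + -qW)
          = (z - x)⁻¹ • ((Z z - Z x) - (W z - W x)) := by
        rw [hqZ, hqW, smul_sub (z - x)⁻¹ (Z z - Z x)]; abel
      rw [this, smul_smul, mul_inv_cancel₀ hpos.ne', one_smul]
      abel
    have mW' : -qW ∈ E := by
      have := E.const_smul (-1) mW
      rwa [neg_one_smul] at this
    have b1 := nE_add_le m0 (E.const_smul (z - x) (E.add mr (E.add mZ mW')))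
    have b2 := nE_add_le mr (E.add mZ mW')
    have b3 := nE_add_le mZ mW'
    rw [nE_neg] at b3
    rw [← e, nE_smul, abs_of_pos hpos] at b1
    have b4 : (z - x) * nE ((rhs (Z x) - rhs (W x)) + (qZ + -qW))
        ≤ (z - x) * (nE (rhs (Z x) - rhs (W x)) + (nE qZ + nE qW)) :=
      mul_le_mul_of_nonneg_left (by linarith) hpos.le
    linarith
  · rw [hZ.init, hW.init]
  · intro x hx
    rw [add_zero]
    exact nE_rhs_sub_le (hZ.mem_E₁ hX hx.1) (hW.mem_E₁ hY hx.1) (hZR x ⟨hx.1, hx.2.le⟩)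
      (hWR x ⟨hx.1, hx.2.le⟩)

theorem bnd_of_nE (hX : X ∈ E₁) : Bnd X (nE X) := by
  have htop := (normE_lt_top (E₁.mem_E hX)).ne
  have key : ∀ {r : ℝ}, ENNReal.ofReal r ≤ normE X → r ≤ nE X := fun h =>
    (ENNReal.ofReal_le_iff_le_toReal htop).1 h
  have e : normE X = normV X.y + normV X.U + normL1 X.ν := rfl
  refine ⟨fun ξ => ?_, key ?_, key ?_, key ?_⟩
  · obtain ⟨x, hx, h⟩ := periodic_exists_mem_Icc hX.2.1.2 ξ
    rw [h]
    refine key ((le_normLinf hX.2.1.1.continuous hx).trans ?_)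
    rw [e]
    refine le_trans (le_trans ?_ (le_add_self (b := normV X.y))) le_self_add
    exact le_self_add
  · rw [← normL1_eq (hX.1.1.intervalIntegrable_deriv 0 1), e]
    exact le_trans (le_trans (le_add_self (b := normLinf X.y)) le_self_add) le_self_add
  · rw [← normL1_eq (hX.2.1.1.intervalIntegrable_deriv 0 1), e]
    exact le_trans (le_trans (le_add_self (b := normLinf X.U)) (le_add_self (b := normV X.y)))
      le_self_add
  · rw [← normL1_eq (L1Per.intervalIntegrable hX.2.2 0 1), e]
    exact le_add_self

theorem exists_bnd (hZ : IsSolution X Z) (hX : X ∈ E₁) (T : ℝ) :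
    ∃ R, ∀ t ∈ Set.Icc 0 T, Bnd (Z t) R := by
  obtain ⟨R, hR⟩ := isCompact_Icc.exists_bound_of_continuousOn
    (hZ.continuousOn_nE.mono (fun t (ht : t ∈ Set.Icc 0 T) => ht.1))
  refine ⟨R, fun t ht => (bnd_of_nE (hZ.mem_E₁ hX ht.1)).mono ?_⟩
  exact (le_abs_self _).trans (hR t ht)

/-- The first two components are bounded pointwise by the norm. For the third, periodicity gives a
null set on each unit interval, and countably many of these cover the line. -/
theorem sameE_of_nE_eq_zero (hX : X ∈ E₁) (hY : Y ∈ E₁) (h : nE (X - Y) = 0) : SameE X Y := by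
  have hXY := E₁.sub hX hY
  have hB := EPer.eBound hXY
  change EBound (X - Y) (nE (X - Y)) at hB
  rw [h] at hB
  refine ⟨?_, ?_, ?_⟩
  · funext ξ
    exact sub_eq_zero.1 (abs_nonpos_iff.1 (hB.y ξ))
  · funext ξ
    exact sub_eq_zero.1 (abs_nonpos_iff.1 (hB.U ξ))
  · have hi := fun a b => L1Per.intervalIntegrable hXY.2.2 a b
    have hp := Adm.periodic_abs hXY.2.2.2
    have h1 : ∀ n : ℤ, ∀ᵐ x ∂(volume.restrict (Set.Ioc (n : ℝ) (n + 1))), |(X - Y).ν x| = 0 := by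
      intro n
      have h0 : ∫ x in (n : ℝ)..(n + 1), |(X - Y).ν x| ≤ 0 := by
        have := hp.intervalIntegral_add_eq (n : ℝ) 0
        rw [zero_add] at this
        rw [this]
        exact hB.ν
      have h0' : ∫ x in (n : ℝ)..(n + 1), |(X - Y).ν x| = 0 :=
        le_antisymm h0 (intervalIntegral.integral_nonneg (by linarith) fun _ _ => abs_nonneg _)
      rw [intervalIntegral.integral_of_le (by linarith), integral_eq_zero_iff_of_nonneg
        (fun _ => abs_nonneg _) (hi _ _).1.abs] at h0'
      exact h0'
    have h2 : ∀ᵐ x ∂(volume.restrict (⋃ n : ℤ, Set.Ioc (n : ℝ) (n + 1))), |(X - Y).ν x| = 0 :=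
      (ae_restrict_iUnion_iff _ _).2 h1
    rw [iUnion_Ioc_intCast, Measure.restrict_univ] at h2
    filter_upwards [h2] with x hx
    exact sub_eq_zero.1 (abs_eq_zero.1 hx)

/-- Uniqueness of solutions. -/
theorem unique (hZ : IsSolution X Z) (hW : IsSolution X W) (hX : X ∈ E₁) {t : ℝ} (ht : 0 ≤ t) :
    SameE (Z t) (W t) := by
  obtain ⟨R₁, h₁⟩ := hZ.exists_bnd hX t
  obtain ⟨R₂, h₂⟩ := hW.exists_bnd hX t
  have := hZ.nE_sub_le hW hX hX (R := max R₁ R₂) (fun s hs => (h₁ s hs).mono (le_max_left _ _))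
    (fun s hs => (h₂ s hs).mono (le_max_right _ _)) (t := t) ⟨ht, le_rfl⟩
  rw [sub_self, ← zero_smul ℝ (0 : Triple), nE_smul, abs_zero, zero_mul, zero_mul] at this
  exact sameE_of_nE_eq_zero (hZ.mem_E₁ hX ht) (hW.mem_E₁ hX ht) (le_antisymm this (nE_nonneg _))

end IsSolution

end Stability

/-! ### A Banach space of bounded functions defined at every point. -/

section StateSpace

/-- Bounded, periodic and measurable functions, with the supremum norm. -/
def boundedPeriodic : Submodule ℝ (lp (fun _ : ℝ => ℝ) ∞) where
  carrier := {v | Function.Periodic (v : ℝ → ℝ) 1 ∧ AEStronglyMeasurable (v : ℝ → ℝ) volume}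
  add_mem' := fun {a b} ha hb => ⟨fun ξ => by
    rw [lp.coeFn_add, Pi.add_apply, Pi.add_apply, ha.1 ξ, hb.1 ξ], by
    rw [lp.coeFn_add]; exact ha.2.add hb.2⟩
  zero_mem' := ⟨fun ξ => rfl, aestronglyMeasurable_const⟩
  smul_mem' := fun c a ha => ⟨fun ξ => by
    rw [lp.coeFn_smul, Pi.smul_apply, Pi.smul_apply, ha.1 ξ], by
    rw [lp.coeFn_smul]; exact ha.2.const_smul c⟩

/-- The Banach space of bounded, periodic and measurable functions. -/
def PB : Type := boundedPeriodic

noncomputable instance : NormedAddCommGroup PB := inferInstanceAs (NormedAddCommGroup boundedPeriodic)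

noncomputable instance : NormedSpace ℝ PB := inferInstanceAs (NormedSpace ℝ boundedPeriodic)

/-- The underlying function. -/
def PB.ev (v : PB) : ℝ → ℝ := fun ξ => v.1 ξ

namespace PB

/-- Convergence in norm is uniform, hence pointwise everywhere, and pointwise limits of sequences
preserve periodicity and measurability. -/
theorem isClosed : IsClosed (boundedPeriodic : Set (lp (fun _ : ℝ => ℝ) ∞)) := by
  refine IsSeqClosed.isClosed fun u v hu hv => ?_
  have hpt : ∀ ξ, Tendsto (fun n => u n ξ) atTop (𝓝 (v ξ)) := fun ξ => by
    have := hv.sub_const v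
    rw [sub_self] at this
    have h2 := this.norm
    rw [norm_zero] at h2
    rw [tendsto_iff_norm_sub_tendsto_zero]
    refine squeeze_zero (fun n => norm_nonneg _) (fun n => ?_) h2
    exact lp.norm_apply_le_norm ENNReal.top_ne_zero (u n - v) ξ
  refine ⟨fun ξ => ?_, ?_⟩
  · refine tendsto_nhds_unique (hpt (ξ + 1)) ?_
    have : (fun n => u n (ξ + 1)) = fun n => u n ξ := funext fun n => (hu n).1 ξ
    rw [this]
    exact hpt ξ
  · exact aestronglyMeasurable_of_tendsto_ae atTop (fun n => (hu n).2)
      (Eventually.of_forall hpt)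

instance : CompleteSpace PB := by
  have : CompleteSpace boundedPeriodic := isClosed.completeSpace_coe
  exact this

/-- The element given by a bounded function. -/
def mk (f : ℝ → ℝ) (hp : Function.Periodic f 1) (hm : AEStronglyMeasurable f volume)
    (hb : ∃ C, ∀ ξ, |f ξ| ≤ C) : PB :=
  ⟨⟨f, memℓp_infty (by
    obtain ⟨C, hC⟩ := hb
    exact ⟨C, by rintro _ ⟨ξ, rfl⟩; exact hC ξ⟩)⟩, hp, hm⟩

theorem abs_ev_le (v : PB) (ξ : ℝ) : |v.ev ξ| ≤ ‖v‖ :=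
  lp.norm_apply_le_norm ENNReal.top_ne_zero v.1 ξ

theorem norm_le {v : PB} {C : ℝ} (hC : 0 ≤ C) (h : ∀ ξ, |v.ev ξ| ≤ C) : ‖v‖ ≤ C :=
  lp.norm_le_of_forall_le hC h

theorem ev_periodic (v : PB) : Function.Periodic v.ev 1 := v.2.1

theorem ev_aesm (v : PB) : AEStronglyMeasurable v.ev volume := v.2.2

theorem intervalIntegrable (v : PB) (a b : ℝ) : IntervalIntegrable v.ev volume a b := by
  rw [intervalIntegrable_iff]
  refine Measure.integrableOn_of_bounded (M := ‖v‖) (by simp) v.ev_aesm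
    (Eventually.of_forall fun ξ => v.abs_ev_le ξ)

theorem abs_integral_le (v : PB) {a b : ℝ} (h : |b - a| ≤ 1) :
    |∫ ξ in a..b, v.ev ξ| ≤ ‖v‖ := by
  have := intervalIntegral.norm_integral_le_of_norm_le_const (a := a) (b := b) (f := v.ev)
    (C := ‖v‖) fun ξ _ => v.abs_ev_le ξ
  rw [Real.norm_eq_abs] at this
  exact this.trans (mul_le_of_le_one_right (norm_nonneg _) h)

/-- Evaluation at a point. -/
noncomputable def evL (ξ : ℝ) : PB →L[ℝ] ℝ :=
  LinearMap.mkContinuous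
    { toFun := fun v => v.ev ξ, map_add' := fun _ _ => rfl, map_smul' := fun _ _ => rfl } 1
    fun v => by rw [one_mul]; exact v.abs_ev_le ξ

/-- The mean value over a period. -/
noncomputable def mean : PB →L[ℝ] ℝ :=
  LinearMap.mkContinuous
    { toFun := fun v => ∫ ξ in (0 : ℝ)..1, v.ev ξ
      map_add' := fun v w => by
        rw [← intervalIntegral.integral_add (v.intervalIntegrable 0 1) (w.intervalIntegrable 0 1)]
        rfl
      map_smul' := fun c v => by
        rw [RingHom.id_apply, smul_eq_mul, ← intervalIntegral.integral_const_mul]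
        rfl } 1
    fun v => by rw [one_mul]; exact v.abs_integral_le (by simp)

theorem mean_apply (v : PB) : mean v = ∫ ξ in (0 : ℝ)..1, v.ev ξ := rfl

theorem abs_mean_le (v : PB) : |mean v| ≤ ‖v‖ := v.abs_integral_le (by simp)

/-- The function whose value at `0` is the mean of `v` and whose derivative is `v - mean v`. -/
noncomputable def J (v : PB) (ξ : ℝ) : ℝ := mean v + ∫ η in (0 : ℝ)..ξ, (v.ev η - mean v)

theorem intervalIntegrable_sub_mean (v : PB) (a b : ℝ) :
    IntervalIntegrable (fun η => v.ev η - mean v) volume a b :=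
  (v.intervalIntegrable a b).sub intervalIntegrable_const

theorem J_eq (v : PB) (ξ : ℝ) : v.J ξ = mean v * (1 - ξ) + ∫ η in (0 : ℝ)..ξ, v.ev η := by
  rw [J, intervalIntegral.integral_sub (v.intervalIntegrable 0 ξ) intervalIntegrable_const,
    intervalIntegral.integral_const, smul_eq_mul]
  ring

theorem J_zero (v : PB) : v.J 0 = mean v := by rw [J_eq]; simp

theorem J_w11Loc (v : PB) : W11Loc v.J :=
  (W11Loc.const _).add (w11Loc_primitive v.intervalIntegrable_sub_mean 0)

theorem J_hasDerivAt (v : PB) : ∀ᵐ ξ : ℝ, HasDerivAt v.J (v.ev ξ - mean v) ξ := by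
  filter_upwards [deriv_primitive v.intervalIntegrable_sub_mean 0] with ξ h
  exact h.const_add _

/-- Subtracting the mean makes the integral over a period vanish. The mean, thus set free, stores
the value at `0`: one bounded function encodes a periodic Lipschitz function. -/
theorem J_periodic (v : PB) : Function.Periodic v.J 1 := by
  intro ξ
  have hp : Function.Periodic (fun η => v.ev η - mean v) 1 := fun η => by
    simp only [v.ev_periodic η]
  have h := hp.intervalIntegral_add_eq ξ 0
  have h0 : ∫ η in (0 : ℝ)..1, (v.ev η - mean v) = 0 := by
    rw [intervalIntegral.integral_sub (v.intervalIntegrable 0 1) intervalIntegrable_const,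
      ← mean_apply, intervalIntegral.integral_const]
    simp
  rw [zero_add, h0] at h
  rw [J, J, ← intervalIntegral.integral_add_adjacent_intervals
    (v.intervalIntegrable_sub_mean 0 ξ) (v.intervalIntegrable_sub_mean ξ (ξ + 1)), h, add_zero]

theorem J_add (v w : PB) (ξ : ℝ) : (v + w).J ξ = v.J ξ + w.J ξ := by
  have h : ∫ η in (0 : ℝ)..ξ, (v + w).ev η
      = (∫ η in (0 : ℝ)..ξ, v.ev η) + ∫ η in (0 : ℝ)..ξ, w.ev η :=
    intervalIntegral.integral_add (v.intervalIntegrable 0 ξ) (w.intervalIntegrable 0 ξ)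
  rw [J_eq, J_eq, J_eq, map_add, h]
  ring

theorem J_smul (c : ℝ) (v : PB) (ξ : ℝ) : (c • v).J ξ = c * v.J ξ := by
  have h : ∫ η in (0 : ℝ)..ξ, (c • v).ev η = c * ∫ η in (0 : ℝ)..ξ, v.ev η :=
    intervalIntegral.integral_const_mul c v.ev
  rw [J_eq, J_eq, map_smul, h, smul_eq_mul]
  ring

theorem abs_J_le (v : PB) (ξ : ℝ) : |v.J ξ| ≤ 3 * ‖v‖ := by
  obtain ⟨x, hx, h⟩ := periodic_exists_mem_Icc v.J_periodic ξ
  rw [h, J_eq]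
  have h1 : |mean v * (1 - x)| ≤ ‖v‖ := by
    rw [abs_mul]
    refine (mul_le_of_le_one_right (abs_nonneg _) ?_).trans v.abs_mean_le
    rw [abs_le]; constructor <;> linarith [hx.1, hx.2]
  have h2 : |∫ η in (0 : ℝ)..x, v.ev η| ≤ ‖v‖ := v.abs_integral_le (by
    rw [abs_le]; constructor <;> linarith [hx.1, hx.2])
  have h3 := norm_nonneg v
  exact (abs_add_le _ _).trans (by linarith)

/-- `J` at a point as a continuous functional. -/
noncomputable def JL (ξ : ℝ) : PB →L[ℝ] ℝ :=
  LinearMap.mkContinuous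
    { toFun := fun v => v.J ξ, map_add' := fun v w => v.J_add w ξ
      map_smul' := fun c v => v.J_smul c ξ } 3 fun v => v.abs_J_le ξ

theorem J_sub (v w : PB) (ξ : ℝ) : (v - w).J ξ = v.J ξ - w.J ξ := map_sub (JL ξ) v w

end PB

/-- The state space: the characteristics, the velocity and the energy density. -/
abbrev State : Type := PB × PB × PB

namespace State

/-- The spatial derivative of the characteristics. -/
noncomputable def p (x : State) (ξ : ℝ) : ℝ := 1 + (x.1.ev ξ - PB.mean x.1)

/-- The spatial derivative of the velocity. -/
noncomputable def q (x : State) (ξ : ℝ) : ℝ := x.2.1.ev ξ - PB.mean x.2.1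

/-- The triple described by a state. -/
noncomputable def toTriple (x : State) : Triple := (fun ξ => ξ + x.1.J ξ, x.2.1.J, x.2.2.ev)

/-- The linear part of `toTriple`. -/
noncomputable def lin (x : State) : Triple := (x.1.J, x.2.1.J, x.2.2.ev)

variable (x x' : State)

theorem norm_fst : ‖x.1‖ ≤ ‖x‖ := norm_fst_le x

theorem norm_snd : ‖x.2.1‖ ≤ ‖x‖ := (norm_fst_le x.2).trans (norm_snd_le x)

theorem norm_trd : ‖x.2.2‖ ≤ ‖x‖ := (norm_snd_le x.2).trans (norm_snd_le x)

theorem norm_le_of {x : State} {C : ℝ} (h1 : ‖x.1‖ ≤ C) (h2 : ‖x.2.1‖ ≤ C) (h3 : ‖x.2.2‖ ≤ C) :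
    ‖x‖ ≤ C := norm_prod_le_iff.2 ⟨h1, norm_prod_le_iff.2 ⟨h2, h3⟩⟩

theorem mem_L1Per (v : PB) : v.ev ∈ L1Per :=
  ⟨locallyIntegrable_iff_intervalIntegrable.2 v.intervalIntegrable, v.ev_periodic⟩

theorem mem_W11Per (v : PB) : v.J ∈ W11Per := ⟨v.J_w11Loc, v.J_periodic⟩

theorem toTriple_mem : x.toTriple ∈ E₁ :=
  ⟨⟨W11Loc.id.add x.1.J_w11Loc, fun ξ => by
    change ξ + 1 + x.1.J (ξ + 1) = ξ + x.1.J ξ + 1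
    rw [x.1.J_periodic ξ]; ring⟩, mem_W11Per _, mem_L1Per _⟩

theorem lin_mem : x.lin ∈ EPer := ⟨mem_W11Per _, mem_W11Per _, mem_L1Per _⟩

theorem toTriple_sub : x.toTriple - x'.toTriple = (x - x').lin := by
  refine Prod.ext (funext fun ξ => ?_) (Prod.ext (funext fun ξ => ?_) rfl)
  · change ξ + x.1.J ξ - (ξ + x'.1.J ξ) = (x.1 - x'.1).J ξ
    rw [PB.J_sub]; ring
  · exact (PB.J_sub _ _ _).symm

theorem lin_sub : x.lin - x'.lin = (x - x').lin := by
  refine Prod.ext (funext fun ξ => ?_) (Prod.ext (funext fun ξ => ?_) rfl)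
  · exact (PB.J_sub _ _ _).symm
  · exact (PB.J_sub _ _ _).symm

theorem lin_smul (c : ℝ) : c • x.lin = (c • x).lin := by
  refine Prod.ext (funext fun ξ => ?_) (Prod.ext (funext fun ξ => ?_) rfl)
  · exact (PB.J_smul _ _ _).symm
  · exact (PB.J_smul _ _ _).symm

theorem hasDerivAt_y : ∀ᵐ ξ : ℝ, HasDerivAt x.toTriple.y (x.p ξ) ξ := by
  filter_upwards [x.1.J_hasDerivAt] with ξ h
  exact (hasDerivAt_id ξ).add h

theorem hasDerivAt_U : ∀ᵐ ξ : ℝ, HasDerivAt x.toTriple.U (x.q ξ) ξ := x.2.1.J_hasDerivAt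

theorem deriv_y : deriv x.toTriple.y =ᵐ[volume] x.p := x.hasDerivAt_y.mono fun _ h => h.deriv

theorem deriv_U : deriv x.toTriple.U =ᵐ[volume] x.q := x.hasDerivAt_U.mono fun _ h => h.deriv

theorem integral_abs_le {f g : ℝ → ℝ} {C : ℝ} (h : f =ᵐ[volume] g) (hg : ∀ ξ, |g ξ| ≤ C) :
    ∫ ξ in (0 : ℝ)..1, |f ξ| ≤ C := by
  have := intervalIntegral.norm_integral_le_of_norm_le (f := fun x => |f x|) (g := fun _ => C)
    (a := 0) (b := 1) (μ := volume) zero_le_one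
    (h.mono fun x hx _ => by simpa [hx] using hg x) intervalIntegrable_const
  simpa using (le_abs_self _).trans this

theorem abs_sub_mean_le (v : PB) (ξ : ℝ) : |v.ev ξ - PB.mean v| ≤ 2 * ‖v‖ := by
  have h1 := v.abs_ev_le ξ
  have h2 := v.abs_mean_le
  exact (abs_sub _ _).trans (by linarith)

theorem eBound_lin : EBound x.lin (3 * ‖x‖) := by
  have h := norm_nonneg x
  have n1 := x.norm_fst
  have n2 := x.norm_snd
  have n3 := x.norm_trd
  refine ⟨fun ξ => (x.1.abs_J_le ξ).trans (by linarith),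
    fun ξ => (x.2.1.abs_J_le ξ).trans (by linarith), ?_, ?_, ?_⟩
  · exact integral_abs_le (x.1.J_hasDerivAt.mono fun _ h => h.deriv)
      fun ξ => (abs_sub_mean_le _ ξ).trans (by linarith)
  · exact integral_abs_le (x.2.1.J_hasDerivAt.mono fun _ h => h.deriv)
      fun ξ => (abs_sub_mean_le _ ξ).trans (by linarith)
  · exact integral_abs_le ae_eq_rfl fun ξ => (x.2.2.abs_ev_le ξ).trans (by linarith)

theorem bnd_toTriple : Bnd x.toTriple (3 * ‖x‖ + 1) := by
  have h := norm_nonneg x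
  have n1 := x.norm_fst
  have n2 := x.norm_snd
  have n3 := x.norm_trd
  refine ⟨fun ξ => (x.2.1.abs_J_le ξ).trans (by linarith), ?_, ?_, ?_⟩
  · refine integral_abs_le x.deriv_y fun ξ => ?_
    have := abs_sub_mean_le x.1 ξ
    rw [p]
    exact (abs_add_le _ _).trans (by rw [abs_one]; linarith)
  · exact integral_abs_le x.deriv_U fun ξ => (abs_sub_mean_le _ ξ).trans (by linarith)
  · exact integral_abs_le ae_eq_rfl fun ξ => (x.2.2.abs_ev_le ξ).trans (by linarith)

end State

end StateSpace

/-! ### The vector field on the state space, locally Lipschitz in the supremum norm. -/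

section StateField

/-- Families of functions that are bounded and Lipschitz, uniformly on bounded sets of states. -/
def LocLip (Φ : State → ℝ → ℝ) : Prop :=
  ∀ R : ℝ, ∃ K, 0 ≤ K ∧ (∀ x, ‖x‖ ≤ R → ∀ ξ, |Φ x ξ| ≤ K) ∧
    ∀ x x', ‖x‖ ≤ R → ‖x'‖ ≤ R → ∀ ξ, |Φ x ξ - Φ x' ξ| ≤ K * ‖x - x'‖

namespace LocLip

variable {Φ Ψ : State → ℝ → ℝ}

theorem const (c : ℝ) : LocLip fun _ _ => c := fun _ =>
  ⟨|c|, abs_nonneg _, fun _ _ _ => le_rfl, fun x x' _ _ _ => by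
    rw [sub_self, abs_zero]; positivity⟩

theorem add (h : LocLip Φ) (h' : LocLip Ψ) : LocLip fun x ξ => Φ x ξ + Ψ x ξ := fun R => by
  obtain ⟨K, hK, h1, h2⟩ := h R
  obtain ⟨L, hL, k1, k2⟩ := h' R
  refine ⟨K + L, add_nonneg hK hL, fun x hx ξ => ?_, fun x x' hx hx' ξ => ?_⟩
  · exact (abs_add_le _ _).trans (add_le_add (h1 x hx ξ) (k1 x hx ξ))
  · rw [add_sub_add_comm, add_mul]
    exact (abs_add_le _ _).trans (add_le_add (h2 x x' hx hx' ξ) (k2 x x' hx hx' ξ))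

theorem mul (h : LocLip Φ) (h' : LocLip Ψ) : LocLip fun x ξ => Φ x ξ * Ψ x ξ := fun R => by
  obtain ⟨K, hK, h1, h2⟩ := h R
  obtain ⟨L, hL, k1, k2⟩ := h' R
  refine ⟨K * L + K * L, by positivity, fun x hx ξ => ?_, fun x x' hx hx' ξ => ?_⟩
  · rw [abs_mul]
    have := mul_le_mul (h1 x hx ξ) (k1 x hx ξ) (abs_nonneg _) hK
    have : 0 ≤ K * L := by positivity
    linarith
  · have e : Φ x ξ * Ψ x ξ - Φ x' ξ * Ψ x' ξ
        = (Φ x ξ - Φ x' ξ) * Ψ x ξ + Φ x' ξ * (Ψ x ξ - Ψ x' ξ) := by ring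
    rw [e]
    calc _ ≤ |Φ x ξ - Φ x' ξ| * |Ψ x ξ| + |Φ x' ξ| * |Ψ x ξ - Ψ x' ξ| := by
          refine (abs_add_le _ _).trans (le_of_eq ?_)
          rw [abs_mul, abs_mul]
      _ ≤ (K * ‖x - x'‖) * L + K * (L * ‖x - x'‖) := by
          gcongr
          exacts [h2 x x' hx hx' ξ, k1 x hx ξ, h1 x' hx' ξ, k2 x x' hx hx' ξ]
      _ = _ := by ring

theorem sub (h : LocLip Φ) (h' : LocLip Ψ) : LocLip fun x ξ => Φ x ξ - Ψ x ξ := by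
  have := h.add ((const (-1)).mul h')
  simpa [sub_eq_add_neg] using this

theorem of_linear {C : ℝ} (hC : 0 ≤ C) (L : ℝ → State → ℝ)
    (hs : ∀ ξ x x', L ξ x - L ξ x' = L ξ (x - x')) (h : ∀ ξ x, |L ξ x| ≤ C * ‖x‖) :
    LocLip fun x ξ => L ξ x := fun R => by
  refine ⟨max C (C * R), le_max_of_le_left hC, fun x hx ξ => ?_, fun x x' _ _ ξ => ?_⟩
  · exact (h ξ x).trans (le_max_of_le_right (by gcongr))
  · rw [hs]
    exact (h ξ _).trans (by gcongr; exact le_max_left _ _)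

theorem p : LocLip State.p := by
  refine (const 1).add (of_linear (C := 2) (by norm_num) (fun ξ x => x.1.ev ξ - PB.mean x.1)
    (fun ξ x x' => ?_) fun ξ x => ?_)
  · change _ = (x.1.ev ξ - x'.1.ev ξ) - PB.mean (x.1 - x'.1)
    rw [map_sub]; ring
  · exact (State.abs_sub_mean_le _ _).trans (by gcongr; exact x.norm_fst)

theorem q : LocLip State.q := by
  refine of_linear (C := 2) (by norm_num) (fun ξ x => x.2.1.ev ξ - PB.mean x.2.1)
    (fun ξ x x' => ?_) fun ξ x => ?_
  · change _ = (x.2.1.ev ξ - x'.2.1.ev ξ) - PB.mean (x.2.1 - x'.2.1)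
    rw [map_sub]; ring
  · exact (State.abs_sub_mean_le _ _).trans (by gcongr; exact x.norm_snd)

theorem n : LocLip fun x => x.2.2.ev := by
  refine of_linear (C := 1) (by norm_num) (fun ξ x => x.2.2.ev ξ) (fun ξ x x' => rfl) fun ξ x => ?_
  rw [one_mul]
  exact (PB.abs_ev_le _ _).trans x.norm_trd

theorem U : LocLip fun x => x.2.1.J := by
  refine of_linear (C := 3) (by norm_num) (fun ξ x => x.2.1.J ξ)
    (fun ξ x x' => (PB.J_sub _ _ _).symm) fun ξ x => ?_
  exact (PB.abs_J_le _ _).trans (by gcongr; exact x.norm_snd)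

theorem PQ_aux (R : ℝ) {x x' : State} (hx : ‖x‖ ≤ R) (hx' : ‖x'‖ ≤ R) (ξ : ℝ) :
    |P x.toTriple ξ - P x'.toTriple ξ| ≤ lipPQ (3 * R + 1) * (3 * ‖x - x'‖) ∧
    |Q x.toTriple ξ - Q x'.toTriple ξ| ≤ lipPQ (3 * R + 1) * (3 * ‖x - x'‖) := by
  refine abs_PQ_sub_le x.toTriple_mem x'.toTriple_mem (x.bnd_toTriple.mono (by linarith))
    (x'.bnd_toTriple.mono (by linarith)) ?_ ξ
  rw [State.toTriple_sub]
  exact State.eBound_lin _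

theorem P : LocLip fun x => P x.toTriple := fun R => by
  rcases lt_or_ge R 0 with hR | hR
  · exact ⟨0, le_rfl, fun x hx => absurd ((norm_nonneg x).trans hx) (not_le.2 hR),
      fun x _ hx => absurd ((norm_nonneg x).trans hx) (not_le.2 hR)⟩
  · have h1 := boundPQ_nonneg (R := 3 * R + 1) (by linarith)
    have h2 := lipPQ_nonneg (R := 3 * R + 1) (by linarith)
    refine ⟨boundPQ (3 * R + 1) + 3 * lipPQ (3 * R + 1), by positivity, fun x hx ξ => ?_,
      fun x x' hx hx' ξ => ?_⟩
    · have := ((x.bnd_toTriple.mono (by linarith : _ ≤ 3 * R + 1)).abs_PQ_le x.toTriple_mem ξ).1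
      linarith
    · have := (PQ_aux R hx hx' ξ).1
      have h3 := mul_nonneg h1 (norm_nonneg (x - x'))
      linarith

theorem Q : LocLip fun x => Q x.toTriple := fun R => by
  rcases lt_or_ge R 0 with hR | hR
  · exact ⟨0, le_rfl, fun x hx => absurd ((norm_nonneg x).trans hx) (not_le.2 hR),
      fun x _ hx => absurd ((norm_nonneg x).trans hx) (not_le.2 hR)⟩
  · have h1 := boundPQ_nonneg (R := 3 * R + 1) (by linarith)
    have h2 := lipPQ_nonneg (R := 3 * R + 1) (by linarith)
    refine ⟨boundPQ (3 * R + 1) + 3 * lipPQ (3 * R + 1), by positivity, fun x hx ξ => ?_,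
      fun x x' hx hx' ξ => ?_⟩
    · have := ((x.bnd_toTriple.mono (by linarith : _ ≤ 3 * R + 1)).abs_PQ_le x.toTriple_mem ξ).2
      linarith
    · have := (PQ_aux R hx hx' ξ).2
      have h3 := mul_nonneg h1 (norm_nonneg (x - x'))
      linarith

theorem comp_zero (h : LocLip Φ) : LocLip fun x _ => Φ x 0 := fun R => by
  obtain ⟨K, hK, h1, h2⟩ := h R
  exact ⟨K, hK, fun x hx _ => h1 x hx 0, fun x x' hx hx' _ => h2 x x' hx hx' 0⟩

end LocLip

namespace State

/-- The time derivative of `U_ξ`, with mean value adapted to the representation of `U`. -/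
noncomputable def velField (x : State) (ξ : ℝ) : ℝ :=
  1 / 2 * x.2.2.ev ξ + (1 / 2 * (x.2.1.J ξ * x.2.1.J ξ) - P x.toTriple ξ) * x.p ξ
    - Q x.toTriple 0

/-- The time derivative of the energy density. -/
noncomputable def energyField (x : State) (ξ : ℝ) : ℝ :=
  -2 * (Q x.toTriple ξ * x.2.1.J ξ * x.p ξ)
    + (3 * (x.2.1.J ξ * x.2.1.J ξ) - 2 * P x.toTriple ξ) * x.q ξ

theorem velField_locLip : LocLip velField :=
  (((LocLip.const (1 / 2)).mul LocLip.n).add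
    ((((LocLip.const (1 / 2)).mul (LocLip.U.mul LocLip.U)).sub LocLip.P).mul LocLip.p)).sub
    LocLip.Q.comp_zero

theorem energyField_locLip : LocLip energyField :=
  ((LocLip.const (-2)).mul ((LocLip.Q.mul LocLip.U).mul LocLip.p)).add
    ((((LocLip.const 3).mul (LocLip.U.mul LocLip.U)).sub ((LocLip.const 2).mul LocLip.P)).mul
      LocLip.q)

variable (x : State)

theorem p_periodic : Function.Periodic x.p 1 := fun ξ => by simp only [p, x.1.ev_periodic ξ]

theorem q_periodic : Function.Periodic x.q 1 := fun ξ => by simp only [q, x.2.1.ev_periodic ξ]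

theorem p_aesm : AEStronglyMeasurable x.p volume :=
  aestronglyMeasurable_const.add (x.1.ev_aesm.sub aestronglyMeasurable_const)

theorem q_aesm : AEStronglyMeasurable x.q volume := x.2.1.ev_aesm.sub aestronglyMeasurable_const

theorem P_aesm : AEStronglyMeasurable (P x.toTriple) volume :=
  (P_mem x.toTriple_mem).1.continuous.aestronglyMeasurable

theorem Q_aesm : AEStronglyMeasurable (Q x.toTriple) volume :=
  (Q_mem x.toTriple_mem).1.continuous.aestronglyMeasurable

theorem U_aesm : AEStronglyMeasurable x.2.1.J volume :=
  x.2.1.J_w11Loc.continuous.aestronglyMeasurable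

/-- The Lagrangian vector field on the state space. -/
noncomputable def field : State :=
  (x.2.1,
    PB.mk x.velField (fun ξ => by
        simp only [velField, x.2.2.ev_periodic ξ, x.2.1.J_periodic ξ, x.p_periodic ξ,
          (P_mem x.toTriple_mem).2 ξ])
      (((x.2.2.ev_aesm.const_mul _).add
        ((((x.U_aesm.mul x.U_aesm).const_mul _).sub x.P_aesm).mul x.p_aesm)).sub
          aestronglyMeasurable_const)
      (by
        obtain ⟨K, _, h, _⟩ := velField_locLip ‖x‖
        exact ⟨K, h x le_rfl⟩),
    PB.mk x.energyField (fun ξ => by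
        simp only [energyField, x.2.1.J_periodic ξ, x.p_periodic ξ, x.q_periodic ξ,
          (P_mem x.toTriple_mem).2 ξ, (Q_mem x.toTriple_mem).2 ξ])
      ((((x.Q_aesm.mul x.U_aesm).mul x.p_aesm).const_mul _).add
        ((((x.U_aesm.mul x.U_aesm).const_mul _).sub (x.P_aesm.const_mul _)).mul x.q_aesm))
      (by
        obtain ⟨K, _, h, _⟩ := energyField_locLip ‖x‖
        exact ⟨K, h x le_rfl⟩))

theorem field_fst : x.field.1 = x.2.1 := rfl

theorem ev_field_snd (ξ : ℝ) : x.field.2.1.ev ξ = x.velField ξ := rfl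

theorem ev_field_trd (ξ : ℝ) : x.field.2.2.ev ξ = x.energyField ξ := rfl

theorem field_locLip (R : ℝ) : ∃ K : ℝ≥0, (∀ x : State, ‖x‖ ≤ R → ‖x.field‖ ≤ K) ∧
    ∀ x x' : State, ‖x‖ ≤ R → ‖x'‖ ≤ R → ‖x.field - x'.field‖ ≤ K * ‖x - x'‖ := by
  obtain ⟨K₁, hK₁, h1, h2⟩ := velField_locLip R
  obtain ⟨K₂, hK₂, k1, k2⟩ := energyField_locLip R
  have hm : |R| + 1 + K₁ + K₂ ≤ (|R| + 1 + K₁ + K₂).toNNReal := Real.le_coe_toNNReal _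
  have h0 := abs_nonneg R
  refine ⟨(|R| + 1 + K₁ + K₂).toNNReal, fun x hx => ?_, fun x x' hx hx' => ?_⟩
  · refine le_trans ?_ hm
    refine norm_le_of ?_ (PB.norm_le (by positivity) fun ξ => ?_)
      (PB.norm_le (by positivity) fun ξ => ?_)
    · rw [field_fst]
      linarith [x.norm_snd, le_abs_self R]
    · rw [ev_field_snd]; linarith [h1 x hx ξ]
    · rw [ev_field_trd]; linarith [k1 x hx ξ]
  · refine le_trans ?_ (mul_le_mul_of_nonneg_right hm (norm_nonneg _))
    have hn := norm_nonneg (x - x')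
    have e1 := mul_nonneg h0 hn
    have e2 := mul_nonneg hK₁ hn
    have e3 := mul_nonneg hK₂ hn
    refine norm_le_of ?_ (PB.norm_le (by positivity) fun ξ => ?_)
      (PB.norm_le (by positivity) fun ξ => ?_)
    · change ‖x.2.1 - x'.2.1‖ ≤ _
      have := norm_snd (x - x')
      change ‖x.2.1 - x'.2.1‖ ≤ _ at this
      linarith
    · change |x.field.2.1.ev ξ - x'.field.2.1.ev ξ| ≤ _
      rw [ev_field_snd, ev_field_snd]; linarith [h2 x x' hx hx' ξ]
    · change |x.field.2.2.ev ξ - x'.field.2.2.ev ξ| ≤ _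
      rw [ev_field_trd, ev_field_trd]; linarith [k2 x x' hx hx' ξ]

theorem velField_ae : (fun ξ => x.velField ξ + Q x.toTriple 0) =ᵐ[volume]
    fun ξ => -(deriv x.toTriple.y ξ * P x.toTriple ξ - 1 / 2 * src x.toTriple ξ) := by
  filter_upwards [x.deriv_y] with ξ h
  rw [src, h, velField]
  change _ = -(x.p ξ * P x.toTriple ξ - 1 / 2 * (x.2.1.J ξ ^ 2 * x.p ξ + x.2.2.ev ξ))
  ring

theorem integral_velField (a b : ℝ) :
    ∫ ξ in a..b, (x.velField ξ + Q x.toTriple 0) = Q x.toTriple a - Q x.toTriple b := by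
  rw [W11Loc.integral_of_ae_eq (Q_mem x.toTriple_mem).1.neg]
  · ring
  · filter_upwards [x.velField_ae, Q_hasDerivAt x.toTriple_mem] with ξ h1 h2
    rw [h1]
    exact h2.neg.deriv

/-- The mean of the second state component is `U(0)`, which changes at the rate `-Q(0)`. The
constant subtracted in `velField` is chosen for this, because `-Q_ξ` has mean zero. -/
theorem mean_field_snd : PB.mean x.field.2.1 = -Q x.toTriple 0 := by
  have h := x.integral_velField 0 1
  have hi : IntervalIntegrable x.velField volume 0 1 := x.field.2.1.intervalIntegrable 0 1
  have hQ := (Q_mem x.toTriple_mem).2 0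
  rw [zero_add] at hQ
  rw [hQ, sub_self, intervalIntegral.integral_add hi intervalIntegrable_const,
    intervalIntegral.integral_const] at h
  change PB.mean x.field.2.1 + _ = 0 at h
  simp at h
  linarith

theorem J_field_snd (ξ : ℝ) : x.field.2.1.J ξ = -Q x.toTriple ξ := by
  rw [PB.J, mean_field_snd]
  have h := x.integral_velField 0 ξ
  simp_rw [sub_neg_eq_add, ev_field_snd]
  rw [h]; ring

/-- Links the two formulations. The third components agree only almost everywhere, since `p` and `q`
are versions of `y_ξ` and `U_ξ`. -/
theorem rhs_toTriple : SameE (rhs x.toTriple) x.field.lin := by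
  refine ⟨rfl, ?_, ?_⟩
  · funext ξ
    exact (x.J_field_snd ξ).symm
  · filter_upwards [x.deriv_y, x.deriv_U] with ξ h1 h2
    change -2 * Q x.toTriple ξ * x.2.1.J ξ * deriv x.toTriple.y ξ
      + (3 * x.2.1.J ξ ^ 2 - 2 * P x.toTriple ξ) * deriv x.toTriple.U ξ = x.energyField ξ
    rw [h1, h2, energyField]
    ring

end State

end StateField

/-! ### Global existence for locally Lipschitz fields from a priori bounds. -/

section AbstractODE

variable {B : Type*} [NormedAddCommGroup B] {v : B → B}

/-- A cutoff equal to one on the ball of radius `R`. -/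
noncomputable def cutoff (R : ℝ) (x : B) : ℝ := max 0 (min 1 (R + 1 - ‖x‖))

theorem cutoff_nonneg (R : ℝ) (x : B) : 0 ≤ cutoff R x := le_max_left _ _

theorem cutoff_le_one (R : ℝ) (x : B) : cutoff R x ≤ 1 := max_le zero_le_one (min_le_left _ _)

theorem cutoff_eq_one {R : ℝ} {x : B} (h : ‖x‖ ≤ R) : cutoff R x = 1 := by
  rw [cutoff, min_eq_left (by linarith), max_eq_right zero_le_one]

theorem cutoff_eq_zero {R : ℝ} {x : B} (h : R + 1 ≤ ‖x‖) : cutoff R x = 0 := by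
  rw [cutoff, max_eq_left]
  exact min_le_of_right_le (by linarith)

theorem abs_cutoff_sub_le (R : ℝ) (x y : B) : |cutoff R x - cutoff R y| ≤ ‖x - y‖ := by
  rw [cutoff, cutoff, max_comm, max_comm 0]
  refine (abs_max_sub_max_le_abs _ _ _).trans ?_
  rw [min_comm, min_comm 1]
  refine (abs_min_sub_min_le_max _ _ _ _).trans ?_
  rw [sub_self, abs_zero, max_eq_left (abs_nonneg _)]
  rw [show R + 1 - ‖x‖ - (R + 1 - ‖y‖) = ‖y‖ - ‖x‖ by ring, norm_sub_rev]
  exact abs_norm_sub_norm_le y x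

/-- Vector fields that are bounded and Lipschitz on bounded sets. -/
def LocLipField (v : B → B) : Prop := ∀ R : ℝ, ∃ K : ℝ≥0, (∀ x, ‖x‖ ≤ R → ‖v x‖ ≤ K) ∧
  ∀ x x', ‖x‖ ≤ R → ‖x'‖ ≤ R → ‖v x - v x'‖ ≤ K * ‖x - x'‖

theorem LocLipField.lipschitzOnWith (hv : LocLipField v) (R : ℝ) :
    ∃ K : ℝ≥0, LipschitzOnWith K v (Metric.closedBall 0 R) := by
  obtain ⟨K, _, h⟩ := hv R
  refine ⟨K, LipschitzOnWith.of_dist_le_mul fun x hx y hy => ?_⟩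
  rw [dist_eq_norm, dist_eq_norm]
  exact h x y (by simpa using hx) (by simpa using hy)

variable [NormedSpace ℝ B]

/-- The truncated field is bounded on the whole space, so a solution cannot leave a ball of radius
bound times `T`. The Picard–Lindelöf theorem on that ball covers all of `[0, T]` at once. -/
theorem LocLipField.exists_cutoff_solution [CompleteSpace B] (hv : LocLipField v) (x₀ : B)
    (R : ℝ) {T : ℝ} (hT : 0 ≤ T) : ∃ x : ℝ → B, x 0 = x₀ ∧ ∀ t ∈ Set.Icc 0 T,
      HasDerivWithinAt x (cutoff R (x t) • v (x t)) (Set.Icc 0 T) t := by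
  obtain ⟨L, hL, _⟩ := hv (R + 1)
  have hb : ∀ x, ‖cutoff R x • v x‖ ≤ L := fun x => by
    rw [norm_smul, Real.norm_of_nonneg (cutoff_nonneg _ _)]
    rcases le_total (R + 1) ‖x‖ with h | h
    · rw [cutoff_eq_zero h, zero_mul]; exact L.2
    · exact (mul_le_of_le_one_left (norm_nonneg _) (cutoff_le_one _ _)).trans (hL x h)
  set a : ℝ≥0 := L * T.toNNReal with ha
  obtain ⟨K, hK1, hK2⟩ := hv (‖x₀‖ + a)
  -- One `K` comes from the Lipschitz constant of `v`, the other from its bound, since the cutoff is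
  -- itself `1`-Lipschitz.
  have hl : LipschitzOnWith (K + K) (fun x => cutoff R x • v x) (Metric.closedBall x₀ a) := by
    refine LipschitzOnWith.of_dist_le_mul fun x hx y hy => ?_
    have nx : ∀ z ∈ Metric.closedBall x₀ (a : ℝ), ‖z‖ ≤ ‖x₀‖ + a := fun z hz => by
      have h1 := norm_add_le x₀ (z - x₀)
      rw [add_sub_cancel] at h1
      rw [Metric.mem_closedBall, dist_eq_norm] at hz
      linarith
    rw [dist_eq_norm, dist_eq_norm]
    have e : cutoff R x • v x - cutoff R y • v y
        = cutoff R x • (v x - v y) + (cutoff R x - cutoff R y) • v y := by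
      rw [smul_sub, sub_smul]; abel
    rw [e]
    calc _ ≤ ‖cutoff R x • (v x - v y)‖ + ‖(cutoff R x - cutoff R y) • v y‖ := norm_add_le _ _
      _ = cutoff R x * ‖v x - v y‖ + |cutoff R x - cutoff R y| * ‖v y‖ := by
        rw [norm_smul, norm_smul, Real.norm_of_nonneg (cutoff_nonneg _ _), Real.norm_eq_abs]
      _ ≤ 1 * (K * ‖x - y‖) + ‖x - y‖ * K := by
        gcongr
        exacts [cutoff_le_one _ _, hK2 x y (nx x hx) (nx y hy), abs_cutoff_sub_le _ _ _,
          hK1 y (nx y hy)]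
      _ = _ := by push_cast; ring
  have hPL : IsPicardLindelof (fun _ x => cutoff R x • v x) (tmin := 0) (tmax := T)
      ⟨0, le_rfl, hT⟩ x₀ a 0 L (K + K) := by
    refine IsPicardLindelof.of_time_independent (fun x _ => hb x) hl ?_
    simp [ha, hT]
  exact hPL.exists_eq_forall_mem_Icc_hasDerivWithinAt₀

theorem LocLipField.unique (hv : LocLipField v) {x y : ℝ → B} {T : ℝ}
    (hx : ∀ t ∈ Set.Icc 0 T, HasDerivWithinAt x (v (x t)) (Set.Icc 0 T) t)
    (hy : ∀ t ∈ Set.Icc 0 T, HasDerivWithinAt y (v (y t)) (Set.Icc 0 T) t) (h0 : x 0 = y 0) :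
    Set.EqOn x y (Set.Icc 0 T) := by
  have cx : ContinuousOn x (Set.Icc 0 T) := fun t ht => (hx t ht).continuousWithinAt
  have cy : ContinuousOn y (Set.Icc 0 T) := fun t ht => (hy t ht).continuousWithinAt
  obtain ⟨R₁, h₁⟩ := isCompact_Icc.exists_bound_of_continuousOn cx
  obtain ⟨R₂, h₂⟩ := isCompact_Icc.exists_bound_of_continuousOn cy
  obtain ⟨K, hK⟩ := hv.lipschitzOnWith (max R₁ R₂)
  have hd : ∀ {z : ℝ → B}, (∀ t ∈ Set.Icc 0 T, HasDerivWithinAt z (v (z t)) (Set.Icc 0 T) t) →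
      ∀ t ∈ Set.Ico 0 T, HasDerivWithinAt z (v (z t)) (Set.Ici t) t := fun hz t ht =>
    (hz t ⟨ht.1, ht.2.le⟩).mono_of_mem_nhdsWithin (mem_of_superset
      (Icc_mem_nhdsGE ht.2) (Set.Icc_subset_Icc_left ht.1))
  refine ODE_solution_unique_of_mem_Icc_right (v := fun _ => v)
    (s := fun _ => Metric.closedBall 0 (max R₁ R₂)) (K := K)
    (fun _ _ => hK) cx (hd hx) (fun t ht => ?_) cy (hd hy) (fun t ht => ?_) h0
  · rw [mem_closedBall_zero_iff]
    exact (h₁ t ⟨ht.1, ht.2.le⟩).trans (le_max_left _ _)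
  · rw [mem_closedBall_zero_iff]
    exact (h₂ t ⟨ht.1, ht.2.le⟩).trans (le_max_right _ _)

/-- Global existence from a bound for the solutions of all truncated equations. -/
theorem LocLipField.exists_global_solution [CompleteSpace B] (hv : LocLipField v) (x₀ : B)
    (ap : ∀ T : ℝ, 0 ≤ T → ∃ R : ℝ, ∀ (x : ℝ → B) (c : ℝ → ℝ), x 0 = x₀ →
      (∀ t, 0 ≤ c t ∧ c t ≤ 1) →
      (∀ t ∈ Set.Icc 0 T, HasDerivWithinAt x (c t • v (x t)) (Set.Icc 0 T) t) →
      ∀ t ∈ Set.Icc 0 T, ‖x t‖ ≤ R) :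
    ∃ x : ℝ → B, x 0 = x₀ ∧ ∀ t, 0 ≤ t → HasDerivWithinAt x (v (x t)) (Set.Ici 0) t := by
  have hex : ∀ n : ℕ, ∃ x : ℝ → B, x 0 = x₀ ∧ ∀ t ∈ Set.Icc (0 : ℝ) n,
      HasDerivWithinAt x (v (x t)) (Set.Icc (0 : ℝ) n) t := fun n => by
    obtain ⟨R, hR⟩ := ap n n.cast_nonneg
    obtain ⟨x, hx0, hx⟩ := hv.exists_cutoff_solution x₀ R n.cast_nonneg
    refine ⟨x, hx0, fun t ht => ?_⟩
    -- The a priori bound holds for every slow-down factor `c`. With `c` the cutoff along the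
    -- trajectory it keeps the solution where the cutoff equals `1`.
    have := hR x (fun t => cutoff R (x t)) hx0 (fun t => ⟨cutoff_nonneg _ _, cutoff_le_one _ _⟩)
      hx t ht
    have h2 := hx t ht
    rwa [cutoff_eq_one this, one_smul] at h2
  choose u hu0 hu using hex
  have agree : ∀ {m n : ℕ}, m ≤ n → Set.EqOn (u m) (u n) (Set.Icc (0 : ℝ) m) := fun {m n} h =>
    hv.unique (hu m) (fun t ht => (hu n t ⟨ht.1, ht.2.trans (by exact_mod_cast h)⟩).mono
      (Set.Icc_subset_Icc_right (by exact_mod_cast h))) (by rw [hu0, hu0])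
  refine ⟨fun t => u (⌈t⌉₊) t, by simp [hu0], fun t ht => ?_⟩
  have key : ∀ n : ℕ, ∀ s ∈ Set.Icc (0 : ℝ) n, u (⌈s⌉₊) s = u n s := fun n s hs =>
    agree (Nat.ceil_le.2 hs.2) ⟨hs.1, Nat.le_ceil s⟩
  -- The extra `1` makes `[0, n]` a neighbourhood of `t` relative to `[0, ∞)`.
  set n := ⌈t⌉₊ + 1 with hn
  have htn : t < n := by
    have := Nat.le_ceil t
    rw [hn]; push_cast; linarith
  have h1 := hu n t ⟨ht, htn.le⟩
  have h2 : HasDerivWithinAt (fun s => u (⌈s⌉₊) s) (v (u n t)) (Set.Icc (0 : ℝ) n) t :=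
    h1.congr (fun s hs => key n s hs) (key n t ⟨ht, htn.le⟩)
  simp only
  rw [key n t ⟨ht, htn.le⟩]
  refine h2.mono_of_mem_nhdsWithin ?_
  rw [← Set.Ici_inter_Iic]
  exact inter_mem self_mem_nhdsWithin (mem_nhdsWithin_of_mem_nhds (Iic_mem_nhds htn))

end AbstractODE

/-! ### Bounds on `F` in terms of the energy alone. -/

section InvariantBounds

variable {X : Triple}

/-- Divide the relation defining `F` by `y_ξ` where it is positive; elsewhere the left-hand side
vanishes. -/
theorem F.sq_mul_le (hX : X ∈ F) : ∀ᵐ ξ : ℝ, X.U ξ ^ 2 * deriv X.y ξ ≤ X.ν ξ := by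
  obtain ⟨_, _, _, _, _, h1, h2, _, h3⟩ := hX
  filter_upwards [h1, h2, h3] with ξ h1 h2 h3
  rcases h1.eq_or_lt with h0 | h0
  · rw [← h0, mul_zero]; exact h2
  · have : deriv X.y ξ * (X.U ξ ^ 2 * deriv X.y ξ) ≤ deriv X.y ξ * X.ν ξ := by
      rw [h3]; nlinarith [sq_nonneg (deriv X.U ξ)]
    exact le_of_mul_le_mul_left this h0

/-- The relation gives `U_ξ² ≤ y_ξ ν`; then use the inequality of arithmetic and geometric means. -/
theorem F.abs_deriv_U_le (hX : X ∈ F) :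
    ∀ᵐ ξ : ℝ, |deriv X.U ξ| ≤ 1 / 2 * |deriv X.y ξ| + 1 / 2 * |X.ν ξ| := by
  obtain ⟨_, _, _, _, _, h1, h2, _, h3⟩ := hX
  filter_upwards [h1, h2, h3] with ξ h1 h2 h3
  rw [abs_of_nonneg h1, abs_of_nonneg h2]
  refine abs_le_of_sq_le_sq ?_ (by positivity)
  nlinarith [sq_nonneg (deriv X.y ξ - X.ν ξ), mul_nonneg (sq_nonneg (deriv X.y ξ)) (sq_nonneg (X.U ξ))]

theorem energy_nonneg (X : Triple) : 0 ≤ energy X :=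
  intervalIntegral.integral_nonneg zero_le_one fun _ _ => abs_nonneg _

theorem F.integral_abs_deriv_y (hX : X ∈ F) : ∫ ξ in (0 : ℝ)..1, |deriv X.y ξ| = 1 := by
  rw [W11Loc.integral_of_ae_eq hX.2.1.1 (g := fun ξ => |deriv X.y ξ|)]
  · have := hX.2.1.2 0
    rw [zero_add] at this
    linarith
  · filter_upwards [hX.2.2.2.2.2.1] with ξ h
    rw [abs_of_nonneg h]

theorem F.integral_abs_deriv_U (hX : X ∈ F) :
    ∫ ξ in (0 : ℝ)..1, |deriv X.U ξ| ≤ (1 + energy X) / 2 := by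
  have i1 := hX.2.1.1.intervalIntegrable_deriv 0 1
  have i2 := L1Per.intervalIntegrable hX.1.2.2 0 1
  have := integral_abs_le_of_ae_le (f := deriv X.U) (a₁ := 1 / 2) (a₂ := 1 / 2) (a₃ := 0) (a₄ := 0)
    i1 i2 i2 i2 (F.integral_abs_deriv_y hX).le (le_refl (energy X)) le_rfl le_rfl
    (by norm_num) (by norm_num) le_rfl le_rfl
    ((F.abs_deriv_U_le hX).mono fun ξ h => by linarith)
  linarith

/-- Over a period `U` varies by at most `(1 + h)/2`. If `|U| > 1 + h` somewhere, then `|U| ≥ m > (1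
+ h)/2` on a whole period, and integrating `U² y_ξ ≤ ν` gives `h ≥ m² > ((1 + h)/2)² ≥ h`. -/
theorem F.abs_U_le (hX : X ∈ F) (ξ : ℝ) : |X.U ξ| ≤ 1 + energy X := by
  have hE := energy_nonneg X
  have hper : Function.Periodic (deriv X.U) 1 :=
    periodic_deriv (α := 0) fun ξ => by rw [hX.1.2.1.2 ξ, add_zero]
  have hdiff : ∀ η ∈ Set.Icc (ξ - 1) ξ, |X.U ξ - X.U η| ≤ (1 + energy X) / 2 := fun η hη => by
    have hi := hX.1.2.1.1.intervalIntegrable_deriv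
    rw [← hX.1.2.1.1.integral_deriv η ξ]
    calc _ ≤ ∫ x in η..ξ, |deriv X.U x| := intervalIntegral.abs_integral_le_integral_abs hη.2
      _ ≤ ∫ x in (ξ - 1)..ξ, |deriv X.U x| :=
        intervalIntegral.integral_mono_interval hη.1 hη.2 le_rfl
          (Eventually.of_forall fun _ => abs_nonneg _) (hi _ _).abs
      _ = ∫ x in (0 : ℝ)..1, |deriv X.U x| := Adm.integral_period (Adm.periodic_abs hper) ξ
      _ ≤ _ := F.integral_abs_deriv_U hX
  by_contra! hlt
  set m := |X.U ξ| - (1 + energy X) / 2 with hm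
  have hm0 : (1 + energy X) / 2 < m := by rw [hm]; linarith
  have hlow : ∀ η ∈ Set.Icc (ξ - 1) ξ, m ^ 2 ≤ X.U η ^ 2 := fun η hη => by
    have h1 := hdiff η hη
    have h2 := abs_sub_abs_le_abs_sub (X.U ξ) (X.U η)
    rw [← sq_abs (X.U η)]
    exact pow_le_pow_left₀ (by linarith) (by rw [hm]; linarith) 2
  have i1 := hX.2.1.1.intervalIntegrable_deriv (ξ - 1) ξ
  have i2 := L1Per.intervalIntegrable hX.1.2.2 (ξ - 1) ξ
  have h1 : ∫ η in (ξ - 1)..ξ, m ^ 2 * deriv X.y η ≤ ∫ η in (ξ - 1)..ξ, |X.ν η| := by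
    refine intervalIntegral.integral_mono_ae_restrict (by linarith) (i1.const_mul _) i2.abs ?_
    filter_upwards [ae_restrict_of_ae (F.sq_mul_le hX), ae_restrict_of_ae hX.2.2.2.2.2.1,
      ae_restrict_mem measurableSet_Icc] with η a1 a2 a3
    exact ((mul_le_mul_of_nonneg_right (hlow η a3) a2).trans a1).trans (le_abs_self _)
  have hy := hX.2.1.2 (ξ - 1)
  rw [sub_add_cancel] at hy
  rw [intervalIntegral.integral_const_mul, hX.2.1.1.integral_deriv, hy,
    Adm.integral_period (Adm.periodic_abs hX.1.2.2.2) ξ] at h1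
  change _ ≤ energy X at h1
  nlinarith [sq_nonneg (1 - energy X)]

theorem F.bnd (hX : X ∈ F) : Bnd X (1 + energy X) := by
  have hE := energy_nonneg X
  refine ⟨F.abs_U_le hX, ?_, (F.integral_abs_deriv_U hX).trans (by linarith), ?_⟩
  · rw [F.integral_abs_deriv_y hX]; linarith
  · change energy X ≤ _
    linarith

theorem F.osc (hX : X ∈ F) : Osc X.y 0 := fun ξ η h _ => by
  have := hX.2.1.1.integral_deriv η ξ
  have h2 : 0 ≤ ∫ x in η..ξ, deriv X.y x :=
    intervalIntegral.integral_nonneg_of_ae_restrict h (ae_restrict_of_ae hX.2.2.2.2.2.1)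
  linarith

/-- The source is nonnegative and at most `2 ν`, and the oscillation bound is `0` because `y` is
nondecreasing. -/
theorem F.abs_PQ_le (hX : X ∈ F) (ξ : ℝ) : |P X ξ| ≤ 2 * energy X ∧ |Q X ξ| ≤ 2 * energy X := by
  have i2 := L1Per.intervalIntegrable hX.1.2.2 0 1
  have h : ∫ η in (0 : ℝ)..1, |src X η| ≤ 2 * energy X := by
    have := integral_abs_le_of_ae_le (f := src X) (a₁ := 2) (a₂ := 0) (a₃ := 0) (a₄ := 0)
      i2 i2 i2 i2 (le_refl (energy X)) le_rfl le_rfl le_rfl (by norm_num) le_rfl le_rfl le_rfl ?_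
    · linarith
    · filter_upwards [F.sq_mul_le hX, hX.2.2.2.2.2.1, hX.2.2.2.2.2.2.1] with η h1 h2 h3
      have : 0 ≤ X.U η ^ 2 * deriv X.y η := by positivity
      rw [src, abs_of_nonneg (by positivity), abs_of_nonneg h3]
      linarith
  have := conv_le (F.mem_E₁ hX) (F.osc hX) h ξ
  rwa [Real.exp_zero, one_mul] at this

end InvariantBounds

/-! ### Pointwise invariants, energy conservation and the global flow of states. -/

section Invariants

/-- States describing elements of `F`, with all relations holding pointwise. -/
structure Good (c₀ : ℝ) (x : State) : Prop where
  ident : ∀ ξ, x.p ξ * x.2.2.ev ξ = x.p ξ ^ 2 * x.2.1.J ξ ^ 2 + x.q ξ ^ 2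
  low : ∀ ξ, c₀ ≤ x.p ξ + x.2.2.ev ξ

namespace Good

variable {c₀ : ℝ} {x : State}

/-- The product is nonnegative by the relation and the sum is positive, so neither factor can be
negative. Signs therefore need not be propagated separately. -/
theorem nonneg (hc : 0 < c₀) (h : Good c₀ x) (ξ : ℝ) : 0 ≤ x.p ξ ∧ 0 ≤ x.2.2.ev ξ := by
  have h1 := h.ident ξ
  have h2 := h.low ξ
  have h3 : 0 ≤ x.p ξ * x.2.2.ev ξ := by rw [h1]; positivity
  constructor
  · by_contra! hp
    have : x.2.2.ev ξ ≤ 0 := by nlinarith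
    linarith
  · by_contra! hp
    have : x.p ξ ≤ 0 := by nlinarith
    linarith

theorem J_locallyLipschitz (v : PB) : LocallyLipschitz v.J := by
  refine LipschitzWith.locallyLipschitz (K := (2 * ‖v‖).toNNReal)
    (LipschitzWith.of_dist_le_mul fun a b => ?_)
  rw [Real.dist_eq, Real.dist_eq, Real.coe_toNNReal _ (by positivity)]
  have h1 : v.J a - v.J b = ∫ η in b..a, (v.ev η - PB.mean v) := by
    rw [PB.J, PB.J, add_sub_add_left_eq_sub, intervalIntegral.integral_interval_sub_left
      (v.intervalIntegrable_sub_mean _ _) (v.intervalIntegrable_sub_mean _ _)]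
  rw [h1]
  exact intervalIntegral.norm_integral_le_of_norm_le_const
    (f := fun η => v.ev η - PB.mean v) fun η _ => State.abs_sub_mean_le v η

theorem mem_F (hc : 0 < c₀) (h : Good c₀ x) : x.toTriple ∈ F := by
  have hm := x.toTriple_mem
  refine ⟨E₁.mem_E hm, hm.1, ?_, J_locallyLipschitz _, ?_, ?_, ?_, ⟨c₀, hc, ?_⟩, ?_⟩
  · exact LocallyLipschitz.add LipschitzWith.id.locallyLipschitz (J_locallyLipschitz x.1)
  · exact memLp_top_of_bound x.2.2.ev_aesm ‖x.2.2‖ (Eventually.of_forall fun ξ => x.2.2.abs_ev_le ξ)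
  · filter_upwards [x.deriv_y] with ξ h1
    rw [h1]; exact (h.nonneg hc ξ).1
  · exact Eventually.of_forall fun ξ => (h.nonneg hc ξ).2
  · filter_upwards [x.deriv_y] with ξ h1
    rw [h1]; exact h.low ξ
  · filter_upwards [x.deriv_y, x.deriv_U] with ξ h1 h2
    rw [h1, h2]; exact h.ident ξ

theorem energy_eq (hc : 0 < c₀) (h : Good c₀ x) : energy x.toTriple = PB.mean x.2.2 := by
  rw [energy, PB.mean_apply]
  refine intervalIntegral.integral_congr fun ξ _ => ?_
  exact abs_of_nonneg (h.nonneg hc ξ).2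

end Good

/-- The exponential rate at which `y_ξ + ν` may grow. -/
noncomputable def growthRate (a b : ℝ) : ℝ := 1 / 2 + 2 * a * b + (3 * a ^ 2 + 2 * b) / 2

/-- The relation gives `p n ≥ q² ≥ 0`, whence `|p| ≤ |p + n|` and `|q| ≤ |p + n| / 2` with no
assumption on signs. The rate of change of `p + n` is linear in `p` and `q`. -/
theorem abs_sum_field_le {x : State} {ξ a b : ℝ}
    (hid : x.p ξ * x.2.2.ev ξ = x.p ξ ^ 2 * x.2.1.J ξ ^ 2 + x.q ξ ^ 2)
    (hU : |x.2.1.J ξ| ≤ a) (hP : |P x.toTriple ξ| ≤ b) (hQ : |Q x.toTriple ξ| ≤ b) :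
    |x.q ξ + x.energyField ξ| ≤ growthRate a b * |x.p ξ + x.2.2.ev ξ| := by
  set p := x.p ξ
  set n := x.2.2.ev ξ
  set q := x.q ξ
  set U := x.2.1.J ξ
  set s := |p + n|
  have ha : 0 ≤ a := (abs_nonneg _).trans hU
  have hb : 0 ≤ b := (abs_nonneg _).trans hP
  have hq : |q| ≤ s / 2 := by
    rw [show s / 2 = |(p + n) / 2| by rw [abs_div]; norm_num [s]]
    refine sq_le_sq.1 ?_
    nlinarith [sq_nonneg (p - n), mul_nonneg (sq_nonneg p) (sq_nonneg U)]
  have hp : |p| ≤ s := by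
    refine sq_le_sq.1 ?_
    nlinarith [sq_nonneg n, mul_nonneg (sq_nonneg p) (sq_nonneg U), sq_nonneg q]
  have hUU : |U * U| ≤ a ^ 2 := by
    rw [abs_mul, sq]; exact mul_le_mul hU hU (abs_nonneg _) ha
  have e : x.energyField ξ = -2 * (Q x.toTriple ξ * U * p)
    + (3 * (U * U) - 2 * P x.toTriple ξ) * q := rfl
  rw [e]
  have t1 : |Q x.toTriple ξ * U * p| ≤ b * a * s := by
    rw [abs_mul, abs_mul]; gcongr
  have t2 : |3 * (U * U) - 2 * P x.toTriple ξ| ≤ 3 * a ^ 2 + 2 * b := by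
    refine (abs_sub _ _).trans ?_
    rw [abs_mul (3 : ℝ), abs_mul (2 : ℝ), abs_of_pos (by norm_num : (0 : ℝ) < 3),
      abs_of_pos (by norm_num : (0 : ℝ) < 2)]
    linarith
  have t3 : |(3 * (U * U) - 2 * P x.toTriple ξ) * q| ≤ (3 * a ^ 2 + 2 * b) * (s / 2) := by
    rw [abs_mul]; gcongr
  have t4 : |-2 * (Q x.toTriple ξ * U * p)| ≤ 2 * (b * a * s) := by
    rw [abs_mul, abs_neg, abs_of_pos (by norm_num : (0 : ℝ) < 2)]; gcongr
  have := abs_add_three q (-2 * (Q x.toTriple ξ * U * p))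
    ((3 * (U * U) - 2 * P x.toTriple ξ) * q)
  rw [← add_assoc]
  refine this.trans ?_
  rw [growthRate]
  linarith

/-- The second estimate is the first one for the time-reversed function `τ ↦ s (t - τ)`. -/
theorem scalar_gronwall {s s' : ℝ → ℝ} {k T : ℝ}
    (h : ∀ t ∈ Set.Icc 0 T, HasDerivWithinAt s (s' t) (Set.Icc 0 T) t)
    (hb : ∀ t ∈ Set.Icc 0 T, |s' t| ≤ k * |s t|) {t : ℝ} (ht : t ∈ Set.Icc 0 T) :
    |s t| ≤ |s 0| * Real.exp (k * t) ∧ |s 0| ≤ |s t| * Real.exp (k * t) := by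
  have hsub : Set.Icc 0 t ⊆ Set.Icc 0 T := Set.Icc_subset_Icc_right ht.2
  have hmem : t ∈ Set.Icc 0 t := ⟨ht.1, le_rfl⟩
  constructor
  · have := norm_le_gronwallBound_of_norm_deriv_right_le (f := s) (f' := s') (δ := |s 0|) (K := k)
      (ε := 0) (a := 0) (b := t) (fun τ hτ => ((h τ (hsub hτ)).continuousWithinAt).mono hsub)
      (fun τ hτ => ((h τ (hsub ⟨hτ.1, hτ.2.le⟩)).mono hsub).mono_of_mem_nhdsWithin
        (mem_of_superset (Icc_mem_nhdsGE hτ.2) (Set.Icc_subset_Icc_left hτ.1)))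
      le_rfl (fun τ hτ => by rw [add_zero]; exact hb τ (hsub ⟨hτ.1, hτ.2.le⟩)) t hmem
    rwa [gronwallBound_ε0, sub_zero] at this
  · have hmaps : Set.MapsTo (fun τ => t - τ) (Set.Icc 0 t) (Set.Icc 0 T) := fun τ hτ =>
      ⟨by linarith [hτ.2], by linarith [hτ.1, ht.2]⟩
    have hd : ∀ τ ∈ Set.Icc 0 t,
        HasDerivWithinAt (fun τ => s (t - τ)) (-s' (t - τ)) (Set.Icc 0 t) τ := fun τ hτ => by
      have := (h (t - τ) (hmaps hτ)).scomp τ ((hasDerivAt_id τ).const_sub t).hasDerivWithinAt hmaps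
      simp only [neg_smul, one_smul] at this
      exact this
    have := norm_le_gronwallBound_of_norm_deriv_right_le (f := fun τ => s (t - τ))
      (f' := fun τ => -s' (t - τ)) (δ := |s t|) (K := k)
      (ε := 0) (a := 0) (b := t) (fun τ hτ => (hd τ hτ).continuousWithinAt)
      (fun τ hτ => (hd τ ⟨hτ.1, hτ.2.le⟩).mono_of_mem_nhdsWithin
        (mem_of_superset (Icc_mem_nhdsGE hτ.2) (Set.Icc_subset_Icc_left hτ.1)))
      (by simp) (fun τ hτ => by
        rw [add_zero, norm_neg]; exact hb _ (hmaps ⟨hτ.1, hτ.2.le⟩)) t hmem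
    rw [gronwallBound_ε0, sub_zero, sub_self] at this
    exact this

/-- A zero of `s` would force `s 0 = 0` by the backward estimate. -/
theorem scalar_gronwall_pos {s s' : ℝ → ℝ} {k T : ℝ}
    (h : ∀ t ∈ Set.Icc 0 T, HasDerivWithinAt s (s' t) (Set.Icc 0 T) t)
    (hb : ∀ t ∈ Set.Icc 0 T, |s' t| ≤ k * |s t|) (h0 : 0 < s 0) {t : ℝ} (ht : t ∈ Set.Icc 0 T) :
    0 < s t := by
  by_contra! hneg
  have hc : ContinuousOn s (Set.Icc 0 t) := fun τ hτ =>
    ((h τ ⟨hτ.1, hτ.2.trans ht.2⟩).continuousWithinAt).mono (Set.Icc_subset_Icc_right ht.2)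
  obtain ⟨τ, hτ, hz⟩ := intermediate_value_Icc' ht.1 hc ⟨hneg, h0.le⟩
  have := (scalar_gronwall h hb ⟨hτ.1, hτ.2.trans ht.2⟩).2
  rw [hz, abs_zero, zero_mul, abs_of_pos h0] at this
  linarith

namespace State

/-- The energy density changes by the spatial derivative of the periodic function `U³ - 2 P U`,
since `P_ξ = y_ξ Q`. -/
theorem integral_energyField (x : State) : ∫ ξ in (0 : ℝ)..1, x.energyField ξ = 0 := by
  have hP := P_mem x.toTriple_mem
  have hU := x.2.1.J_w11Loc
  have hw : W11Loc fun ξ => x.2.1.J ξ * (x.2.1.J ξ * x.2.1.J ξ)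
      - 2 * (P x.toTriple ξ * x.2.1.J ξ) := (hU.mul (hU.mul hU)).sub ((hP.1.mul hU).const_mul 2)
  rw [hw.integral_of_ae_eq]
  · have h1 := hP.2 0
    have h2 := x.2.1.J_periodic 0
    rw [zero_add] at h1 h2
    rw [h1, h2, sub_self]
  · filter_upwards [P_hasDerivAt x.toTriple_mem, x.hasDerivAt_U, x.deriv_y] with ξ h1 h2 h3
    rw [h3] at h1
    have h2' : HasDerivAt x.2.1.J (x.q ξ) ξ := h2
    have h4 := (h2'.mul (h2'.mul h2')).sub ((h1.mul h2').const_mul 2)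
    refine h4.deriv.trans ?_
    rw [energyField]
    simp only [Pi.mul_apply]
    ring

end State

variable {x : ℝ → State} {c : ℝ → ℝ} {T c₀ : ℝ}

/-- Solutions on `[0, T]` of the state equation with a rescaled speed. -/
def Flow (x : ℝ → State) (c : ℝ → ℝ) (T : ℝ) : Prop :=
  ∀ t ∈ Set.Icc 0 T, HasDerivWithinAt x (c t • (x t).field) (Set.Icc 0 T) t

namespace Flow

/-- Evaluation at a single point is among these functionals; this is why states are genuine
functions and not classes modulo null sets. -/
theorem comp (h : Flow x c T) (L : State →L[ℝ] ℝ) {t : ℝ} (ht : t ∈ Set.Icc 0 T) :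
    HasDerivWithinAt (fun t => L (x t)) (c t * L (x t).field) (Set.Icc 0 T) t := by
  have := L.hasFDerivAt.comp_hasDerivWithinAt t (h t ht)
  rwa [map_smul] at this

theorem mean_fst (h : Flow x c T) {t : ℝ} (ht : t ∈ Set.Icc 0 T) :
    HasDerivWithinAt (fun t => PB.mean (x t).1) (c t * PB.mean (x t).2.1) (Set.Icc 0 T) t :=
  h.comp (PB.mean.comp (ContinuousLinearMap.fst ℝ PB (PB × PB))) ht

theorem p (h : Flow x c T) (ξ : ℝ) {t : ℝ} (ht : t ∈ Set.Icc 0 T) :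
    HasDerivWithinAt (fun t => (x t).p ξ) (c t * (x t).q ξ) (Set.Icc 0 T) t :=
  (h.comp ((PB.evL ξ - PB.mean).comp (ContinuousLinearMap.fst ℝ PB (PB × PB))) ht).const_add 1

theorem q (h : Flow x c T) (ξ : ℝ) {t : ℝ} (ht : t ∈ Set.Icc 0 T) :
    HasDerivWithinAt (fun t => (x t).q ξ)
      (c t * ((x t).velField ξ + Q (x t).toTriple 0)) (Set.Icc 0 T) t := by
  have := h.comp ((PB.evL ξ - PB.mean).comp ((ContinuousLinearMap.fst ℝ PB PB).comp
    (ContinuousLinearMap.snd ℝ PB (PB × PB)))) ht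
  change HasDerivWithinAt (fun t => (x t).q ξ)
    (c t * ((x t).velField ξ - PB.mean (x t).field.2.1)) (Set.Icc 0 T) t at this
  rwa [State.mean_field_snd, sub_neg_eq_add] at this

theorem U (h : Flow x c T) (ξ : ℝ) {t : ℝ} (ht : t ∈ Set.Icc 0 T) :
    HasDerivWithinAt (fun t => (x t).2.1.J ξ) (c t * -Q (x t).toTriple ξ) (Set.Icc 0 T) t := by
  have := h.comp ((PB.JL ξ).comp ((ContinuousLinearMap.fst ℝ PB PB).comp
    (ContinuousLinearMap.snd ℝ PB (PB × PB)))) ht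
  change HasDerivWithinAt (fun t => (x t).2.1.J ξ)
    (c t * (x t).field.2.1.J ξ) (Set.Icc 0 T) t at this
  rwa [State.J_field_snd] at this

theorem n (h : Flow x c T) (ξ : ℝ) {t : ℝ} (ht : t ∈ Set.Icc 0 T) :
    HasDerivWithinAt (fun t => (x t).2.2.ev ξ) (c t * (x t).energyField ξ) (Set.Icc 0 T) t :=
  h.comp ((PB.evL ξ).comp ((ContinuousLinearMap.snd ℝ PB PB).comp
    (ContinuousLinearMap.snd ℝ PB (PB × PB)))) ht

theorem eq_of_deriv_zero {f : ℝ → ℝ}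
    (h : ∀ t ∈ Set.Icc 0 T, HasDerivWithinAt f 0 (Set.Icc 0 T) t) {t : ℝ} (ht : t ∈ Set.Icc 0 T) :
    f t = f 0 :=
  constant_of_has_deriv_right_zero (fun s hs => (h s hs).continuousWithinAt)
    (fun s hs => (h s ⟨hs.1, hs.2.le⟩).mono_of_mem_nhdsWithin
      (mem_of_superset (Icc_mem_nhdsGE hs.2) (Set.Icc_subset_Icc_left hs.1))) t ht

theorem energy_const (h : Flow x c T) {t : ℝ} (ht : t ∈ Set.Icc 0 T) :
    PB.mean (x t).2.2 = PB.mean (x 0).2.2 := by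
  refine eq_of_deriv_zero (f := fun t => PB.mean (x t).2.2) (fun s hs => ?_) ht
  have := h.comp (PB.mean.comp ((ContinuousLinearMap.snd ℝ PB PB).comp
    (ContinuousLinearMap.snd ℝ PB (PB × PB)))) hs
  have h0 : PB.mean (x s).field.2.2 = 0 := (x s).integral_energyField
  change HasDerivWithinAt (fun t => PB.mean (x t).2.2) (c s * PB.mean (x s).field.2.2) _ _ at this
  rwa [h0, mul_zero] at this

/-- The time derivative of the difference of the two sides is zero by algebra alone. The speed `c`
factors out, so truncation does not destroy the invariant. -/
theorem ident (h : Flow x c T) (h0 : Good c₀ (x 0)) {t : ℝ} (ht : t ∈ Set.Icc 0 T) (ξ : ℝ) :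
    (x t).p ξ * (x t).2.2.ev ξ = (x t).p ξ ^ 2 * (x t).2.1.J ξ ^ 2 + (x t).q ξ ^ 2 := by
  have key := eq_of_deriv_zero (T := T) (f := fun t => (x t).p ξ * (x t).2.2.ev ξ
    - ((x t).p ξ * (x t).p ξ * ((x t).2.1.J ξ * (x t).2.1.J ξ) + (x t).q ξ * (x t).q ξ))
    (fun s hs => ?_) ht
  · have := h0.ident ξ
    linarith
  · have hp := h.p ξ hs
    have hq := h.q ξ hs
    have hU := h.U ξ hs
    have hn := h.n ξ hs
    convert! (hp.mul hn).sub (((hp.mul hp).mul (hU.mul hU)).add (hq.mul hq)) using 1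
    simp only [State.velField, State.energyField, Pi.mul_apply]
    ring

theorem sum (h : Flow x c T) (ξ : ℝ) {t : ℝ} (ht : t ∈ Set.Icc 0 T) :
    HasDerivWithinAt (fun t => (x t).p ξ + (x t).2.2.ev ξ)
      (c t * ((x t).q ξ + (x t).energyField ξ)) (Set.Icc 0 T) t := by
  convert! (h.p ξ ht).add (h.n ξ ht) using 1
  ring

theorem abs_mul_le {a b k : ℝ} (ha : 0 ≤ a ∧ a ≤ 1) (h : |b| ≤ k) : |a * b| ≤ k := by
  rw [abs_mul, abs_of_nonneg ha.1]
  exact (mul_le_of_le_one_left (abs_nonneg _) ha.2).trans h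

/-- Only some positive lower bound is needed here, so the Gronwall rate may come from a bound `R` of
this particular trajectory. The uniform bound comes afterwards, in `norm_le`. -/
theorem good (hc₀ : 0 < c₀) (h : Flow x c T) (hc : ∀ t, 0 ≤ c t ∧ c t ≤ 1) (h0 : Good c₀ (x 0)) :
    ∃ c₁, 0 < c₁ ∧ ∀ t ∈ Set.Icc 0 T, Good c₁ (x t) := by
  obtain ⟨R, hR⟩ := isCompact_Icc.exists_bound_of_continuousOn
    (f := x) (fun t ht => (h t ht).continuousWithinAt)
  have hb : ∀ ξ, ∀ t ∈ Set.Icc 0 T, |c t * ((x t).q ξ + (x t).energyField ξ)| ≤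
      growthRate (3 * R + 1) (boundPQ (3 * R + 1)) * |(x t).p ξ + (x t).2.2.ev ξ| :=
    fun ξ t ht => by
      have hB := (x t).bnd_toTriple.mono (R' := 3 * R + 1) (by linarith [hR t ht])
      have hPQ := hB.abs_PQ_le (x t).toTriple_mem ξ
      exact abs_mul_le (hc t) (abs_sum_field_le (h.ident h0 ht ξ) (hB.U ξ) hPQ.1 hPQ.2)
  set k := growthRate (3 * R + 1) (boundPQ (3 * R + 1))
  refine ⟨c₀ * Real.exp (-(|k| * T)), by positivity, fun t ht => ⟨h.ident h0 ht, fun ξ => ?_⟩⟩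
  have hs0 : 0 < (x 0).p ξ + (x 0).2.2.ev ξ := hc₀.trans_le (h0.low ξ)
  have hpos := scalar_gronwall_pos (fun t ht => h.sum ξ ht) (hb ξ) hs0 ht
  have h1 := (scalar_gronwall (fun t ht => h.sum ξ ht) (hb ξ) ht).2
  rw [abs_of_pos hs0, abs_of_pos hpos] at h1
  have h2 : Real.exp (k * t) ≤ Real.exp (|k| * T) := by
    refine Real.exp_le_exp.2 ?_
    exact mul_le_mul (le_abs_self k) ht.2 ht.1 (abs_nonneg _)
  rw [Real.exp_neg, ← div_eq_mul_inv, div_le_iff₀ (Real.exp_pos _)]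
  calc c₀ ≤ _ := h0.low ξ
    _ ≤ _ := h1
    _ ≤ _ := by gcongr

/-- An a priori bound depending only on the initial state and the length of the time interval. -/
theorem norm_le (hc₀ : 0 < c₀) (h : Flow x c T) (hc : ∀ t, 0 ≤ c t ∧ c t ≤ 1)
    (h0 : Good c₀ (x 0)) {t : ℝ} (ht : t ∈ Set.Icc 0 T) {e : ℝ} (he : e = PB.mean (x 0).2.2) :
    ‖x t‖ ≤ (1 + 3 * ‖x 0‖) * Real.exp (growthRate (1 + e) (2 * e) * T) + 1 + ‖x 0‖
      + (1 + e) * T + (1 + e) := by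
  obtain ⟨c₁, hc₁, hgood⟩ := h.good hc₀ hc h0
  -- The states lie in `F` and conserve energy, so from here on `U`, `P` and `Q` are bounded in
  -- terms of `e` alone and the Gronwall rate no longer depends on the trajectory.
  have hEn : ∀ t ∈ Set.Icc 0 T, energy (x t).toTriple = e := fun t ht => by
    rw [(hgood t ht).energy_eq hc₁, h.energy_const ht, he]
  have hT : 0 ≤ T := ht.1.trans ht.2
  have he0 : 0 ≤ e := by rw [← hEn t ht]; exact energy_nonneg _
  have hU : ∀ t ∈ Set.Icc 0 T, ∀ ξ, |(x t).2.1.J ξ| ≤ 1 + e := fun t ht ξ => by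
    rw [← hEn t ht]; exact F.abs_U_le ((hgood t ht).mem_F hc₁) ξ
  have hb : ∀ ξ, ∀ t ∈ Set.Icc 0 T, |c t * ((x t).q ξ + (x t).energyField ξ)| ≤
      growthRate (1 + e) (2 * e) * |(x t).p ξ + (x t).2.2.ev ξ| := fun ξ t ht => by
    have hPQ := F.abs_PQ_le ((hgood t ht).mem_F hc₁) ξ
    rw [hEn t ht] at hPQ
    exact abs_mul_le (hc t) (abs_sum_field_le (h.ident h0 ht ξ) (hU t ht ξ) hPQ.1 hPQ.2)
  have hk : 0 ≤ growthRate (1 + e) (2 * e) := by rw [growthRate]; positivity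
  set k := growthRate (1 + e) (2 * e)
  set S := (1 + 3 * ‖x 0‖) * Real.exp (k * T)
  have hS0 : 0 ≤ S := by positivity
  have hn0 := norm_nonneg (x 0)
  have hS : ∀ ξ, (x t).p ξ + (x t).2.2.ev ξ ≤ S := fun ξ => by
    have h1 := (scalar_gronwall (fun t ht => h.sum ξ ht) (hb ξ) ht).1
    have h2 : Real.exp (k * t) ≤ Real.exp (k * T) :=
      Real.exp_le_exp.2 (mul_le_mul_of_nonneg_left ht.2 hk)
    have h3 : |(x 0).p ξ + (x 0).2.2.ev ξ| ≤ 1 + 3 * ‖x 0‖ := by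
      have a1 := State.abs_sub_mean_le (x 0).1 ξ
      have a2 := (x 0).2.2.abs_ev_le ξ
      have a3 := (x 0).norm_fst
      have a4 := (x 0).norm_trd
      rw [State.p]
      refine (abs_add_three _ _ _).trans ?_
      rw [abs_one]; linarith
    exact (le_abs_self _).trans (h1.trans (mul_le_mul h3 h2 (Real.exp_pos _).le (by positivity)))
  have hpn := (hgood t ht).nonneg hc₁
  have hq : ∀ ξ, |(x t).q ξ| ≤ S := fun ξ => by
    have h1 := h.ident h0 ht ξ
    have h2 := hpn ξ
    refine (abs_le_of_sq_le_sq (b := (x t).p ξ + (x t).2.2.ev ξ) ?_ (by linarith)).trans (hS ξ)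
    nlinarith [mul_nonneg (sq_nonneg ((x t).p ξ)) (sq_nonneg ((x t).2.1.J ξ)),
      mul_nonneg h2.1 h2.2, sq_nonneg ((x t).p ξ), sq_nonneg ((x t).2.2.ev ξ)]
  have hm2 : ∀ t ∈ Set.Icc 0 T, |PB.mean (x t).2.1| ≤ 1 + e := fun t ht => by
    rw [← PB.J_zero]; exact hU t ht 0
  -- The mean of the first component is `y(0)`; it moves with speed `c U(0)`, which is at most `1 +
  -- e` in absolute value.
  have hm1 : |PB.mean (x t).1| ≤ ‖x 0‖ + (1 + e) * T := by
    have h1 := norm_image_sub_le_of_norm_deriv_le_segment' (f := fun t => PB.mean (x t).1)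
      (f' := fun t => c t * PB.mean (x t).2.1) (C := 1 + e) (fun s hs => h.mean_fst hs)
      (fun s hs => abs_mul_le (hc s) (hm2 s ⟨hs.1, hs.2.le⟩)) t ht
    rw [Real.norm_eq_abs, sub_zero] at h1
    have h2 : |PB.mean (x 0).1| ≤ ‖x 0‖ := (PB.abs_mean_le _).trans (x 0).norm_fst
    have h3 := abs_sub_abs_le_abs_sub (PB.mean (x t).1) (PB.mean (x 0).1)
    have h4 : (1 + e) * t ≤ (1 + e) * T := by gcongr; exact ht.2
    linarith
  have hT' : 0 ≤ (1 + e) * T := by positivity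
  refine State.norm_le_of (PB.norm_le (by positivity) fun ξ => ?_)
    (PB.norm_le (by positivity) fun ξ => ?_) (PB.norm_le (by positivity) fun ξ => ?_)
  · have e1 : (x t).1.ev ξ = (x t).p ξ - 1 + PB.mean (x t).1 := by rw [State.p]; ring
    rw [e1]
    have := hS ξ
    have := hpn ξ
    have := abs_le.1 hm1
    rw [abs_le]; constructor <;> linarith
  · have e1 : (x t).2.1.ev ξ = (x t).q ξ + PB.mean (x t).2.1 := by rw [State.q]; ring
    rw [e1]
    have := abs_le.1 (hq ξ)
    have := abs_le.1 (hm2 t ht)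
    rw [abs_le]; constructor <;> linarith
  · have := hS ξ
    have := hpn ξ
    rw [abs_le]; constructor <;> linarith

end Flow

/-- Global solutions of the state equation. -/
theorem exists_global_flow {x₀ : State} (hc₀ : 0 < c₀) (h0 : Good c₀ x₀) :
    ∃ x : ℝ → State, x 0 = x₀ ∧ (∀ t, 0 ≤ t → HasDerivWithinAt x (x t).field (Set.Ici 0) t) ∧
      ∀ t, 0 ≤ t → (∃ c₁, 0 < c₁ ∧ Good c₁ (x t)) ∧ PB.mean (x t).2.2 = PB.mean x₀.2.2 := by
  have hv : LocLipField State.field := State.field_locLip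
  obtain ⟨x, hx0, hx⟩ := hv.exists_global_solution x₀ (fun T _ => ⟨_, fun x c hx0 hc hf t ht => by
    have h0' : Good c₀ (x 0) := by rw [hx0]; exact h0
    have := Flow.norm_le hc₀ hf hc h0' ht rfl
    rw [hx0] at this
    exact this⟩)
  refine ⟨x, hx0, hx, fun t ht => ?_⟩
  have hf : Flow x (fun _ => 1) t := fun s hs => by
    rw [one_smul]
    exact (hx s hs.1).mono Set.Icc_subset_Ici_self
  have h0' : Good c₀ (x 0) := by rw [hx0]; exact h0
  obtain ⟨c₁, hc₁, hg⟩ := hf.good hc₀ (fun _ => ⟨zero_le_one, le_rfl⟩) h0'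
  refine ⟨⟨c₁, hc₁, hg t ⟨ht, le_rfl⟩⟩, ?_⟩
  rw [hf.energy_const ⟨ht, le_rfl⟩, hx0]

end Invariants

/-! ### From states back to triples: existence, the operator `S`, and stability. -/

section Existence

theorem SameE.mem_F {X Y : Triple} (h : SameE X Y) (hX : X ∈ F) (hY : Y.ν ∈ L1Per) : Y ∈ F := by
  obtain ⟨⟨a1, a2, a3⟩, b1, b2, b3, b4, b5, b6, ⟨c, hc, b7⟩, b8⟩ := hX
  obtain ⟨h1, h2, h3⟩ := h
  rw [h1] at a1 b1 b2 b5 b7 b8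
  rw [h2] at a2 b3 b8
  refine ⟨⟨a1, a2, hY⟩, b1, b2, b3, (memLp_congr_ae h3).1 b4, b5, ?_, ⟨c, hc, ?_⟩, ?_⟩
  · filter_upwards [b6, h3] with ξ k1 k2
    rwa [← k2]
  · filter_upwards [b7, h3] with ξ k1 k2
    rwa [← k2]
  · filter_upwards [b8, h3] with ξ k1 k2
    rwa [← k2]

theorem exists_deriv_bound {f : ℝ → ℝ} (hf : LocallyLipschitz f)
    (hp : Function.Periodic (deriv f) 1) : ∃ K, ∀ ξ, |deriv f ξ| ≤ K := by
  obtain ⟨K, hK⟩ := (hf.locallyLipschitzOn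
    (s := Set.Icc (-1 : ℝ) 2)).exists_lipschitzOnWith_of_compact isCompact_Icc
  refine ⟨K, fun ξ => ?_⟩
  obtain ⟨x, hx, h⟩ := periodic_exists_mem_Icc hp ξ
  rw [h]
  exact norm_deriv_le_of_lipschitzOn (Icc_mem_nhds (by linarith [hx.1]) (by linarith [hx.2])) hK

theorem deriv_U_periodic {X : Triple} (hX : X ∈ F) : Function.Periodic (deriv X.U) 1 :=
  periodic_deriv (α := 0) fun ξ => by rw [hX.1.2.1.2 ξ, add_zero]

/-- Every element of `F` is described by a state. -/
theorem exists_state {X : Triple} (hX : X ∈ F) :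
    ∃ c₀ > 0, ∃ x : State, Good c₀ x ∧ SameE x.toTriple X := by
  classical
  have hX' := hX
  obtain ⟨⟨-, a2, a3⟩, b1, b2, b3, b4, b5, b6, ⟨c, hc, b7⟩, b8⟩ := hX'
  have py : Function.Periodic (deriv X.y) 1 := periodic_deriv b1.2
  have pU := deriv_U_periodic hX
  obtain ⟨Ky, hKy⟩ := exists_deriv_bound b2 py
  obtain ⟨KU, hKU⟩ := exists_deriv_bound b3 pU
  set K := (eLpNorm X.ν ∞ volume).toReal with hK
  have bK : ∀ᵐ ξ : ℝ, |X.ν ξ| ≤ K := by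
    have := ae_le_eLpNormEssSup (f := X.ν) (μ := volume)
    rw [← eLpNorm_exponent_top] at this
    filter_upwards [this] with ξ h
    rw [← ofReal_norm] at h
    exact (ENNReal.ofReal_le_iff_le_toReal b4.2.ne).1 h
  -- `A` is a periodic set of full measure on which the relations hold pointwise. Off `A` the values
  -- `0, 0, 1` for `y_ξ, U_ξ, ν` satisfy the relation trivially and have `y_ξ + ν = 1`, hence the
  -- lower bound `min c 1` below.
  set A : Set ℝ := {ξ | c ≤ deriv X.y ξ + X.ν ξ ∧ |X.ν ξ| ≤ K ∧
    deriv X.y ξ * X.ν ξ = deriv X.y ξ ^ 2 * X.U ξ ^ 2 + deriv X.U ξ ^ 2} with hA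
  have hAe : ∀ᵐ ξ : ℝ, ξ ∈ A := by
    filter_upwards [b7, bK, b8] with ξ h1 h2 h3 using ⟨h1, h2, h3⟩
  have hAp : ∀ ξ, ξ + 1 ∈ A ↔ ξ ∈ A := fun ξ => by
    have e1 := py ξ
    have e2 := pU ξ
    have e3 := a2.2 ξ
    have e4 := a3.2 ξ
    simp only [hA, Set.mem_ofPred_eq, e1, e2, e3, e4]
  have modE : ∀ (f : ℝ → ℝ) (d : ℝ), (fun ξ => if ξ ∈ A then f ξ else d) =ᵐ[volume] f :=
    fun f d => by
      filter_upwards [hAe] with ξ h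
      rw [if_pos h]
  have modP : ∀ (f : ℝ → ℝ) (d : ℝ), Function.Periodic f 1 →
      Function.Periodic (fun ξ => if ξ ∈ A then f ξ else d) 1 := fun f d hf ξ => by
    simp only [hAp ξ, hf ξ]
  set pf : ℝ → ℝ := fun ξ => if ξ ∈ A then deriv X.y ξ else 0 with hpf
  set qf : ℝ → ℝ := fun ξ => if ξ ∈ A then deriv X.U ξ else 0 with hqf
  set nf : ℝ → ℝ := fun ξ => if ξ ∈ A then X.ν ξ else 1 with hnf
  have pe : pf =ᵐ[volume] deriv X.y := modE _ _
  have qe : qf =ᵐ[volume] deriv X.U := modE _ _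
  have ne : nf =ᵐ[volume] X.ν := modE _ _
  have pm : AEStronglyMeasurable pf volume :=
    (measurable_deriv X.y).aestronglyMeasurable.congr pe.symm
  have qm : AEStronglyMeasurable qf volume :=
    (measurable_deriv X.U).aestronglyMeasurable.congr qe.symm
  have nm : AEStronglyMeasurable nf volume := a3.1.aestronglyMeasurable.congr ne.symm
  have pi : ∀ a b, IntervalIntegrable pf volume a b := fun a b =>
    (b1.1.intervalIntegrable_deriv a b).congr_ae (ae_restrict_of_ae pe.symm)
  have qi : ∀ a b, IntervalIntegrable qf volume a b := fun a b =>
    (a2.1.intervalIntegrable_deriv a b).congr_ae (ae_restrict_of_ae qe.symm)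
  have pInt : ∀ a b, ∫ ξ in a..b, pf ξ = X.y b - X.y a := fun a b =>
    b1.1.integral_of_ae_eq pe.symm a b
  have qInt : ∀ a b, ∫ ξ in a..b, qf ξ = X.U b - X.U a := fun a b =>
    a2.1.integral_of_ae_eq qe.symm a b
  have hK0 : 0 ≤ K := ENNReal.toReal_nonneg
  have hKy0 : 0 ≤ Ky := (abs_nonneg _).trans (hKy 0)
  have hKU0 : 0 ≤ KU := (abs_nonneg _).trans (hKU 0)
  -- `pf` has mean `1`, so adding `y(0) - 1` produces the mean `y(0)` that the encoding requires.
  let v1 : PB := PB.mk (fun ξ => pf ξ + (X.y 0 - 1))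
    (fun ξ => by simp only [modP _ 0 py ξ, hpf]) (pm.add aestronglyMeasurable_const)
    ⟨Ky + |X.y 0 - 1|, fun ξ => (abs_add_le _ _).trans (add_le_add (by
      simp only [hpf]; split_ifs; exacts [hKy ξ, by simpa using hKy0]) le_rfl)⟩
  let v2 : PB := PB.mk (fun ξ => qf ξ + X.U 0)
    (fun ξ => by simp only [modP _ 0 pU ξ, hqf]) (qm.add aestronglyMeasurable_const)
    ⟨KU + |X.U 0|, fun ξ => (abs_add_le _ _).trans (add_le_add (by
      simp only [hqf]; split_ifs; exacts [hKU ξ, by simpa using hKU0]) le_rfl)⟩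
  let v3 : PB := PB.mk nf (modP _ 1 a3.2) nm
    ⟨K + 1, fun ξ => by
      simp only [hnf]
      split_ifs with h
      · exact h.2.1.trans (by linarith)
      · rw [abs_one]; linarith⟩
  have hm1 : PB.mean v1 = X.y 0 := by
    change ∫ ξ in (0 : ℝ)..1, (pf ξ + (X.y 0 - 1)) = _
    have := b1.2 0
    rw [zero_add] at this
    rw [intervalIntegral.integral_add (pi 0 1) intervalIntegrable_const, pInt,
      intervalIntegral.integral_const, this]
    simp
  have hm2 : PB.mean v2 = X.U 0 := by
    change ∫ ξ in (0 : ℝ)..1, (qf ξ + X.U 0) = _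
    have := a2.2 0
    rw [zero_add] at this
    rw [intervalIntegral.integral_add (qi 0 1) intervalIntegrable_const, qInt,
      intervalIntegral.integral_const, this]
    simp
  have hJ1 : ∀ ξ, ξ + v1.J ξ = X.y ξ := fun ξ => by
    rw [PB.J_eq, hm1]
    change ξ + (_ + ∫ η in (0 : ℝ)..ξ, (pf η + (X.y 0 - 1))) = _
    rw [intervalIntegral.integral_add (pi 0 ξ) intervalIntegrable_const, pInt,
      intervalIntegral.integral_const, smul_eq_mul]
    ring
  have hJ2 : ∀ ξ, v2.J ξ = X.U ξ := fun ξ => by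
    rw [PB.J_eq, hm2]
    change (_ + ∫ η in (0 : ℝ)..ξ, (qf η + X.U 0)) = _
    rw [intervalIntegral.integral_add (qi 0 ξ) intervalIntegrable_const, qInt,
      intervalIntegral.integral_const, smul_eq_mul]
    ring
  have hp : ∀ ξ, State.p (v1, v2, v3) ξ = pf ξ := fun ξ => by
    change 1 + (pf ξ + (X.y 0 - 1) - PB.mean v1) = pf ξ
    rw [hm1]; ring
  have hq : ∀ ξ, State.q (v1, v2, v3) ξ = qf ξ := fun ξ => by
    change qf ξ + X.U 0 - PB.mean v2 = qf ξ
    rw [hm2]; ring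
  refine ⟨min c 1, lt_min hc one_pos, (v1, v2, v3), ⟨fun ξ => ?_, fun ξ => ?_⟩,
    funext hJ1, funext hJ2, ne⟩
  · rw [hp, hq]
    change pf ξ * nf ξ = pf ξ ^ 2 * v2.J ξ ^ 2 + qf ξ ^ 2
    rw [hJ2]
    simp only [hpf, hqf, hnf]
    split_ifs with h
    · exact h.2.2
    · ring
  · rw [hp]
    change min c 1 ≤ pf ξ + nf ξ
    simp only [hpf, hnf]
    split_ifs with h
    · exact (min_le_left _ _).trans h.1
    · rw [zero_add]; exact min_le_right _ _

theorem LocLipField.continuous {B : Type*} [NormedAddCommGroup B] {v : B → B}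
    (hv : LocLipField v) : Continuous v := by
  rw [continuous_iff_continuousAt]
  intro x
  obtain ⟨K, hK⟩ := hv.lipschitzOnWith (‖x‖ + 1)
  refine hK.continuousOn.continuousAt ?_
  refine mem_of_superset (Metric.ball_mem_nhds x one_pos) fun y hy => ?_
  rw [mem_closedBall_zero_iff]
  rw [Metric.mem_ball, dist_eq_norm] at hy
  have := norm_add_le x (y - x)
  rw [add_sub_cancel] at this
  linarith

theorem normE_lin_le (x : State) : normE x.lin ≤ ENNReal.ofReal (15 * ‖x‖) := by
  have := x.eBound_lin.normE_le (EPer.mem_E x.lin_mem)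
  rwa [← mul_assoc, show (5 : ℝ) * 3 = 15 by norm_num] at this

theorem tendsto_normE_of_tendsto {α : Type*} {l : Filter α} {u : α → State}
    (h : Tendsto (fun a => ‖u a‖) l (𝓝 0)) {W : α → Triple} (hW : ∀ a, normE (W a) = normE (u a).lin) :
    Tendsto (fun a => normE (W a)) l (𝓝 0) := by
  have h1 := ENNReal.tendsto_ofReal (h.const_mul 15)
  rw [mul_zero, ENNReal.ofReal_zero] at h1
  refine tendsto_of_tendsto_of_tendsto_of_le_of_le tendsto_const_nhds h1 (fun a => zero_le)
    fun a => ?_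
  simp only [hW]
  exact normE_lin_le _

/-- A global solution of the state equation solves the Lagrangian system. -/
theorem isSolution_of_flow {X : Triple} {Z : ℝ → Triple} {x : ℝ → State} (h0 : Z 0 = X)
    (hS : ∀ t, SameE (Z t) (x t).toTriple) (hν : ∀ t, (Z t).ν ∈ L1Per)
    (hx : ∀ t, 0 ≤ t → HasDerivWithinAt x (x t).field (Set.Ici 0) t) : IsSolution X Z := by
  have hm : ∀ t, Z t ∈ E₁ := fun t => by
    have := (x t).toTriple_mem
    refine ⟨?_, ?_, hν t⟩
    · rw [(hS t).1]; exact this.1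
    · rw [(hS t).2.1]; exact this.2.1
  have hr : ∀ t, SameE (rhs (Z t)) (x t).field.lin := fun t => by
    rw [(hS t).rhs_eq]; exact (x t).rhs_toTriple
  refine ⟨h0, fun t _ => E₁.mem_E (hm t), fun t _ => EPer.mem_E (rhs_mem_EPer (hm t)),
    fun t ht => ?_, fun t ht => ?_⟩
  · have h1 := (hasDerivWithinAt_iff_tendsto_slope.1 (hx t ht)).sub_const (x t).field
    rw [sub_self] at h1
    have h2 := h1.norm
    rw [norm_zero] at h2
    refine tendsto_normE_of_tendsto h2 fun s => ?_
    rw [((((hS s).sub (hS t)).smul _).sub (hr t)).normE_eq, State.toTriple_sub, State.lin_smul,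
      State.lin_sub]
    rfl
  · have hc : ContinuousWithinAt (fun s => (x s).field) (Set.Ici 0) t :=
      (LocLipField.continuous State.field_locLip).continuousAt.comp_continuousWithinAt
        (hx t ht).continuousWithinAt
    have h1 := (Tendsto.sub_const hc (x t).field)
    rw [sub_self] at h1
    have h2 := h1.norm
    rw [norm_zero] at h2
    refine tendsto_normE_of_tendsto h2 fun s => ?_
    rw [((hr s).sub (hr t)).normE_eq, State.lin_sub]

/-- Global existence, invariance of `F` and conservation of energy. -/
theorem exists_solution {X : Triple} (hX : X ∈ F) :
    ∃ Z, IsSolution X Z ∧ ∀ t, 0 ≤ t → Z t ∈ F ∧ energy (Z t) = energy X := by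
  obtain ⟨c₀, hc₀, x₀, hg, hS₀⟩ := exists_state hX
  obtain ⟨x, hx0, hx, hinv⟩ := exists_global_flow hc₀ hg
  -- The added function vanishes almost everywhere and does not depend on time; it makes the initial
  -- condition hold literally for the given representative of `ν`.
  set Z : ℝ → Triple := fun t => ((x t).toTriple.y, (x t).toTriple.U,
    (x t).toTriple.ν + (X.ν - x₀.toTriple.ν)) with hZ
  have hS : ∀ t, SameE (Z t) (x t).toTriple := fun t => ⟨rfl, rfl, by
    filter_upwards [hS₀.2.2] with ξ h
    change (x t).toTriple.ν ξ + (X.ν ξ - x₀.toTriple.ν ξ) = _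
    rw [h]; ring⟩
  have hν : ∀ t, (Z t).ν ∈ L1Per := fun t => by
    have h1 := State.mem_L1Per (x t).2.2
    have h2 := L1Per.sub hX.1.2.2 (State.mem_L1Per x₀.2.2)
    exact ⟨h1.1.add h2.1, fun ξ => by
      change (x t).2.2.ev (ξ + 1) + (X.ν - x₀.2.2.ev) (ξ + 1) = _
      rw [h1.2 ξ, h2.2 ξ]; rfl⟩
  have h0 : Z 0 = X := by
    refine Prod.ext ?_ (Prod.ext ?_ ?_)
    · change (x 0).toTriple.y = X.y
      rw [hx0]; exact hS₀.1
    · change (x 0).toTriple.U = X.U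
      rw [hx0]; exact hS₀.2.1
    · change (x 0).toTriple.ν + (X.ν - x₀.toTriple.ν) = X.ν
      rw [hx0]; abel
  refine ⟨Z, isSolution_of_flow h0 hS hν hx, fun t ht => ?_⟩
  obtain ⟨⟨c₁, hc₁, hg₁⟩, he⟩ := hinv t ht
  refine ⟨(hS t).symm.mem_F (hg₁.mem_F hc₁) (hν t), ?_⟩
  rw [(hS t).energy_eq, hg₁.energy_eq hc₁, he, ← hg.energy_eq hc₀, hS₀.energy_eq]

theorem isSolution_S {X : Triple} (hX : X ∈ F) : IsSolution X (fun t => S t X) := by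
  have hex : ∃ Z, IsSolution X Z := (exists_solution hX).imp fun _ h => h.1
  have : (fun t => S t X) = hex.choose := by
    funext t
    rw [S, dif_pos hex]
  rw [this]
  exact hex.choose_spec

theorem sameE_S {X : Triple} (hX : X ∈ F) {Z : ℝ → Triple} (hZ : IsSolution X Z) {t : ℝ}
    (ht : 0 ≤ t) : SameE (Z t) (S t X) :=
  hZ.unique (isSolution_S hX) (F.mem_E₁ hX) ht

theorem S_mem_F {X : Triple} (hX : X ∈ F) {t : ℝ} (ht : 0 ≤ t) :
    S t X ∈ F ∧ energy (S t X) = energy X := by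
  obtain ⟨Z, hZ, h⟩ := exists_solution hX
  have hS := sameE_S hX hZ ht
  exact ⟨hS.mem_F (h t ht).1 ((isSolution_S hX).mem t ht).2.2, by
    rw [← hS.energy_eq, (h t ht).2]⟩

/-- Stability of the flow on sets of bounded energy. -/
theorem nE_S_sub_le {X Y : Triple} (hX : X ∈ F) (hY : Y ∈ F) {M T t : ℝ} (hXM : energy X ≤ M)
    (hYM : energy Y ≤ M) (ht : t ∈ Set.Icc 0 T) :
    nE (S t X - S t Y) ≤ nE (X - Y) * Real.exp (5 * lipRhs (1 + M) * t) := by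
  refine (isSolution_S hX).nE_sub_le (isSolution_S hY) (F.mem_E₁ hX) (F.mem_E₁ hY)
    (fun s hs => ?_) (fun s hs => ?_) ht
  · have := S_mem_F hX hs.1
    exact (F.bnd this.1).mono (by linarith)
  · have := S_mem_F hY hs.1
    exact (F.bnd this.1).mono (by linarith)

end Existence

/-! ### Bi-Lipschitz relabelings: null sets, chain rule, change of variables. -/

section Relabeling

/-- `f` is a bi-Lipschitz relabeling function with inverse `g`. -/
structure Relabel (f g : ℝ → ℝ) : Prop where
  left : ∀ ξ, g (f ξ) = ξ
  right : ∀ ξ, f (g ξ) = ξ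
  lip : ∃ K, LipschitzWith K f
  lip_inv : ∃ K, LipschitzWith K g
  shift : ∀ ξ, f (ξ + 1) = f ξ + 1

theorem lipschitzWith_of_deriv_le {f : ℝ → ℝ} (hf : W11Loc f) {K : ℝ}
    (h : ∀ᵐ ξ : ℝ, |deriv f ξ| ≤ K) : LipschitzWith K.toNNReal f := by
  refine LipschitzWith.of_dist_le_mul fun x y => ?_
  have h1 : ‖∫ ξ in y..x, deriv f ξ‖ ≤ K.toNNReal * |x - y| := by
    refine intervalIntegral.norm_integral_le_of_norm_le_const_ae ?_
    filter_upwards [h] with ξ hξ _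
    exact hξ.trans (Real.le_coe_toNNReal K)
  rwa [hf.integral_deriv] at h1

theorem exists_lipschitzWith {f : ℝ → ℝ} (hf : LocallyLipschitz f) {α : ℝ}
    (h : ∀ ξ, f (ξ + 1) = f ξ + α) : ∃ K, LipschitzWith K f := by
  obtain ⟨K, hK⟩ := exists_deriv_bound hf (periodic_deriv h)
  exact ⟨_, lipschitzWith_of_deriv_le (W11Loc.of_locallyLipschitz hf) (ae_of_all _ hK)⟩

namespace Relabel

variable {f g f' g' : ℝ → ℝ}

theorem continuous (h : Relabel f g) : Continuous f := h.lip.choose_spec.continuous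

theorem injective (h : Relabel f g) : Function.Injective f :=
  Function.LeftInverse.injective h.left

theorem strictMono (h : Relabel f g) : StrictMono f := by
  refine (h.continuous.strictMono_of_inj h.injective).resolve_right fun ha => ?_
  have h1 := ha (zero_lt_one (α := ℝ))
  have h2 := h.shift 0
  rw [zero_add] at h2
  linarith

theorem symm (h : Relabel f g) : Relabel g f where
  left := h.right
  right := h.left
  lip := h.lip_inv
  lip_inv := h.lip
  shift := fun ξ => h.injective (by rw [h.right, h.shift, h.right])

theorem comp (h : Relabel f g) (h' : Relabel f' g') :
    Relabel (fun ξ => f (f' ξ)) (fun ξ => g' (g ξ)) where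
  left := fun ξ => by rw [h.left, h'.left]
  right := fun ξ => by rw [h'.right, h.right]
  lip := ⟨_, h.lip.choose_spec.comp h'.lip.choose_spec⟩
  lip_inv := ⟨_, h'.lip_inv.choose_spec.comp h.lip_inv.choose_spec⟩
  shift := fun ξ => by rw [h'.shift, h.shift]

theorem sub_const (a : ℝ) : Relabel (fun ξ => ξ - a) (fun ξ => ξ + a) where
  left := fun ξ => by ring
  right := fun ξ => by ring
  lip := ⟨1, LipschitzWith.of_dist_le_mul fun x y => by simp⟩
  lip_inv := ⟨1, LipschitzWith.of_dist_le_mul fun x y => by simp⟩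
  shift := fun ξ => by ring

theorem refl : Relabel (fun ξ => ξ) (fun ξ => ξ) where
  left := fun _ => rfl
  right := fun _ => rfl
  lip := ⟨1, LipschitzWith.id⟩
  lip_inv := ⟨1, LipschitzWith.id⟩
  shift := fun _ => rfl

theorem mem_G (h : Relabel f g) : f ∈ G := by
  have key : ∀ {f g : ℝ → ℝ}, Relabel f g → W1infPer (fun ξ => f ξ - ξ) := fun h =>
    ⟨(h.lip.choose_spec.sub LipschitzWith.id).locallyLipschitz, fun ξ => by
      change _ - _ = _ - _
      rw [h.shift]; ring⟩
  exact ⟨h.lip.choose_spec.locallyLipschitz, h.shift, g, h.left, h.right, key h, key h.symm⟩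

/-- Membership in `G` gives local Lipschitz bounds only; periodicity of the derivatives makes them
global. The inverse is a periodic Lipschitz function plus the identity. -/
theorem exists_of_mem_G (h : f ∈ G) : ∃ g, Relabel f g := by
  obtain ⟨h1, h2, g, h3, h4, h5, h6⟩ := h
  have h7 : ∀ ξ, g (ξ + 1) = g ξ + 1 := fun ξ => by
    have := h6.2 ξ
    simp only at this
    linarith
  obtain ⟨K, hK⟩ := exists_lipschitzWith (α := 0) h6.1 (fun ξ => (h6.2 ξ).trans (add_zero _).symm)
  refine ⟨g, h3, h4, exists_lipschitzWith h1 h2, ⟨K + 1, ?_⟩, h2⟩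
  have := hK.add LipschitzWith.id
  simpa using this

/-- The preimage of a null set under `f` is its image under the Lipschitz inverse, and Lipschitz
maps preserve sets of zero one-dimensional Hausdorff measure. -/
theorem ae_comp (h : Relabel f g) {p : ℝ → Prop} (hp : ∀ᵐ x : ℝ, p x) : ∀ᵐ x : ℝ, p (f x) := by
  obtain ⟨K, hK⟩ := h.lip_inv
  rw [ae_iff] at hp ⊢
  have h1 : {x | ¬ p (f x)} = g '' {x | ¬ p x} := by
    ext x
    constructor
    · exact fun hx => ⟨f x, hx, h.left x⟩
    · rintro ⟨z, hz, rfl⟩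
      change ¬ p (f (g z))
      rwa [h.right]
  rw [h1]
  have := hK.hausdorffMeasure_image_le (d := 1) zero_le_one {x | ¬ p x}
  rw [MeasureTheory.hausdorffMeasure_real, hp, mul_zero] at this
  exact le_antisymm this bot_le

theorem w11Loc (h : Relabel f g) : W11Loc f :=
  W11Loc.of_locallyLipschitz h.lip.choose_spec.locallyLipschitz

theorem uIoc_eq (h : Relabel f g) (a b : ℝ) : Set.uIoc (f a) (f b) = f '' Set.uIoc a b := by
  ext x
  obtain ⟨x, rfl⟩ : ∃ z, f z = x := ⟨_, h.right x⟩
  rw [h.injective.mem_set_image, Set.mem_uIoc, Set.mem_uIoc]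
  simp only [h.strictMono.lt_iff_lt, h.strictMono.le_iff_le]

/-- Absolute continuity does not survive composition in general. Here the inner function is
injective and monotone, so it sends disjoint intervals to disjoint intervals, with total length
growing at most by the factor `K`. -/
theorem comp_w11Loc (h : Relabel f g) {u : ℝ → ℝ} (hu : W11Loc u) :
    W11Loc (fun ξ => u (f ξ)) := by
  intro a b
  obtain ⟨K, hK⟩ := h.lip
  have hab := hu (f a) (f b)
  rw [absolutelyContinuousOnInterval_iff] at hab ⊢
  intro ε hε
  obtain ⟨δ, hδ, hE⟩ := hab ε hε
  refine ⟨δ / (K + 1), by positivity, fun E hmem hs => ?_⟩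
  have hmem' : (E.1, fun i => (f (E.2 i).1, f (E.2 i).2)) ∈
      AbsolutelyContinuousOnInterval.disjWithin (f a) (f b) := by
    refine ⟨fun i hi => ?_, fun i hi j hj hij => ?_⟩
    · exact ⟨h.strictMono.monotone.image_uIcc_subset ⟨_, (hmem.1 i hi).1, rfl⟩,
        h.strictMono.monotone.image_uIcc_subset ⟨_, (hmem.1 i hi).2, rfl⟩⟩
    · simp only [Function.onFun, h.uIoc_eq]
      exact (Set.disjoint_image_iff h.injective).2 (hmem.2 hi hj hij)
  refine hE _ hmem' ?_
  calc ∑ i ∈ Finset.range E.1, dist (f (E.2 i).1) (f (E.2 i).2)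
      ≤ ∑ i ∈ Finset.range E.1, K * dist (E.2 i).1 (E.2 i).2 :=
        Finset.sum_le_sum fun i _ => hK.dist_le_mul _ _
    _ = K * ∑ i ∈ Finset.range E.1, dist (E.2 i).1 (E.2 i).2 := by rw [Finset.mul_sum]
    _ ≤ K * (δ / (K + 1)) := by gcongr
    _ < (K + 1) * (δ / (K + 1)) := by gcongr; simp
    _ = δ := by field

theorem chain (h : Relabel f g) {u v : ℝ → ℝ} (hu : ∀ᵐ ξ : ℝ, HasDerivAt u (v ξ) ξ) :
    ∀ᵐ ξ : ℝ, HasDerivAt (fun ξ => u (f ξ)) (v (f ξ) * deriv f ξ) ξ := by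
  filter_upwards [h.ae_comp hu, h.w11Loc.ae_differentiableAt] with ξ h1 h2
  exact h1.comp ξ h2.hasDerivAt

theorem deriv_comp (h : Relabel f g) {u : ℝ → ℝ} (hu : W11Loc u) :
    ∀ᵐ ξ : ℝ, deriv (fun ξ => u (f ξ)) ξ = deriv u (f ξ) * deriv f ξ := by
  filter_upwards [h.chain (hu.ae_differentiableAt.mono fun ξ hξ => hξ.hasDerivAt)] with ξ hξ
  exact hξ.deriv

theorem deriv_nonneg (h : Relabel f g) (ξ : ℝ) : 0 ≤ deriv f ξ :=
  h.strictMono.monotone.deriv_nonneg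

theorem deriv_periodic (h : Relabel f g) : Function.Periodic (deriv f) 1 := periodic_deriv h.shift

theorem deriv_le (h : Relabel f g) : ∃ K : ℝ, ∀ ξ, deriv f ξ ≤ K := by
  obtain ⟨K, hK⟩ := exists_deriv_bound h.lip.choose_spec.locallyLipschitz h.deriv_periodic
  exact ⟨K, fun ξ => (le_abs_self _).trans (hK ξ)⟩

theorem deriv_mul (h : Relabel f g) : ∀ᵐ ξ : ℝ, deriv g (f ξ) * deriv f ξ = 1 := by
  filter_upwards [h.deriv_comp h.symm.w11Loc] with ξ hξ
  rw [← hξ]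
  simp_rw [h.left]
  exact deriv_id ξ

/-- The inverse has bounded derivative, and the product of the two derivatives is `1` almost
everywhere. -/
theorem deriv_lower (h : Relabel f g) : ∃ c : ℝ, 0 < c ∧ ∀ᵐ ξ : ℝ, c ≤ deriv f ξ := by
  obtain ⟨K, hK⟩ := h.symm.deriv_le
  have hK0 : 0 ≤ K := (h.symm.deriv_nonneg 0).trans (hK 0)
  refine ⟨(K + 1)⁻¹, by positivity, ?_⟩
  filter_upwards [h.deriv_mul] with ξ hξ
  have h1 := h.deriv_nonneg ξ
  rw [inv_le_iff_one_le_mul₀ (by positivity), ← hξ]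
  nlinarith [hK (f ξ)]

/-- The primitive of `m` composed with `f` is absolutely continuous and has the integrand as its
derivative. This gives integrability and the substitution rule together. -/
theorem int_comp (h : Relabel f g) {m : ℝ → ℝ} (hm : ∀ a b, IntervalIntegrable m volume a b) :
    (∀ a b, IntervalIntegrable (fun η => m (f η) * deriv f η) volume a b) ∧
    ∀ a b, ∫ η in a..b, m (f η) * deriv f η = ∫ η in (f a)..(f b), m η := by
  have h1 := h.comp_w11Loc (w11Loc_primitive hm 0)
  have h2 : deriv (fun ξ => ∫ t in (0 : ℝ)..f ξ, m t) =ᵐ[volume] fun ξ => m (f ξ) * deriv f ξ := by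
    filter_upwards [h.chain (deriv_primitive hm 0)] with ξ hξ using hξ.deriv
  refine ⟨fun a b => (h1.intervalIntegrable_deriv a b).congr_ae (ae_restrict_of_ae h2),
    fun a b => ?_⟩
  rw [h1.integral_of_ae_eq h2, intervalIntegral.integral_interval_sub_left (hm _ _) (hm _ _)]

theorem intervalIntegrable (h : Relabel f g) {m : ℝ → ℝ}
    (hm : ∀ a b, IntervalIntegrable m volume a b) (a b : ℝ) :
    IntervalIntegrable (fun η => m (f η) * deriv f η) volume a b :=
  (h.int_comp hm).1 a b

theorem integral_comp (h : Relabel f g) {m : ℝ → ℝ}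
    (hm : ∀ a b, IntervalIntegrable m volume a b) (a b : ℝ) :
    ∫ η in a..b, m (f η) * deriv f η = ∫ η in (f a)..(f b), m η :=
  (h.int_comp hm).2 a b

/-- The invariance of `L¹` norms over a period, on which the uniformity of all constants in the
relabeling rests. -/
theorem integral_abs (h : Relabel f g) {m : ℝ → ℝ} (hp : Function.Periodic m 1)
    (hm : ∀ a b, IntervalIntegrable m volume a b) :
    ∫ η in (0 : ℝ)..1, |m (f η) * deriv f η| = ∫ η in (0 : ℝ)..1, |m η| := by
  simp_rw [abs_mul, abs_of_nonneg (h.deriv_nonneg _)]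
  rw [h.integral_comp (fun a b => (hm a b).abs)]
  have h1 := h.shift 0
  rw [zero_add] at h1
  rw [h1]
  have := (Adm.periodic_abs hp).intervalIntegral_add_eq (f 0) 0
  rwa [zero_add] at this

end Relabel

end Relabeling

/-! ### Equivariance of the system and its flow under relabeling. -/

section Action

variable {f g f' g' : ℝ → ℝ} {X Y : Triple}

namespace Relabel

theorem reflect (h : Relabel f g) : Relabel (fun s => -f (-s)) (fun s => -g (-s)) where
  left := fun ξ => by rw [neg_neg, h.left, neg_neg]
  right := fun ξ => by rw [neg_neg, h.right, neg_neg]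
  lip := ⟨_, (h.lip.choose_spec.comp LipschitzWith.id.neg).neg⟩
  lip_inv := ⟨_, (h.lip_inv.choose_spec.comp LipschitzWith.id.neg).neg⟩
  shift := fun ξ => by
    have := h.shift (-(ξ + 1))
    rw [show -(ξ + 1) + 1 = -ξ by ring] at this
    linarith

theorem deriv_reflect (f : ℝ → ℝ) (s : ℝ) : deriv (fun s => -f (-s)) s = deriv f (-s) := by
  rw [deriv.fun_neg, deriv_comp_neg, neg_neg]

theorem comp_w11Per (h : Relabel f g) {u : ℝ → ℝ} (hu : u ∈ W11Per) :
    (fun ξ => u (f ξ)) ∈ W11Per :=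
  ⟨h.comp_w11Loc hu.1, fun ξ => by
    change u (f (ξ + 1)) = _
    rw [h.shift, hu.2]⟩

theorem comp_V₁ (h : Relabel f g) {u : ℝ → ℝ} (hu : u ∈ V₁) : (fun ξ => u (f ξ)) ∈ V₁ :=
  ⟨h.comp_w11Loc hu.1, fun ξ => by
    change u (f (ξ + 1)) = _
    rw [h.shift, hu.2]⟩

theorem comp_l1Per (h : Relabel f g) {u : ℝ → ℝ} (hu : u ∈ L1Per) :
    (fun ξ => u (f ξ) * deriv f ξ) ∈ L1Per :=
  ⟨locallyIntegrable_iff_intervalIntegrable.2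
      (h.intervalIntegrable (L1Per.intervalIntegrable hu)), fun ξ => by
    change u (f (ξ + 1)) * deriv f (ξ + 1) = _
    rw [h.shift, hu.2, h.deriv_periodic]⟩

theorem act_E₁ (h : Relabel f g) (hX : X ∈ E₁) : act X f ∈ E₁ :=
  ⟨h.comp_V₁ hX.1, h.comp_w11Per hX.2.1, h.comp_l1Per hX.2.2⟩

theorem act_EPer (h : Relabel f g) (hX : X ∈ EPer) : act X f ∈ EPer :=
  ⟨h.comp_w11Per hX.1, h.comp_w11Per hX.2.1, h.comp_l1Per hX.2.2⟩

theorem act_sameE (h : Relabel f g) (hS : SameE X Y) : SameE (act X f) (act Y f) := by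
  refine ⟨?_, ?_, ?_⟩
  · simp only [act, Triple.y, hS.1]
  · simp only [act, Triple.U, hS.2.1]
  · filter_upwards [h.ae_comp hS.2.2] with ξ hξ
    change X.ν (f ξ) * _ = Y.ν (f ξ) * _
    rw [hξ]

/-- Only `SameE`, because the chain rule for the composed relabelings holds almost everywhere. -/
theorem act_act (h : Relabel f g) (h' : Relabel f' g') (X : Triple) :
    SameE (act (act X f) f') (act X fun ξ => f (f' ξ)) := by
  refine ⟨rfl, rfl, ?_⟩
  filter_upwards [h'.deriv_comp h.w11Loc] with ξ hξ
  change X.ν (f (f' ξ)) * deriv f (f' ξ) * deriv f' ξ = X.ν (f (f' ξ)) * deriv (fun ξ => f (f' ξ)) ξ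
  rw [hξ, mul_assoc]

theorem eBound_act (h : Relabel f g) (hX : X ∈ EPer) {D : ℝ} (hD : EBound X D) :
    EBound (act X f) D := by
  have key : ∀ {u : ℝ → ℝ}, u ∈ W11Per →
      ∫ ξ in (0 : ℝ)..1, |deriv (fun ξ => u (f ξ)) ξ| = ∫ ξ in (0 : ℝ)..1, |deriv u ξ| := by
    intro u hu
    rw [← h.integral_abs (periodic_deriv (α := 0) fun ξ => (hu.2 ξ).trans (add_zero _).symm)
      hu.1.intervalIntegrable_deriv]
    refine intervalIntegral.integral_congr_ae ?_
    filter_upwards [h.deriv_comp hu.1] with ξ hξ _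
    rw [hξ]
  refine ⟨fun ξ => hD.y _, fun ξ => hD.U _, ?_, ?_, ?_⟩
  · exact (key hX.1).trans_le hD.dy
  · exact (key hX.2.1).trans_le hD.dU
  · exact (h.integral_abs hX.2.2.2 (L1Per.intervalIntegrable hX.2.2)).trans_le hD.ν

/-- The factor `5` is an artefact of passing through `EBound`. It serves only to transport limits to
relabeled solutions. -/
theorem normE_act_le (h : Relabel f g) (hX : X ∈ EPer) : normE (act X f) ≤ 5 * normE X := by
  refine ((h.eBound_act hX (EPer.eBound hX)).normE_le (EPer.mem_E (h.act_EPer hX))).trans ?_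
  rw [ENNReal.ofReal_mul (by norm_num), ENNReal.ofReal_toReal (normE_lt_top (EPer.mem_E hX)).ne]
  norm_num

/-- Substitution in the one-period formula; the period is respected because `f (ξ - 1) = f ξ - 1`.
-/
theorem leftConv_comp (h : Relabel f g) {y m m' : ℝ → ℝ} (hA : Adm y m)
    (hA' : Adm (fun ξ => y (f ξ)) m') (hm : m' =ᵐ[volume] fun ξ => m (f ξ) * deriv f ξ) (ξ : ℝ) :
    leftConv (fun ξ => y (f ξ)) m' ξ = leftConv y m (f ξ) := by
  rw [hA'.leftConv_eq_period, hA.leftConv_eq_period]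
  congr 1
  have h1 : f (ξ - 1) = f ξ - 1 := by
    have := h.shift (ξ - 1)
    rw [sub_add_cancel] at this
    linarith
  rw [← h1, ← h.integral_comp (m := fun η => Real.exp (y η - y (f ξ)) * m η)]
  · refine intervalIntegral.integral_congr_ae ?_
    filter_upwards [hm] with η hη _
    rw [hη]; ring
  · intro a b
    exact (hA.int a b).continuousOn_mul
      (Real.continuous_exp.comp (hA.continuous.sub continuous_const)).continuousOn

theorem rightConv_comp (h : Relabel f g) {y m m' : ℝ → ℝ} (hA : Adm y m)
    (hA' : Adm (fun ξ => y (f ξ)) m') (hm : m' =ᵐ[volume] fun ξ => m (f ξ) * deriv f ξ) (ξ : ℝ) :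
    rightConv (fun ξ => y (f ξ)) m' ξ = rightConv y m (f ξ) := by
  rw [Adm.rightConv_eq_reflect, Adm.rightConv_eq_reflect]
  have h1 : Adm (fun ξ => -y (- -f (-ξ))) fun s => m' (-s) := by
    simp only [neg_neg]
    exact hA'.reflect
  have h2 := h.reflect.leftConv_comp hA.reflect h1 (by
    filter_upwards [Adm.ae_comp_neg hm] with s hs
    rw [hs, deriv_reflect, neg_neg]) (-ξ)
  simpa only [neg_neg] using h2

theorem src_act (h : Relabel f g) (hX : X ∈ E₁) :
    src (act X f) =ᵐ[volume] fun ξ => src X (f ξ) * deriv f ξ := by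
  filter_upwards [h.deriv_comp hX.1.1] with ξ hξ
  change X.U (f ξ) ^ 2 * deriv (fun ξ => X.y (f ξ)) ξ + X.ν (f ξ) * deriv f ξ = _
  rw [hξ, src]; ring

theorem PQ_act (h : Relabel f g) (hX : X ∈ E₁) (ξ : ℝ) :
    P (act X f) ξ = P X (f ξ) ∧ Q (act X f) ξ = Q X (f ξ) := by
  have hA := E₁.adm hX
  have hA' := E₁.adm (h.act_E₁ hX)
  rw [P_eq_conv hX, Q_eq_conv hX, P_eq_conv (h.act_E₁ hX), Q_eq_conv (h.act_E₁ hX),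
    ← h.leftConv_comp hA hA' (h.src_act hX), ← h.rightConv_comp hA hA' (h.src_act hX)]
  exact ⟨rfl, rfl⟩

/-- `P` and `Q` are transported as functions. Each term of the `ν` equation contains exactly one
spatial derivative and so acquires the factor `f_ξ`, which is how `ν` transforms. -/
theorem rhs_act (h : Relabel f g) (hX : X ∈ E₁) : SameE (rhs (act X f)) (act (rhs X) f) := by
  refine ⟨rfl, funext fun ξ => congrArg _ (h.PQ_act hX ξ).2, ?_⟩
  filter_upwards [h.deriv_comp hX.1.1, h.deriv_comp hX.2.1.1] with ξ h1 h2
  change -2 * Q (act X f) ξ * X.U (f ξ) * deriv (fun ξ => X.y (f ξ)) ξ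
    + (3 * X.U (f ξ) ^ 2 - 2 * P (act X f) ξ) * deriv (fun ξ => X.U (f ξ)) ξ
    = (-2 * Q X (f ξ) * X.U (f ξ) * deriv X.y (f ξ)
      + (3 * X.U (f ξ) ^ 2 - 2 * P X (f ξ)) * deriv X.U (f ξ)) * deriv f ξ
  rw [h1, h2, (h.PQ_act hX ξ).1, (h.PQ_act hX ξ).2]
  ring

end Relabel

theorem act_sub (X Y : Triple) (f : ℝ → ℝ) : act (X - Y) f = act X f - act Y f :=
  Prod.ext rfl (Prod.ext rfl (funext fun _ => sub_mul _ _ _))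

theorem act_smul (c : ℝ) (X : Triple) (f : ℝ → ℝ) : act (c • X) f = c • act X f :=
  Prod.ext rfl (Prod.ext rfl (funext fun _ => mul_assoc _ _ _))

/-- Relabeling maps solutions to solutions. -/
theorem IsSolution.act {Z : ℝ → Triple} (hZ : IsSolution X Z) (hX : X ∈ E₁) (h : Relabel f g) :
    IsSolution (act X f) (fun t => act (Z t) f) := by
  have hm : ∀ t, 0 ≤ t → Z t ∈ E₁ := fun t ht => hZ.mem_E₁ hX ht
  have hr : ∀ t, 0 ≤ t → rhs (Z t) ∈ EPer := fun t ht => rhs_mem_EPer (hm t ht)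
  have key : ∀ {l : Filter ℝ} {W W' : ℝ → Triple}, (∀ᶠ s in l, W s ∈ EPer) →
      (∀ᶠ s in l, SameE (W' s) (CamassaHolm.act (W s) f)) →
      Tendsto (fun s => normE (W s)) l (𝓝 0) → Tendsto (fun s => normE (W' s)) l (𝓝 0) := by
    intro l W W' h1 h2 h3
    have h4 := ENNReal.Tendsto.const_mul (a := 5) h3 (Or.inr (by norm_num))
    rw [mul_zero] at h4
    refine tendsto_of_tendsto_of_tendsto_of_le_of_le' tendsto_const_nhds h4
      (Eventually.of_forall fun _ => zero_le) ?_
    filter_upwards [h1, h2] with s k1 k2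
    rw [k2.normE_eq]
    exact h.normE_act_le k1
  refine ⟨by simp only [hZ.init], fun t ht => E₁.mem_E (h.act_E₁ (hm t ht)),
    fun t ht => EPer.mem_E (rhs_mem_EPer (h.act_E₁ (hm t ht))), fun t ht => ?_, fun t ht => ?_⟩
  · refine key ?_ ?_ (hZ.hasDeriv t ht)
    · filter_upwards [self_mem_nhdsWithin] with s hs
      exact EPer.sub (EPer.const_smul _ (E₁.sub (hm s hs.1) (hm t ht))) (hr t ht)
    · refine Eventually.of_forall fun s => ?_
      rw [act_sub, act_smul, act_sub]
      exact (SameE.refl _).sub (h.rhs_act (hm t ht))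
  · refine key ?_ ?_ (hZ.cont_deriv t ht)
    · filter_upwards [self_mem_nhdsWithin] with s hs
      exact EPer.sub (hr s hs) (hr t ht)
    · filter_upwards [self_mem_nhdsWithin] with s hs
      rw [act_sub]
      exact (h.rhs_act (hm s hs)).sub (h.rhs_act (hm t ht))

namespace Relabel

theorem comp_locallyLipschitz (h : Relabel f g) {u : ℝ → ℝ} (hu : LocallyLipschitz u) :
    LocallyLipschitz (fun ξ => u (f ξ)) :=
  hu.comp h.lip.choose_spec.locallyLipschitz

/-- `y_ξ`, `U_ξ` and `ν` are all multiplied by `f_ξ`, and the relation is homogeneous of degree two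
in them. The lower bound survives because `f_ξ` is bounded away from zero. -/
theorem act_F (h : Relabel f g) (hX : X ∈ F) : act X f ∈ F := by
  obtain ⟨hE, hy, hyL, hUL, hν, h1, h2, ⟨c, hc, h3⟩, h4⟩ := hX
  have hd := h.deriv_comp hy.1
  have hdU := h.deriv_comp hE.2.1.1
  have hE' := h.act_E₁ (X := X) ⟨hy, hE.2⟩
  refine ⟨E₁.mem_E hE', hE'.1, h.comp_locallyLipschitz hyL, h.comp_locallyLipschitz hUL, ?_, ?_, ?_,
    ?_, ?_⟩
  · obtain ⟨K, hK⟩ := h.deriv_le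
    have hb : ∀ᵐ ξ : ℝ, ‖X.ν ξ‖ ≤ (eLpNorm X.ν ∞ volume).toReal := by
      rw [eLpNorm_exponent_top]
      filter_upwards [ae_le_eLpNormEssSup (f := X.ν) (μ := volume)] with ξ hξ
      have hlt : eLpNormEssSup X.ν volume ≠ ∞ := by
        rw [← eLpNorm_exponent_top]; exact hν.2.ne
      rw [← toReal_enorm]
      exact ENNReal.toReal_mono hlt hξ
    refine memLp_top_of_bound hE'.2.2.1.aestronglyMeasurable
      ((eLpNorm X.ν ∞ volume).toReal * K) ?_
    filter_upwards [h.ae_comp hb] with ξ hξ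
    change ‖X.ν (f ξ) * deriv f ξ‖ ≤ _
    rw [norm_mul, Real.norm_of_nonneg (h.deriv_nonneg ξ)]
    exact mul_le_mul hξ (hK ξ) (h.deriv_nonneg ξ) ENNReal.toReal_nonneg
  · filter_upwards [hd, h.ae_comp h1] with ξ k1 k2
    rw [show deriv (act X f).y ξ = _ from k1]
    exact mul_nonneg k2 (h.deriv_nonneg ξ)
  · filter_upwards [h.ae_comp h2] with ξ k2
    exact mul_nonneg k2 (h.deriv_nonneg ξ)
  · obtain ⟨c', hc', h5⟩ := h.deriv_lower
    refine ⟨c * c', mul_pos hc hc', ?_⟩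
    filter_upwards [hd, h.ae_comp h3, h5] with ξ k1 k2 k3
    rw [show deriv (act X f).y ξ = _ from k1]
    change _ ≤ _ + X.ν (f ξ) * deriv f ξ
    rw [← add_mul]
    exact mul_le_mul k2 k3 hc'.le (hc.le.trans k2)
  · filter_upwards [hd, hdU, h.ae_comp h4] with ξ k1 k2 k3
    rw [show deriv (act X f).y ξ = _ from k1, show deriv (act X f).U ξ = _ from k2]
    change _ * (X.ν (f ξ) * deriv f ξ) = _ * X.U (f ξ) ^ 2 + _
    linear_combination deriv f ξ ^ 2 * k3

theorem energy_act (h : Relabel f g) (hX : X ∈ E₁) : energy (act X f) = energy X :=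
  h.integral_abs hX.2.2.2 (L1Per.intervalIntegrable hX.2.2)

/-- The relabeled solution solves the system with relabeled data, so uniqueness identifies it with
the flow. -/
theorem S_act (h : Relabel f g) (hX : X ∈ F) {t : ℝ} (ht : 0 ≤ t) :
    SameE (act (S t X) f) (S t (act X f)) :=
  sameE_S (h.act_F hX) ((isSolution_S hX).act (F.mem_E₁ hX) h) ht

end Relabel

end Action

/-! ### The normalizing relabeling and the projection onto `H`. -/

section Projection

variable {f g : ℝ → ℝ} {X Y : Triple}

/-- The lower bound makes `f` expand distances by at least the factor `c`: it is injective, tends to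
infinity at both ends, and has a Lipschitz inverse. -/
theorem Relabel.of_deriv_bounds (hf : W11Loc f) (hs : ∀ ξ, f (ξ + 1) = f ξ + 1) {c K : ℝ}
    (hc : 0 < c) (h : ∀ᵐ ξ : ℝ, c ≤ deriv f ξ ∧ deriv f ξ ≤ K) :
    Relabel f (Function.invFun f) := by
  have hlow : ∀ a b, a ≤ b → c * (b - a) ≤ f b - f a := fun a b hab => by
    rw [← hf.integral_deriv a b]
    have h1 : ∫ _ in a..b, c = c * (b - a) := by
      rw [intervalIntegral.integral_const, smul_eq_mul, mul_comm]
    rw [← h1]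
    refine intervalIntegral.integral_mono_ae hab intervalIntegrable_const
      (hf.intervalIntegrable_deriv a b) (h.mono fun ξ hξ => hξ.1)
  have hanti : AntilipschitzWith c⁻¹.toNNReal f := by
    refine AntilipschitzWith.of_le_mul_dist fun a b => ?_
    rw [Real.coe_toNNReal _ (inv_nonneg.2 hc.le), ← div_eq_inv_mul, le_div_iff₀ hc, mul_comm,
      Real.dist_eq, Real.dist_eq]
    rcases le_total a b with hab | hab
    · rw [abs_sub_comm a b, abs_sub_comm (f a), abs_of_nonneg (sub_nonneg.2 hab)]
      exact (hlow a b hab).trans (le_abs_self _)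
    · rw [abs_of_nonneg (sub_nonneg.2 hab)]
      exact (hlow b a hab).trans (le_abs_self _)
  have hsurj : Function.Surjective f := by
    refine hf.continuous.surjective ?_ ?_
    · refine tendsto_atTop_mono' (f₁ := fun x => f 0 + c * x) _ ?_
        (tendsto_atTop_add_const_left _ _ (tendsto_id.const_mul_atTop hc))
      filter_upwards [eventually_ge_atTop 0] with x hx
      have := hlow 0 x hx
      rw [sub_zero] at this
      linarith
    · refine tendsto_atBot_mono' (f₁ := fun x => f 0 + c * x) _ ?_
        (tendsto_atBot_add_const_left _ _ (tendsto_id.const_mul_atBot hc))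
      filter_upwards [eventually_le_atBot 0] with x hx
      have := hlow x 0 hx
      linarith
  have hR : Function.RightInverse (Function.invFun f) f := Function.rightInverse_invFun hsurj
  refine ⟨Function.leftInverse_invFun hanti.injective, hR, ⟨K.toNNReal, ?_⟩,
    ⟨_, hanti.to_rightInverse hR⟩, hs⟩
  refine lipschitzWith_of_deriv_le hf ?_
  filter_upwards [h] with ξ hξ
  rw [abs_of_nonneg (hc.le.trans hξ.1)]
  exact hξ.2

theorem F.integral_ν (hX : X ∈ F) : ∫ η in (0 : ℝ)..1, X.ν η = energy X := by
  refine intervalIntegral.integral_congr_ae ?_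
  filter_upwards [hX.2.2.2.2.2.2.1] with ξ hξ _
  rw [abs_of_nonneg hξ]

theorem ae_le_of_memLp_top {u : ℝ → ℝ} (hu : MemLp u ∞ volume) :
    ∃ K : ℝ, ∀ᵐ ξ : ℝ, u ξ ≤ K := by
  refine ⟨(eLpNormEssSup u volume).toReal, ?_⟩
  have hlt : eLpNormEssSup u volume ≠ ∞ := by
    rw [← eLpNorm_exponent_top]; exact hu.2.ne
  filter_upwards [ae_le_eLpNormEssSup (f := u) (μ := volume)] with ξ hξ
  refine (le_abs_self _).trans ?_
  rw [← Real.norm_eq_abs, ← toReal_enorm]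
  exact ENNReal.toReal_mono hlt hξ

/-- The relabeling function that brings `X` to constant `y_ξ + ν`. -/
noncomputable def normalizer (X : Triple) (ξ : ℝ) : ℝ :=
  (1 / (1 + energy X)) * (X.y ξ + ∫ η in (0 : ℝ)..ξ, X.ν η)

theorem F.deriv_normalizer (hX : X ∈ F) :
    ∀ᵐ ξ : ℝ, deriv (normalizer X) ξ = (1 / (1 + energy X)) * (deriv X.y ξ + X.ν ξ) := by
  filter_upwards [hX.2.1.1.ae_differentiableAt,
    deriv_primitive (L1Per.intervalIntegrable hX.1.2.2) 0] with ξ h1 h2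
  exact ((h1.hasDerivAt.add h2).const_mul _).deriv

/-- Over a period `y` grows by `1` and the primitive of `ν` by `h`, so division by `1 + h` gives
increment `1`. The bounds of the derivative are those of `y_ξ + ν` on `F`. -/
theorem F.relabel_normalizer (hX : X ∈ F) :
    Relabel (normalizer X) (Function.invFun (normalizer X)) := by
  have he := energy_nonneg X
  have hint := L1Per.intervalIntegrable hX.1.2.2
  obtain ⟨c, hc, hlow⟩ := hX.2.2.2.2.2.2.2.1
  obtain ⟨K₁, hK₁⟩ := exists_deriv_bound hX.2.2.1 (periodic_deriv hX.2.1.2)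
  obtain ⟨K₂, hK₂⟩ := ae_le_of_memLp_top hX.2.2.2.2.1
  have hpos : 0 < 1 / (1 + energy X) := by positivity
  refine Relabel.of_deriv_bounds (c := 1 / (1 + energy X) * c)
    (K := 1 / (1 + energy X) * (K₁ + K₂))
    ((hX.2.1.1.add (w11Loc_primitive hint 0)).const_mul _) (fun ξ => ?_) (mul_pos hpos hc) ?_
  · have h1 : ∫ η in (0 : ℝ)..(ξ + 1), X.ν η = (∫ η in (0 : ℝ)..ξ, X.ν η) + energy X := by
      rw [← intervalIntegral.integral_add_adjacent_intervals (hint 0 ξ) (hint ξ (ξ + 1)),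
        ← F.integral_ν hX, hX.1.2.2.2.intervalIntegral_add_eq ξ 0, zero_add]
    rw [normalizer, normalizer, h1, hX.2.1.2]
    field_simp
    ring
  · filter_upwards [F.deriv_normalizer hX, hlow, hK₂] with ξ h1 h2 h3
    rw [h1]
    exact ⟨mul_le_mul_of_nonneg_left h2 hpos.le, mul_le_mul_of_nonneg_left
      (add_le_add ((le_abs_self _).trans (hK₁ ξ)) h3) hpos.le⟩

/-- Before projection `y_ξ + ν = (1 + h) f_ξ`; after composition with the inverse, the factor `f_ξ`
cancels against the derivative of the inverse. -/
theorem F.proj₁_mem (hX : X ∈ F) : proj₁ X ∈ F₀ ∧ energy (proj₁ X) = energy X := by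
  have h := F.relabel_normalizer hX
  have he : energy (proj₁ X) = energy X := h.symm.energy_act (F.mem_E₁ hX)
  refine ⟨⟨h.symm.act_F hX, ?_⟩, he⟩
  rw [he]
  have hpos : 1 + energy X ≠ 0 := (add_pos_of_pos_of_nonneg one_pos (energy_nonneg X)).ne'
  filter_upwards [h.symm.deriv_comp hX.2.1.1, h.symm.deriv_mul,
    h.symm.ae_comp (F.deriv_normalizer hX)] with ξ h1 h2 h3
  rw [show deriv (proj₁ X).y ξ = _ from h1]
  change _ + X.ν (Function.invFun (normalizer X) ξ) * deriv (Function.invFun (normalizer X)) ξ = _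
  rw [h3] at h2
  field_simp at h2
  linear_combination h2

/-- `y` minus the identity is periodic, so only the integral of the identity feels the shift. -/
theorem integral_shift {y : ℝ → ℝ} (hy : y ∈ V₁) (a : ℝ) :
    ∫ ξ in (0 : ℝ)..1, y (ξ - a) = (∫ ξ in (0 : ℝ)..1, y ξ) - a := by
  have hc := hy.1.continuous
  have hp : Function.Periodic (fun ξ => y ξ - ξ) 1 := fun ξ => by
    change y (ξ + 1) - (ξ + 1) = _
    rw [hy.2]; ring
  have h1 := hp.intervalIntegral_add_eq (-a) 0
  rw [zero_add, intervalIntegral.integral_sub (hc.intervalIntegrable _ _)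
    (continuous_id'.intervalIntegrable _ _), intervalIntegral.integral_sub
    (hc.intervalIntegrable _ _) (continuous_id'.intervalIntegrable _ _), integral_id,
    integral_id] at h1
  rw [intervalIntegral.integral_comp_sub_right (fun ξ => y ξ) a,
    show (0 : ℝ) - a = -a by ring, show (1 : ℝ) - a = -a + 1 by ring]
  linear_combination h1

theorem F₀.proj₂_mem (hX : X ∈ F₀) : proj₂ X ∈ H ∧ energy (proj₂ X) = energy X := by
  set a := ∫ η in (0 : ℝ)..1, X.y η with ha
  have h := Relabel.sub_const a
  have he : energy (proj₂ X) = energy X := h.energy_act (F.mem_E₁ hX.1)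
  refine ⟨⟨⟨h.act_F hX.1, ?_⟩, ?_⟩, he⟩
  · rw [he]
    filter_upwards [h.deriv_comp hX.1.2.1.1, h.ae_comp hX.2] with ξ h1 h2
    rw [show deriv (proj₂ X).y ξ = _ from h1]
    change _ + X.ν (ξ - a) * deriv (fun ξ => ξ - a) ξ = _
    rw [← add_mul, h2, deriv_sub_const, deriv_id'', mul_one]
  · change ∫ ξ in (0 : ℝ)..1, X.y (ξ - a) = 0
    rw [integral_shift hX.1.2.1, ← ha, sub_self]

theorem F.proj_mem (hX : X ∈ F) : proj X ∈ H ∧ energy (proj X) = energy X := by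
  have h1 := F.proj₁_mem hX
  have h2 := F₀.proj₂_mem h1.1
  exact ⟨h2.1, h2.2.trans h1.2⟩

/-- The projection is a relabeling. -/
theorem F.proj_sameE (hX : X ∈ F) : ∃ φ ψ, Relabel φ ψ ∧ SameE (proj X) (act X φ) := by
  have h := (F.relabel_normalizer hX).symm
  have h' := Relabel.sub_const (∫ η in (0 : ℝ)..1, (proj₁ X).y η)
  exact ⟨_, _, h.comp h', h.act_act h' X⟩

/-- `J` ranges over all relabelings of both arguments. A relabeling `f` of `X` is matched by `φ⁻¹ ∘
f` on the projection, where `φ` is the relabeling that produces it. -/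
theorem J_proj_le (hX : X ∈ F) (hY : Y ∈ F) : J (proj X) (proj Y) ≤ J X Y := by
  obtain ⟨φ, φ', h, hS⟩ := F.proj_sameE hX
  obtain ⟨ψ, ψ', k, kS⟩ := F.proj_sameE hY
  have key : ∀ {A : Triple} {φ φ' f : ℝ → ℝ}, Relabel φ φ' → SameE (proj A) (act A φ) → f ∈ G →
      ∃ f₁ ∈ G, SameE (act (proj A) f₁) (act A f) := by
    intro A φ φ' f h hS hf
    obtain ⟨f', hf'⟩ := Relabel.exists_of_mem_G hf
    have h1 := h.symm.comp hf'
    refine ⟨_, h1.mem_G, (h1.act_sameE hS).trans ?_⟩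
    have h2 := h.act_act h1 A
    simp only [h.right] at h2
    exact h2
  refine le_iInf₂ fun f hf => le_iInf₂ fun g hg => ?_
  obtain ⟨f₁, hf₁, h1⟩ := key h hS hf
  obtain ⟨g₁, hg₁, h2⟩ := key k kS hg
  rw [← (h1.sub h2).normE_eq]
  exact iInf₂_le_of_le f₁ hf₁ (iInf₂_le g₁ hg₁)

end Projection

/-! ### Lipschitz estimates for `J` and `dM` along the semigroup. -/

section Contraction

variable {X Y : Triple}

/-- The growth factor of the flow over a time interval of length `T` at energy at most `M`. -/
noncomputable def growth (M T : ℝ) : ℝ≥0 := (Real.exp (|5 * lipRhs (1 + M)| * T)).toNNReal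

theorem growth_ne_zero (M T : ℝ) : (growth M T : ℝ≥0∞) ≠ 0 := by
  rw [growth, ENNReal.coe_ne_zero]
  exact (Real.toNNReal_pos.2 (Real.exp_pos _)).ne'

theorem normE_S_sub_le (hX : X ∈ F) (hY : Y ∈ F) {M T t : ℝ} (hXM : energy X ≤ M)
    (hYM : energy Y ≤ M) (ht : t ∈ Set.Icc 0 T) :
    normE (S t X - S t Y) ≤ growth M T * normE (X - Y) := by
  have h := nE_S_sub_le hX hY hXM hYM ht
  have f1 := (normE_lt_top (E.sub (S_mem_F hX ht.1).1.1 (S_mem_F hY ht.1).1.1)).ne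
  have f2 := (normE_lt_top (E.sub hX.1 hY.1)).ne
  rw [← ENNReal.ofReal_toReal f1, ← ENNReal.ofReal_toReal f2, growth, ENNReal.ofNNReal_toNNReal,
    ← ENNReal.ofReal_mul (Real.exp_pos _).le]
  refine ENNReal.ofReal_le_ofReal (h.trans ?_)
  rw [mul_comm]
  refine mul_le_mul_of_nonneg_right (Real.exp_le_exp.2 ?_) (nE_nonneg _)
  exact (mul_le_mul_of_nonneg_right (le_abs_self _) ht.1).trans
    (mul_le_mul_of_nonneg_left ht.2 (abs_nonneg _))

/-- Relabel before flowing: equivariance moves `f` and `g` inside `S t`, and the stability constant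
sees only the energies, which relabeling preserves. One constant therefore serves for all `f` and
`g`. -/
theorem J_S_le (hX : X ∈ F) (hY : Y ∈ F) {M T t : ℝ} (hXM : energy X ≤ M)
    (hYM : energy Y ≤ M) (ht : t ∈ Set.Icc 0 T) :
    J (S t X) (S t Y) ≤ growth M T * J X Y := by
  -- Dividing by the factor, which is neither `0` nor `∞`, isolates the infimum so that each pair of
  -- relabelings can be treated alone.
  rw [mul_comm, ← ENNReal.div_le_iff_le_mul (Or.inl (growth_ne_zero M T))
    (Or.inl ENNReal.coe_ne_top)]
  refine le_iInf₂ fun f hf => le_iInf₂ fun g hg => ?_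
  rw [ENNReal.div_le_iff_le_mul (Or.inl (growth_ne_zero M T)) (Or.inl ENNReal.coe_ne_top), mul_comm]
  obtain ⟨f', hf'⟩ := Relabel.exists_of_mem_G hf
  obtain ⟨g', hg'⟩ := Relabel.exists_of_mem_G hg
  refine (iInf₂_le_of_le f hf (iInf₂_le g hg)).trans ?_
  rw [((hf'.S_act hX ht.1).sub (hg'.S_act hY ht.1)).normE_eq]
  exact normE_S_sub_le (hf'.act_F hX) (hg'.act_F hY)
    ((hf'.energy_act (F.mem_E₁ hX)).trans_le hXM) ((hg'.energy_act (F.mem_E₁ hY)).trans_le hYM) ht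

theorem Sbar_mem_HM {M t : ℝ} (hX : X ∈ HM M) (ht : 0 ≤ t) : Sbar t X ∈ HM M := by
  have h1 := S_mem_F hX.1.1.1 ht
  have h2 := F.proj_mem h1.1
  exact ⟨h2.1, (h2.2.trans h1.2).trans_le hX.2⟩

theorem J_Sbar_le {M T t : ℝ} (hX : X ∈ HM M) (hY : Y ∈ HM M) (ht : t ∈ Set.Icc 0 T) :
    J (Sbar t X) (Sbar t Y) ≤ growth M T * J X Y :=
  (J_proj_le (S_mem_F hX.1.1.1 ht.1).1 (S_mem_F hY.1.1.1 ht.1).1).trans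
    (J_S_le hX.1.1.1 hY.1.1.1 hX.2 hY.2 ht)

theorem J_ne_top (hX : X ∈ F) (hY : Y ∈ F) : J X Y ≠ ∞ := by
  have hG := Relabel.refl.mem_G
  refine ne_top_of_le_ne_top (normE_lt_top (E.sub (Relabel.refl.act_F hX).1
    (Relabel.refl.act_F hY).1)).ne (iInf₂_le_of_le _ hG (iInf₂_le _ hG))

theorem dM_ne_top {M : ℝ} (hX : X ∈ HM M) (hY : Y ∈ HM M) : dM M X Y ≠ ∞ := by
  refine ne_top_of_le_ne_top (J_ne_top hX.1.1.1 hY.1.1.1) ?_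
  -- The chain with the single link from `X` to `Y`.
  refine iInf_le_of_le 1 (iInf_le_of_le (fun n => if n = 0 then X else Y)
    (iInf_le_of_le rfl (iInf_le_of_le rfl (iInf_le_of_le (fun n _ => ?_) ?_))))
  · dsimp only
    split_ifs
    exacts [hX, hY]
  · simp

/-- The image of a chain under `Sbar t` is again a chain in `HM M`, because the energy is conserved,
and each of its links is estimated by `J_Sbar_le`. -/
theorem dM_Sbar_le {M T t : ℝ} (ht : t ∈ Set.Icc 0 T) :
    dM M (Sbar t X) (Sbar t Y) ≤ growth M T * dM M X Y := by
  rw [mul_comm, ← ENNReal.div_le_iff_le_mul (Or.inl (growth_ne_zero M T))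
    (Or.inl ENNReal.coe_ne_top)]
  refine le_iInf fun N => le_iInf fun c => le_iInf fun h0 => le_iInf fun hN => le_iInf fun hc => ?_
  rw [ENNReal.div_le_iff_le_mul (Or.inl (growth_ne_zero M T)) (Or.inl ENNReal.coe_ne_top), mul_comm]
  have h : dM M (Sbar t X) (Sbar t Y) ≤
      ∑ n ∈ Finset.range N, J (Sbar t (c n)) (Sbar t (c (n + 1))) := by
    refine iInf_le_of_le N (iInf_le_of_le (fun n => Sbar t (c n)) ?_)
    exact iInf_le_of_le (congrArg _ h0) (iInf_le_of_le (congrArg _ hN)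
      (iInf_le_of_le (fun n hn => Sbar_mem_HM (hc n hn) ht.1) le_rfl))
  refine h.trans ?_
  rw [Finset.mul_sum]
  refine Finset.sum_le_sum fun n hn => ?_
  have hn' := Finset.mem_range.1 hn
  exact J_Sbar_le (hc n hn'.le) (hc (n + 1) hn') ht

end Contraction

end CamassaHolm

theorem theorem4p7 :
    (∀ X ∈ F,
      IsSolution X (fun t => S t X) ∧
      (∀ Z : ℝ → Triple, IsSolution X Z → ∀ t, 0 ≤ t → SameE (Z t) (S t X)) ∧
      ∀ t, 0 ≤ t → S t X ∈ F) ∧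
    ∀ M T : ℝ, 0 < M → 0 < T →
      ∃ C : ℝ≥0, ∀ Xα ∈ HM M, ∀ Xβ ∈ HM M, ∀ t ∈ Set.Icc 0 T,
        Sbar t Xα ∈ HM M ∧ Sbar t Xβ ∈ HM M ∧
        dM M Xα Xβ ≠ ∞ ∧ dM M (Sbar t Xα) (Sbar t Xβ) ≤ C * dM M Xα Xβ :=
  ⟨fun _ hX => ⟨isSolution_S hX, fun _ hZ _ ht => sameE_S hX hZ ht, fun _ ht => (S_mem_F hX ht).1⟩,
    fun M T _ _ => ⟨growth M T, fun _ hα _ hβ _ ht =>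
      ⟨Sbar_mem_HM hα ht.1, Sbar_mem_HM hβ ht.1, dM_ne_top hα hβ, dM_Sbar_le ht⟩⟩⟩
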